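/- Let $P$ be a finite partial order with $n$ elements, each element $a$ having a weight $\omega(a)\in\mathbb{R}^2$. Let $w$ be the treewidth of the undirected graph underlying the transitive reduction (Hasse diagram) of $P$; that is, the minimum, over all tree-decompositions of this graph, of the maximum bag size minus one (with the convention $w=0$ if $P$ is empty). Let $\mathrm{poly}(P)\subset\mathbb{R}^2$ be the convex hull of the points $\sum_{a\in L}\omega(a)$, where $L$ ranges over all lower sets of $P$. Then $\mathrm{poly}(P)$ has $n^{O(w)}$ vertices and can be constructed in time $n^{O(w)}$, where for $w=0$ (that is, when $P$ is an antichain) this is read as a bound polynomial in $n$. Precisely: there are an absolute constant $C\in\mathbb{N}$ and a single real-RAM program such that, for all $P$, $\omega$, $n$, $w$ as above, (i) $\mathrm{poly}(P)$ has at most $\max(n,2)^{C\max(w,1)}$ vertices, which is $n^{Cw}$ whenever $w\ge 1$ (and then $n\ge2$); (ii) for every numbering of the elements of $P$ by $0,\dots,n-1$, the program, given $n$, the $n\times n$ zero-one matrix of the order relation and the list of weights, halts after at most $\max(n,2)^{C\max(w,1)}$ steps and outputs the list of the vertices of $\mathrm{poly}(P)$ in counterclockwise order, each vertex exactly once. Here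 a real RAM is a machine with integer and real memory cells and indirect addressing, which in unit time can add, subtract or compare two integers, add, subtract, multiply, divide or compare two reals, and read or write a cell. Its only built-in constants are natural numbers. -/

import Mathlib

namespace ParametricClosure

/-! ### Tree-decompositions and treewidth -/

/-- `(T, bag)` is a tree-decomposition of `G`: `T` is a tree, the bags containing any given vertex
of `G` induce a (nonempty) connected subgraph of `T`, and each edge of `G` lies in some bag. -/
structure IsTreeDecomposition {V ι : Type*} (G : SimpleGraph V) (T : SimpleGraph ι)
    (bag : ι → Finset V) : Prop where
  isTree : T.IsTree
  connected : ∀ v : V, (T.induce {i | v ∈ bag i}).Connected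
  edge : ∀ u v : V, G.Adj u v → ∃ i, u ∈ bag i ∧ v ∈ bag i

/-- The width of a tree-decomposition: one less than the largest size of a bag. -/
def decompositionWidth {V ι : Type*} [Fintype ι] (bag : ι → Finset V) : ℕ :=
  (Finset.univ.sup fun i => (bag i).card) - 1

/-- The treewidth of a finite graph: the smallest width of a (finite) tree-decomposition.
(The empty graph gets the value `0`.) -/
noncomputable def treewidth {V : Type*} (G : SimpleGraph V) : ℕ :=
  sInf {k | ∃ (m : ℕ) (T : SimpleGraph (Fin m)) (bag : Fin m → Finset V),
    IsTreeDecomposition G T bag ∧ decompositionWidth bag = k}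

/-! ### The polygon of a weighted partial order -/

open Classical in
/-- The point of the plane that represents a set of elements: the sum of their weights. -/
noncomputable def project {α : Type*} [Fintype α] (wt : α → ℝ × ℝ) (S : Set α) : ℝ × ℝ :=
  ∑ a with a ∈ S, wt a

/-- The convex hull of the points representing the lower sets of the weighted partial order. -/
noncomputable def poly {α : Type*} [Fintype α] [PartialOrder α] (wt : α → ℝ × ℝ) : Set (ℝ × ℝ) :=
  convexHull ℝ {p | ∃ L : LowerSet α, p = project wt (L : Set α)}

/-- The vertices of a convex polygon, which may degenerate to a segment or a point. -/
def vertices (K : Set (ℝ × ℝ)) : Set (ℝ × ℝ) := K.extremePoints ℝ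

/-- Twice the signed area of the triangle `p q r`; positive iff `p q r` turns counterclockwise. -/
def orient (p q r : ℝ × ℝ) : ℝ :=
  (q.1 - p.1) * (r.2 - p.2) - (q.2 - p.2) * (r.1 - p.1)

/-- `v` lists each vertex of the convex polygon `K` exactly once, in counterclockwise order. -/
structure IsVertexList (K : Set (ℝ × ℝ)) {m : ℕ} (v : Fin m → ℝ × ℝ) : Prop where
  injective : Function.Injective v
  range_eq : Set.range v = vertices K
  ccw : ∀ i j k : Fin m, i < j → j < k → 0 < orient (v i) (v j) (v k)

/-! ### A real RAM

A program uses finitely many integer arrays and finitely many real arrays, named by numerals, each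
with cells indexed by `ℕ`, and addressed indirectly.  On integers it can add, subtract (truncated
at `0`) and compare; on reals it can add, subtract, multiply, divide and compare.  The only
constants are natural numbers, and there is no conversion from reals to integers. -/

/-- Memory contents: `s.nat a i` and `s.real a i` are the cells `i` of the arrays named `a`. -/
structure State where
  nat : ℕ → ℕ → ℕ
  real : ℕ → ℕ → ℝ

/-- Integer expressions; `read a i` is the content of cell `i` of the integer array `a`. -/
inductive NExpr where
  | lit (k : ℕ)
  | read (a : ℕ) (i : NExpr)
  | add (x y : NExpr)
  | sub (x y : NExpr)

/-- Real expressions; `read a i` is the content of cell `i` of the real array `a`. -/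
inductive RExpr where
  | lit (k : ℕ)
  | read (a : ℕ) (i : NExpr)
  | add (x y : RExpr)
  | sub (x y : RExpr)
  | mul (x y : RExpr)
  | div (x y : RExpr)

/-- Tests. -/
inductive BExpr where
  | natLe (x y : NExpr)
  | realLe (x y : RExpr)
  | neg (b : BExpr)
  | both (b c : BExpr)

/-- Programs. -/
inductive Prog where
  | skip
  | setNat (a : ℕ) (i x : NExpr)
  | setReal (a : ℕ) (i : NExpr) (x : RExpr)
  | seq (p q : Prog)
  | ite (b : BExpr) (p q : Prog)
  | loop (b : BExpr) (p : Prog)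

/-- The value of an integer expression. -/
def NExpr.eval (s : State) : NExpr → ℕ
  | .lit k => k
  | .read a i => s.nat a (i.eval s)
  | .add x y => x.eval s + y.eval s
  | .sub x y => x.eval s - y.eval s

/-- The time to evaluate an integer expression: one step per operation. -/
def NExpr.cost : NExpr → ℕ
  | .lit _ => 1
  | .read _ i => i.cost + 1
  | .add x y => x.cost + y.cost + 1
  | .sub x y => x.cost + y.cost + 1

/-- The value of a real expression. -/
noncomputable def RExpr.eval (s : State) : RExpr → ℝ
  | .lit k => k
  | .read a i => s.real a (i.eval s)
  | .add x y => x.eval s + y.eval s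
  | .sub x y => x.eval s - y.eval s
  | .mul x y => x.eval s * y.eval s
  | .div x y => x.eval s / y.eval s

/-- The time to evaluate a real expression: one step per operation. -/
def RExpr.cost : RExpr → ℕ
  | .lit _ => 1
  | .read _ i => i.cost + 1
  | .add x y => x.cost + y.cost + 1
  | .sub x y => x.cost + y.cost + 1
  | .mul x y => x.cost + y.cost + 1
  | .div x y => x.cost + y.cost + 1

/-- The outcome of a test. -/
def BExpr.eval (s : State) : BExpr → Prop
  | .natLe x y => x.eval s ≤ y.eval s
  | .realLe x y => x.eval s ≤ y.eval s
  | .neg b => ¬ b.eval s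
  | .both b c => b.eval s ∧ c.eval s

/-- The time to evaluate a test: one step per operation. -/
def BExpr.cost : BExpr → ℕ
  | .natLe x y => x.cost + y.cost + 1
  | .realLe x y => x.cost + y.cost + 1
  | .neg b => b.cost + 1
  | .both b c => b.cost + c.cost + 1

/-- Overwrite cell `i` of the integer array `a`. -/
def State.setNat (s : State) (a i x : ℕ) : State :=
  { s with nat := Function.update s.nat a (Function.update (s.nat a) i x) }

/-- Overwrite cell `i` of the real array `a`. -/
noncomputable def State.setReal (s : State) (a i : ℕ) (x : ℝ) : State :=
  { s with real := Function.update s.real a (Function.update (s.real a) i x) }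

/-- `Exec p s s' t`: the program `p`, started in memory `s`, halts after exactly `t` steps in
memory `s'`. -/
inductive Exec : Prog → State → State → ℕ → Prop where
  | skip (s : State) : Exec .skip s s 1
  | setNat (a : ℕ) (i x : NExpr) (s : State) :
      Exec (.setNat a i x) s (s.setNat a (i.eval s) (x.eval s)) (i.cost + x.cost + 1)
  | setReal (a : ℕ) (i : NExpr) (x : RExpr) (s : State) :
      Exec (.setReal a i x) s (s.setReal a (i.eval s) (x.eval s)) (i.cost + x.cost + 1)
  | seq {p q : Prog} {s s' s'' : State} {t t' : ℕ} (hp : Exec p s s' t) (hq : Exec q s' s'' t') :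
      Exec (.seq p q) s s'' (t + t')
  | iteTrue {b : BExpr} {p q : Prog} {s s' : State} {t : ℕ} (hb : b.eval s) (hp : Exec p s s' t) :
      Exec (.ite b p q) s s' (b.cost + t + 1)
  | iteFalse {b : BExpr} {p q : Prog} {s s' : State} {t : ℕ} (hb : ¬ b.eval s)
      (hq : Exec q s s' t) : Exec (.ite b p q) s s' (b.cost + t + 1)
  | loopDone {b : BExpr} {p : Prog} {s : State} (hb : ¬ b.eval s) :
      Exec (.loop b p) s s (b.cost + 1)
  | loopStep {b : BExpr} {p : Prog} {s s' s'' : State} {t t' : ℕ} (hb : b.eval s)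
      (hp : Exec p s s' t) (hl : Exec (.loop b p) s' s'' t') :
      Exec (.loop b p) s s'' (b.cost + t + t' + 1)

/-! ### Input and output conventions -/

open Classical in
/-- The initial memory for a weighted partial order whose elements are numbered `0, …, n - 1`.
Cell `0` of the integer array `0` holds `n`; the integer array `1` holds the `n × n` zero-one matrix
of the order relation, row by row; the real array `0` holds the weights
`x₀, y₀, x₁, y₁, …`.  All other cells hold `0`. -/
noncomputable def inputState {α : Type*} [PartialOrder α] {n : ℕ} (e : Fin n ≃ α)
    (wt : α → ℝ × ℝ) : State where
  nat a k :=
    if a = 0 ∧ k = 0 then n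
    else if a = 1 ∧ ∃ i j : Fin n, k = i * n + j ∧ e i ≤ e j then 1
    else 0
  real a k :=
    if h : a = 0 ∧ k / 2 < n then
      if k % 2 = 0 then (wt (e ⟨k / 2, h.2⟩)).1 else (wt (e ⟨k / 2, h.2⟩)).2
    else 0

/-- The list of points that a halting computation leaves as its output: its length `m` is in cell
`0` of the integer array `0`, and the real array `0` holds `x₀, y₀, …, x_{m-1}, y_{m-1}`. -/
def output (s : State) : Fin (s.nat 0 0) → ℝ × ℝ :=
  fun i => (s.real 0 (2 * i), s.real 0 (2 * i + 1))

end ParametricClosure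

open ParametricClosure

open ParametricClosure

namespace ParametricClosure

/-! ### A program logic with time bounds -/

/-! The treewidth enters only through the number of vertices; the program never sees a
tree-decomposition.

Counting. A set is a lower set iff it is closed under cover relations, so all constraints sit on
edges of the Hasse diagram. Some bag of a tree-decomposition, of at most `w + 1` elements, leaves
only parts with at most half of the elements (`IsTreeDecomposition.exists_separator`). Once it is
decided which elements of the bag are present, in at most `2 ^ (w + 1)` ways, the parts are
independent, and the representable points form a Minkowski sum. In the plane, the number of upper
hull vertices minus one is subadditive under Minkowski sums (`card_upper_add_le`), and the number
itself is subadditive under unions. A recursion that carries along the set `A` of decisions made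
elsewhere yields at most `(2 * m) ^ (w + 2) + 1` upper points for `m` elements
(`card_upper_extensionPoints_le`). The lower hull is the upper hull for the negated weights.

Optimizing. To maximize a linear functional over the polygon is to find a lower set of maximum
weight, which is done by a push-relabel method. Weight flows from an element to smaller ones, along
arcs of infinite capacity. There are no extra source and sink: positive excess is the supply, and
deficits, which occur only at height `0`, are the demand. One of the levels `1, …, n + 1` is
unoccupied; residual arcs descend by at most one level, so none crosses it, and the elements above
it form an optimal lower set (`IsPreflow.isMax`). The argument works over any ordered abelian group.
Taking pairs of reals in lexicographic order lets a second functional break ties, so that the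
optimum is a vertex (`mem_vertices_of_lexValue_le`).

Constructing. The boundary is traversed counterclockwise from the lowest vertex. The optimizer is
called in the direction normal to the segment from the last listed vertex to the next known one:
either it finds a new vertex to the right of the segment, to be inserted, or the segment supports
the polygon and the traversal advances (`hullStep_spec`). Each call makes progress, so about twice
as many calls as vertices suffice, each of cost `O(n ^ 5)` (`polygonProgram_spec`). -/

@[simp] theorem State.setNat_real (s : State) (a i x : ℕ) : (s.setNat a i x).real = s.real := rfl

@[simp] theorem State.setReal_nat (s : State) (a i : ℕ) (x : ℝ) :
    (s.setReal a i x).nat = s.nat := rfl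

@[simp] theorem State.setNat_nat (s : State) (a i x b j : ℕ) :
    (s.setNat a i x).nat b j = if b = a ∧ j = i then x else s.nat b j := by
  unfold State.setNat
  by_cases hb : b = a
  · subst hb
    by_cases hj : j = i <;> simp [hj]
  · simp [hb]

@[simp] theorem State.setReal_real (s : State) (a i : ℕ) (x : ℝ) (b j : ℕ) :
    (s.setReal a i x).real b j = if b = a ∧ j = i then x else s.real b j := by
  unfold State.setReal
  by_cases hb : b = a
  · subst hb
    by_cases hj : j = i <;> simp [hj]
  · simp [hb]

/-- Cell `0` of an integer array, used as an integer register. -/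
abbrev NExpr.reg (a : ℕ) : NExpr := .read a (.lit 0)

/-- Cell `0` of a real array, used as a real register. -/
abbrev RExpr.reg (a : ℕ) : RExpr := .read a (.lit 0)

/-- The program `p` started in `s` halts within `T` steps in a state satisfying `Q`. -/
def HaltsWithin (p : Prog) (T : ℕ) (Q : State → Prop) (s : State) : Prop :=
  ∃ s' t, Exec p s s' t ∧ t ≤ T ∧ Q s'

namespace HaltsWithin

variable {p q : Prog} {T T' : ℕ} {Q R : State → Prop} {s : State}

theorem mono (h : HaltsWithin p T Q s) (hT : T ≤ T') (hQ : ∀ s', Q s' → R s') :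
    HaltsWithin p T' R s := by
  obtain ⟨s', t, he, ht, hq⟩ := h
  exact ⟨s', t, he, ht.trans hT, hQ _ hq⟩

theorem skip (hT : 1 ≤ T) (h : Q s) : HaltsWithin .skip T Q s := ⟨s, 1, .skip s, hT, h⟩

theorem setNat {a : ℕ} {i x : NExpr} (hT : i.cost + x.cost + 1 ≤ T)
    (h : Q (s.setNat a (i.eval s) (x.eval s))) : HaltsWithin (.setNat a i x) T Q s :=
  ⟨_, _, .setNat a i x s, hT, h⟩

theorem setReal {a : ℕ} {i : NExpr} {x : RExpr} (hT : i.cost + x.cost + 1 ≤ T)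
    (h : Q (s.setReal a (i.eval s) (x.eval s))) : HaltsWithin (.setReal a i x) T Q s :=
  ⟨_, _, .setReal a i x s, hT, h⟩

theorem seq (h : HaltsWithin p T (HaltsWithin q T' Q) s) : HaltsWithin (p.seq q) (T + T') Q s := by
  obtain ⟨s', t, he, ht, s'', t', he', ht', hq⟩ := h
  exact ⟨s'', t + t', .seq he he', by omega, hq⟩

theorem ite {b : BExpr} (hT : b.cost + T + 1 ≤ T') (hp : b.eval s → HaltsWithin p T Q s)
    (hq : ¬ b.eval s → HaltsWithin q T Q s) : HaltsWithin (.ite b p q) T' Q s := by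
  by_cases hb : b.eval s
  · obtain ⟨s', t, he, ht, h⟩ := hp hb
    exact ⟨s', _, .iteTrue hb he, by omega, h⟩
  · obtain ⟨s', t, he, ht, h⟩ := hq hb
    exact ⟨s', _, .iteFalse hb he, by omega, h⟩

/-- The rule for loops: `I j` is an invariant that allows at most `j` more rounds. -/
theorem loop {b : BExpr} (I : ℕ → State → Prop) (k : ℕ) (h0 : I k s)
    (hdone : ∀ s, I 0 s → ¬ b.eval s)
    (hstep : ∀ j s, I (j + 1) s → b.eval s → HaltsWithin p T (I j) s) :
    HaltsWithin (.loop b p) (k * (b.cost + T + 1) + b.cost + 1)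
      (fun s' => (∃ j, I j s') ∧ ¬ b.eval s') s := by
  induction k generalizing s with
  | zero => exact ⟨s, _, .loopDone (hdone s h0), by omega, ⟨0, h0⟩, hdone s h0⟩
  | succ k ih =>
    by_cases hb : b.eval s
    · obtain ⟨s', t, he, ht, hI⟩ := hstep k s h0 hb
      obtain ⟨s'', t', he', ht', hq⟩ := ih hI
      refine ⟨s'', _, .loopStep hb he he', ?_, hq⟩
      rw [Nat.succ_mul]; omega
    · exact ⟨s, _, .loopDone hb, by rw [Nat.succ_mul]; omega, ⟨_, h0⟩, hb⟩

end HaltsWithin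

/-- The integer arrays that a program may write to. -/
def Prog.natArrays : Prog → List ℕ
  | .skip => []
  | .setNat a _ _ => [a]
  | .setReal _ _ _ => []
  | .seq p q => p.natArrays ++ q.natArrays
  | .ite _ p q => p.natArrays ++ q.natArrays
  | .loop _ p => p.natArrays

/-- The real arrays that a program may write to. -/
def Prog.realArrays : Prog → List ℕ
  | .skip => []
  | .setNat _ _ _ => []
  | .setReal a _ _ => [a]
  | .seq p q => p.realArrays ++ q.realArrays
  | .ite _ p q => p.realArrays ++ q.realArrays
  | .loop _ p => p.realArrays

/-- Two states agree on all arrays that `p` does not write to. -/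
structure Frame (p : Prog) (s s' : State) : Prop where
  nat : ∀ a, a ∉ p.natArrays → s'.nat a = s.nat a
  real : ∀ a, a ∉ p.realArrays → s'.real a = s.real a

/-- Specifications of subroutines state only what is computed; that other arrays survive is read off
from the lists of written arrays, in which membership is decidable. -/
theorem Exec.frame {p : Prog} {s s' : State} {t : ℕ} (h : Exec p s s' t) : Frame p s s' := by
  induction h with
  | skip s => exact ⟨fun _ _ => rfl, fun _ _ => rfl⟩
  | setNat a i x s =>
    refine ⟨fun b hb => ?_, fun _ _ => rfl⟩
    have : b ≠ a := by simpa [Prog.natArrays] using hb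
    funext j; simp [this]
  | setReal a i x s =>
    refine ⟨fun _ _ => rfl, fun b hb => ?_⟩
    have : b ≠ a := by simpa [Prog.realArrays] using hb
    funext j; simp [this]
  | seq hp hq ihp ihq =>
    constructor
    · intro a ha
      simp only [Prog.natArrays, List.mem_append, not_or] at ha
      rw [ihq.nat a ha.2, ihp.nat a ha.1]
    · intro a ha
      simp only [Prog.realArrays, List.mem_append, not_or] at ha
      rw [ihq.real a ha.2, ihp.real a ha.1]
  | iteTrue hb hp ih =>
    constructor
    · intro a ha
      simp only [Prog.natArrays, List.mem_append, not_or] at ha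
      exact ih.nat a ha.1
    · intro a ha
      simp only [Prog.realArrays, List.mem_append, not_or] at ha
      exact ih.real a ha.1
  | iteFalse hb hp ih =>
    constructor
    · intro a ha
      simp only [Prog.natArrays, List.mem_append, not_or] at ha
      exact ih.nat a ha.2
    · intro a ha
      simp only [Prog.realArrays, List.mem_append, not_or] at ha
      exact ih.real a ha.2
  | loopDone hb => exact ⟨fun _ _ => rfl, fun _ _ => rfl⟩
  | loopStep hb hp hl ihp ihl =>
    exact ⟨fun a ha => (ihl.nat a ha).trans (ihp.nat a ha),
      fun a ha => (ihl.real a ha).trans (ihp.real a ha)⟩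

theorem HaltsWithin.frame {p : Prog} {T : ℕ} {Q : State → Prop} {s : State}
    (h : HaltsWithin p T Q s) : HaltsWithin p T (fun s' => Q s' ∧ Frame p s s') s := by
  obtain ⟨s', t, he, ht, hq⟩ := h
  exact ⟨s', t, he, ht, hq, he.frame⟩

/-- `for i := 0 to m - 1 do p`, with the loop variable in cell `0` of the integer array `i`. -/
def Prog.forLoop (i : ℕ) (m : NExpr) (p : Prog) : Prog :=
  .seq (.setNat i (.lit 0) (.lit 0))
    (.loop (.natLe (.add (.reg i) (.lit 1)) m)
      (.seq p (.setNat i (.lit 0) (.add (.reg i) (.lit 1)))))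

/-- The rule for `for` loops.  The bound evaluates to `k` in every state that satisfies the
invariant. -/
theorem HaltsWithin.forLoop {i : ℕ} {m : NExpr} {p : Prog} {T k : ℕ} {s : State}
    (I : ℕ → State → Prop) (hi : i ∉ p.natArrays)
    (h0 : I 0 (s.setNat i 0 0))
    (hm : ∀ j s, I j s → m.eval s = k)
    (hstep : ∀ j s, j < k → I j s → s.nat i 0 = j →
      HaltsWithin p T (fun s' => I (j + 1) (s'.setNat i 0 (j + 1))) s) :
    HaltsWithin (.forLoop i m p) (k * (m.cost + T + 12) + m.cost + 9) (I k) s := by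
  have key : HaltsWithin
      (.loop (.natLe (.add (.reg i) (.lit 1)) m)
        (.seq p (.setNat i (.lit 0) (.add (.reg i) (.lit 1)))))
      (k * (m.cost + T + 12) + m.cost + 6)
      (I k) (s.setNat i 0 0) := by
    have := HaltsWithin.loop (b := .natLe (.add (.reg i) (.lit 1)) m)
      (p := .seq p (.setNat i (.lit 0) (.add (.reg i) (.lit 1)))) (T := T + 6)
      (s := s.setNat i 0 0)
      -- Here `r` counts the remaining rounds, whereas `I` counts the finished ones.
      (fun r s => r ≤ k ∧ I (k - r) s ∧ s.nat i 0 = k - r) k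
      (by simpa using h0) ?_ ?_
    · refine this.mono ?_ ?_
      · simp only [BExpr.cost, NExpr.cost]
        rw [show 1 + 1 + 1 + 1 + m.cost + 1 + (T + 6) + 1 = m.cost + T + 12 by omega]
        omega
      · rintro s' ⟨⟨j, hj, hI, hr⟩, hb⟩
        simp only [BExpr.eval, NExpr.eval, hm _ _ hI, hr] at hb
        have : j = 0 := by omega
        simpa [this] using hI
    · rintro s' ⟨-, hI, hr⟩ hb
      simp only [BExpr.eval, NExpr.eval, hm _ _ hI, hr] at hb
      omega
    · rintro j s' ⟨hj, hI, hr⟩ -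
      refine HaltsWithin.seq ?_
      refine ((hstep _ s' (by omega) hI hr).frame).mono le_rfl ?_
      rintro s'' ⟨hI', hf⟩
      refine HaltsWithin.setNat (by simp [NExpr.cost]) ?_
      have e : s''.nat i 0 = k - (j + 1) := by rw [hf.nat i hi, hr]
      have e2 : k - (j + 1) + 1 = k - j := by omega
      simp only [NExpr.eval, e, e2] at hI' ⊢
      exact ⟨by omega, hI', by simp⟩
  exact (HaltsWithin.seq (T := 3) (HaltsWithin.setNat (by simp [NExpr.cost]) key)).mono
    (by omega) fun _ h => h

/-! ### Maximum-weight lower sets by preflows -/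

section Preflow

set_option linter.unusedSectionVars false

variable {Λ : Type*} [AddCommGroup Λ] [LinearOrder Λ] [IsOrderedAddMonoid Λ]

/-- A preflow with valid heights for the problem to find a maximum-weight lower set of the order
`le` on `{0, …, n - 1}`: the weights `c` have been moved downwards along the flow `f`, which leaves
the excesses `e`; each residual arc descends by at most `1` in the heights `h`. -/
structure IsPreflow (n : ℕ) (le : ℕ → ℕ → Prop) (c e : ℕ → Λ) (f : ℕ → ℕ → Λ) (h : ℕ → ℕ) :
    Prop where
  nonneg : ∀ u < n, ∀ v < n, 0 ≤ f u v
  support : ∀ u < n, ∀ v < n, f u v ≠ 0 → le v u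
  height : ∀ u < n, ∀ v < n, (le v u ∨ 0 < f v u) → h u ≤ h v + 1
  deficit : ∀ u < n, e u < 0 → h u = 0
  bounded : ∀ u < n, h u ≤ n + 1
  balance : ∀ u < n, e u = c u + ∑ v ∈ Finset.range n, (f v u - f u v)

namespace IsPreflow

variable {n : ℕ} {le : ℕ → ℕ → Prop} {c e e' : ℕ → Λ} {f f' : ℕ → ℕ → Λ} {h h' : ℕ → ℕ}

theorem init (n : ℕ) (le : ℕ → ℕ → Prop) {c e : ℕ → Λ} {f : ℕ → ℕ → Λ} {h : ℕ → ℕ}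
    (he : ∀ u < n, e u = c u) (hf : ∀ u < n, ∀ v < n, f u v = 0) (hh : ∀ u < n, h u = 0) :
    IsPreflow n le c e f h where
  nonneg u hu v hv := (hf u hu v hv).ge
  support u hu v hv h0 := absurd (hf u hu v hv) h0
  height u hu v hv _ := by simp [hh u hu]
  deficit u hu _ := hh u hu
  bounded u hu := by simp [hh u hu]
  balance u hu := by
    rw [he u hu, Finset.sum_eq_zero, add_zero]
    intro v hv
    have hv := Finset.mem_range.1 hv
    simp [hf u hu v hv, hf v hv u hu]

/-- Moving the amount `δ` of excess from `u` to `v`, which lies one level lower. -/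
theorem push (H : IsPreflow n le c e f h) {u v : ℕ} (hu : u < n) (hv : v < n)
    (huv : h u = h v + 1) {δ : Λ} (hδ : 0 ≤ δ) (hδe : δ ≤ e u)
    (heu : e' u = e u - δ) (hev : e' v = e v + δ)
    (he : ∀ x < n, x ≠ u → x ≠ v → e' x = e x)
    (hnonneg : ∀ x < n, ∀ y < n, 0 ≤ f' x y)
    (hsupp : ∀ x < n, ∀ y < n, f' x y ≠ 0 → le y x)
    (hpos : ∀ x < n, ∀ y < n, 0 < f' x y → 0 < f x y ∨ x = u ∧ y = v)
    (hnet : f' u v - f' v u = f u v - f v u + δ)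
    (hf : ∀ x < n, ∀ y < n, ¬ (x = u ∧ y = v) → ¬ (x = v ∧ y = u) → f' x y = f x y) :
    IsPreflow n le c e' f' h where
  nonneg := hnonneg
  support := hsupp
  height x hx y hy hr := by
    rcases hr with hr | hr
    · exact H.height x hx y hy (.inl hr)
    -- The only residual arc that a push can create runs from `v` up to `u`, and ascending arcs are
    -- harmless.
    · rcases hpos y hy x hx hr with hr | ⟨rfl, rfl⟩
      · exact H.height x hx y hy (.inr hr)
      · omega
  deficit x hx hlt := by
    by_cases h1 : x = u
    · subst h1
      rw [heu] at hlt
      exact absurd hlt (by simpa using hδe)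
    by_cases h2 : x = v
    · subst h2
      rw [hev] at hlt
      exact H.deficit x hx (lt_of_le_of_lt (by simpa using hδ) hlt)
    · exact H.deficit x hx (he x hx h1 h2 ▸ hlt)
  bounded := H.bounded
  balance x hx := by
    have huv' : u ≠ v := by rintro rfl; omega
    have key : ∀ (x z : ℕ), z < n → (∀ y < n, y ≠ z → f' y x - f' x y = f y x - f x y) →
        ∑ y ∈ Finset.range n, (f' y x - f' x y)
          = ∑ y ∈ Finset.range n, (f y x - f x y) + ((f' z x - f' x z) - (f z x - f x z)) := by
      intro x z hz hy
      have hz' := Finset.mem_range.2 hz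
      rw [← Finset.add_sum_erase _ _ hz', ← Finset.add_sum_erase _ _ hz']
      rw [Finset.sum_congr rfl (g := fun y => f y x - f x y)]
      · abel
      · intro y hy'
        rw [Finset.mem_erase, Finset.mem_range] at hy'
        exact hy y hy'.2 hy'.1
    by_cases h1 : x = u
    · subst h1
      rw [heu, H.balance x hu, key x v hv]
      · have : f' v x - f' x v - (f v x - f x v) = -δ := by
          rw [← neg_sub (f' x v), hnet]; abel
        rw [this]; abel
      · intro y hy hyv
        rw [hf y hy x hx (by tauto) (by tauto), hf x hx y hy (by tauto) (by tauto)]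
    by_cases h2 : x = v
    · subst h2
      rw [hev, H.balance x hv, key x u hu]
      · rw [hnet]; abel
      · intro y hy hyv
        rw [hf y hy x hx (by tauto) (by tauto), hf x hx y hy (by tauto) (by tauto)]
    · rw [he x hx h1 h2, H.balance x hx]
      congr 1
      refine Finset.sum_congr rfl fun y hy => ?_
      have hy := Finset.mem_range.1 hy
      rw [hf y hy x hx (by tauto) (by tauto), hf x hx y hy (by tauto) (by tauto)]

/-- Raising a vertex of positive excess that has no admissible residual arc. -/
theorem relabel (H : IsPreflow n le c e f h) {u : ℕ} (hu : u < n) (hun : h u ≤ n) (heu : 0 < e u)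
    (hadm : ∀ v < n, (le v u ∨ 0 < f v u) → h u ≠ h v + 1)
    (hhu : h' u = h u + 1) (hh : ∀ x < n, x ≠ u → h' x = h x) :
    IsPreflow n le c e f h' where
  nonneg := H.nonneg
  support := H.support
  balance := H.balance
  height x hx y hy hr := by
    have h0 := H.height x hx y hy hr
    by_cases h1 : x = u
    · subst h1
      have := hadm y hy hr
      by_cases h2 : y = x
      · subst h2; omega
      · rw [hhu, hh y hy h2]; omega
    · rw [hh x hx h1]
      by_cases h2 : y = u
      · subst h2; omega
      · rw [hh y hy h2]; omega
  deficit x hx hlt := by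
    by_cases h1 : x = u
    · subst h1; exact absurd hlt heu.le.not_gt
    · rw [hh x hx h1]; exact H.deficit x hx hlt
  bounded x hx := by
    by_cases h1 : x = u
    · subst h1; omega
    · rw [hh x hx h1]; exact H.bounded x hx

/-- As the program never lowers a vertex, this caps the number of raises and thereby the number of
sweeps. -/
theorem sum_height_le (H : IsPreflow n le c e f h) :
    ∑ u ∈ Finset.range n, h u ≤ n * (n + 1) := by
  calc ∑ u ∈ Finset.range n, h u ≤ ∑ _u ∈ Finset.range n, (n + 1) :=
        Finset.sum_le_sum fun u hu => H.bounded u (Finset.mem_range.1 hu)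
    _ = n * (n + 1) := by simp

/-- Some level between `1` and `n + 1` is unoccupied. -/
theorem exists_gap (n : ℕ) (h : ℕ → ℕ) :
    ∃ g, 1 ≤ g ∧ g ≤ n + 1 ∧ ∀ u < n, h u ≠ g := by
  by_contra hcon
  push Not at hcon
  have : (Finset.Icc 1 (n + 1)) ⊆ (Finset.range n).image h := by
    intro g hg
    rw [Finset.mem_Icc] at hg
    obtain ⟨u, hu, rfl⟩ := hcon g hg.1 hg.2
    exact Finset.mem_image_of_mem _ (Finset.mem_range.2 hu)
  have := (Finset.card_le_card this).trans Finset.card_image_le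
  simp at this

/-- Flow between two elements of `L` cancels; only flow across the boundary of `L` remains. -/
theorem sum_excess (H : IsPreflow n le c e f h) {L : Finset ℕ} (hL : L ⊆ Finset.range n) :
    ∑ u ∈ L, e u = ∑ u ∈ L, c u + ∑ u ∈ L, ∑ v ∈ Finset.range n \ L, (f v u - f u v) := by
  have h1 : ∑ u ∈ L, ∑ v ∈ L, (f v u - f u v) = 0 := by
    simp only [Finset.sum_sub_distrib]
    rw [Finset.sum_comm, sub_self]
  rw [Finset.sum_congr rfl fun u hu => H.balance u (Finset.mem_range.1 (hL hu)),
    Finset.sum_add_distrib]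
  congr 1
  simp_rw [← Finset.sum_sdiff hL]
  rw [Finset.sum_add_distrib, h1, add_zero]

/-- When all excess lies below height `1` or at height `n + 1`, the vertices above an unoccupied
level form a maximum-weight lower set. -/
theorem isMax (H : IsPreflow n le c e f h) (hdone : ∀ u < n, h u ≤ n → e u ≤ 0) {g : ℕ}
    (hg1 : 1 ≤ g) (hg2 : g ≤ n + 1) (hg : ∀ u < n, h u ≠ g) {L : Finset ℕ}
    (hL : ∀ u, u ∈ L ↔ u < n ∧ g < h u) :
    (∀ u ∈ L, ∀ v < n, le v u → v ∈ L) ∧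
      ∀ M ⊆ Finset.range n, (∀ u ∈ M, ∀ v < n, le v u → v ∈ M) →
        ∑ u ∈ M, c u ≤ ∑ u ∈ L, c u := by
  -- A residual arc descends by at most one level, so it cannot jump over the empty level `g`.
  have hcut : ∀ u ∈ L, ∀ v < n, v ∉ L → ¬ (le v u ∨ 0 < f v u) := by
    intro u hu v hv hvL hr
    have h1 := H.height u ((hL u).1 hu).1 v hv hr
    have h2 := ((hL u).1 hu).2
    have h3 := hg v hv
    have h4 : ¬ g < h v := fun h => hvL ((hL v).2 ⟨hv, h⟩)
    omega
  have hlow : ∀ u ∈ L, ∀ v < n, le v u → v ∈ L := by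
    intro u hu v hv hr
    by_contra hvL
    exact hcut u hu v hv hvL (.inl hr)
  refine ⟨hlow, fun M hMn hM => ?_⟩
  have hLn : L ⊆ Finset.range n := fun u hu => Finset.mem_range.2 ((hL u).1 hu).1
  -- Flow runs only to smaller elements, so none leaves a lower set.
  have hout : ∀ M : Finset ℕ, M ⊆ Finset.range n → (∀ u ∈ M, ∀ v < n, le v u → v ∈ M) →
      ∀ u ∈ M, ∀ v ∈ Finset.range n \ M, f u v = 0 := by
    intro M hMn hM u hu v hv
    rw [Finset.mem_sdiff, Finset.mem_range] at hv
    by_contra h0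
    exact hv.2 (hM u hu v hv.1 (H.support u (Finset.mem_range.1 (hMn hu)) v hv.1 h0))
  -- Flow into `L` would be the reverse of a residual arc out of `L`. So the excess of `L` equals
  -- its weight, while that of any other lower set is at least its weight.
  have e1 : ∑ u ∈ L, ∑ v ∈ Finset.range n \ L, (f v u - f u v) = 0 := by
    refine Finset.sum_eq_zero fun u hu => Finset.sum_eq_zero fun v hv => ?_
    rw [hout L hLn hlow u hu v hv, sub_zero]
    rw [Finset.mem_sdiff, Finset.mem_range] at hv
    have h1 := H.nonneg v hv.1 u ((hL u).1 hu).1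
    have h2 := hcut u hu v hv.1 hv.2
    push Not at h2
    exact le_antisymm h2.2 h1
  have e2 : 0 ≤ ∑ u ∈ M, ∑ v ∈ Finset.range n \ M, (f v u - f u v) := by
    refine Finset.sum_nonneg fun u hu => Finset.sum_nonneg fun v hv => ?_
    rw [hout M hMn hM u hu v hv, sub_zero]
    rw [Finset.mem_sdiff, Finset.mem_range] at hv
    exact H.nonneg v hv.1 u (Finset.mem_range.1 (hMn hu))
  have s1 := H.sum_excess hLn
  have s2 := H.sum_excess hMn
  rw [e1, add_zero] at s1
  calc ∑ u ∈ M, c u ≤ ∑ u ∈ M, e u := by rw [s2]; simpa using e2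
    -- Elements outside `L` lie below `g`, hence at height at most `n`, and have no positive excess;
    -- elements of `L` have positive height, hence no deficit.
    _ ≤ ∑ u ∈ L, e u := by
      rw [← Finset.sum_inter_add_sum_sdiff M L, ← Finset.sum_inter_add_sum_sdiff L M,
        Finset.inter_comm L M]
      refine add_le_add le_rfl ?_
      refine (Finset.sum_nonpos fun u hu => ?_).trans (Finset.sum_nonneg fun u hu => ?_)
      · rw [Finset.mem_sdiff] at hu
        have hun := Finset.mem_range.1 (hMn hu.1)
        have : ¬ g < h u := fun h => hu.2 ((hL u).2 ⟨hun, h⟩)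
        have := hg u hun
        exact hdone u hun (by omega)
      · rw [Finset.mem_sdiff] at hu
        have := (hL u).1 hu.1
        by_contra hlt
        have := H.deficit u this.1 (not_le.1 hlt)
        omega
    _ = ∑ u ∈ L, c u := s1

end IsPreflow

end Preflow

/-! ### The program for maximum-weight lower sets

Integer arrays: `0` the number `n`, `1` the order matrix, `2` the row offsets `u * n`, `3` heights,
`4` a flag for changes, `5` the current round of a sweep, `6` and `7` the current vertices `u`, `v`,
`8` an unoccupied level, `9` a flag for occupied levels.
Real arrays: `0` weights, `1` and `2` excesses, `3` and `4` flow, `5` and `6` the amount to push,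
`7` to `10` the primary and secondary directions, `11` and `12` the resulting point.
Excesses and flow are pairs of reals, compared lexicographically. -/

/-- A sequence of programs. -/
def Prog.block : List Prog → Prog
  | [] => .skip
  | p :: ps => .seq p (block ps)

theorem HaltsWithin.nil {Q : State → Prop} {s : State} (h : Q s) :
    HaltsWithin (.block []) 1 Q s := HaltsWithin.skip le_rfl h

theorem HaltsWithin.cons {p : Prog} {ps : List Prog} {T T' : ℕ} {Q : State → Prop} {s : State}
    (h : HaltsWithin p T (HaltsWithin (.block ps) T' Q) s) :
    HaltsWithin (.block (p :: ps)) (T + T') Q s := HaltsWithin.seq h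

/-- Executing an assignment of a real at the front of a block. -/
theorem HaltsWithin.cons_setReal {a : ℕ} {i : NExpr} {x : RExpr} {ps : List Prog} {T : ℕ}
    {Q : State → Prop} {s : State}
    (h : HaltsWithin (.block ps) T Q (s.setReal a (i.eval s) (x.eval s))) :
    HaltsWithin (.block (.setReal a i x :: ps)) (i.cost + x.cost + 1 + T) Q s :=
  .cons (.setReal le_rfl h)

/-- Executing an assignment of an integer at the front of a block. -/
theorem HaltsWithin.cons_setNat {a : ℕ} {i x : NExpr} {ps : List Prog} {T : ℕ}
    {Q : State → Prop} {s : State}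
    (h : HaltsWithin (.block ps) T Q (s.setNat a (i.eval s) (x.eval s))) :
    HaltsWithin (.block (.setNat a i x :: ps)) (i.cost + x.cost + 1 + T) Q s :=
  .cons (.setNat le_rfl h)

/-- Lexicographic comparison of the pairs `(x, y)` and `(x', y')`. -/
def BExpr.lexLe (x y x' y' : RExpr) : BExpr :=
  .both (.realLe x x') (.neg (.both (.realLe x' x) (.neg (.realLe y y'))))

theorem BExpr.lexLe_eval {x y x' y' : RExpr} {s : State} :
    (BExpr.lexLe x y x' y').eval s ↔
      toLex (x.eval s, y.eval s) ≤ toLex (x'.eval s, y'.eval s) := by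
  simp only [BExpr.lexLe, BExpr.eval, Prod.Lex.toLex_le_toLex]
  constructor
  · rintro ⟨h1, h2⟩
    rcases h1.lt_or_eq with h | h
    · exact .inl h
    · exact .inr ⟨h, by_contra fun h3 => h2 ⟨h.ge, h3⟩⟩
  · rintro (h | ⟨h1, h2⟩)
    · exact ⟨h.le, fun h3 => absurd h3.1 h.not_ge⟩
    · exact ⟨h1.le, fun h3 => h3.2 h2⟩

/-- The excess of `u`. -/
def State.excess (s : State) (u : ℕ) : Lex (ℝ × ℝ) := toLex (s.real 1 u, s.real 2 u)

/-- The flow from `u` to `v`. -/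
def State.flow (s : State) (n u v : ℕ) : Lex (ℝ × ℝ) :=
  toLex (s.real 3 (u * n + v), s.real 4 (u * n + v))

/-- Guarantees that writing one entry of a matrix stored by rows leaves the other entries alone. -/
theorem mul_add_inj {n u v x y : ℕ} (hv : v < n) (hy : y < n) :
    x * n + y = u * n + v ↔ x = u ∧ y = v := by
  constructor
  · intro h
    have h1 := congrArg (· / n) h
    have h2 := congrArg (· % n) h
    have hn : 0 < n := by omega
    simp only [Nat.mod_eq_of_lt hv, Nat.mod_eq_of_lt hy,
      mul_comm _ n, Nat.mul_add_div hn, Nat.div_eq_of_lt hv,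
      Nat.div_eq_of_lt hy, add_zero, Nat.mul_add_mod] at h1 h2
    exact ⟨h1, h2⟩
  · rintro ⟨rfl, rfl⟩; rfl

/-- The parts of the memory that describe the order relation `le` on `{0, …, n - 1}`. -/
structure OrderMem (n : ℕ) (le : ℕ → ℕ → Prop) (s : State) : Prop where
  size : s.nat 0 0 = n
  matrix : ∀ u < n, ∀ v < n, 1 ≤ s.nat 1 (u * n + v) ↔ le u v
  row : ∀ u < n, s.nat 2 u = u * n

theorem OrderMem.congr {n : ℕ} {le : ℕ → ℕ → Prop} {s s' : State} (h : OrderMem n le s)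
    (h0 : s'.nat 0 = s.nat 0) (h1 : s'.nat 1 = s.nat 1) (h2 : s'.nat 2 = s.nat 2) :
    OrderMem n le s' :=
  ⟨by rw [h0, h.size], by rw [h1]; exact h.matrix, by rw [h2]; exact h.row⟩

/-- The memory contains a preflow. -/
structure FlowMem (n : ℕ) (le : ℕ → ℕ → Prop) (c : ℕ → Lex (ℝ × ℝ)) (s : State) : Prop where
  order : OrderMem n le s
  preflow : IsPreflow n le c s.excess (s.flow n) (s.nat 3)

theorem FlowMem.congr {n : ℕ} {le : ℕ → ℕ → Prop} {c : ℕ → Lex (ℝ × ℝ)} {s s' : State}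
    (h : FlowMem n le c s) (h0 : s'.nat 0 = s.nat 0) (h1 : s'.nat 1 = s.nat 1)
    (h2 : s'.nat 2 = s.nat 2) (h3 : s'.nat 3 = s.nat 3) (hr : s'.real = s.real) :
    FlowMem n le c s' :=
  ⟨h.order.congr h0 h1 h2, by
    have := h.preflow
    rw [h3]
    unfold State.excess State.flow
    rw [hr]
    exact this⟩

/-- The address of the entry in the row of the vertex in register `a` and the column of the vertex
in register `b`. -/
abbrev NExpr.entry (a b : ℕ) : NExpr := .add (.read 2 (.reg a)) (.reg b)

/-- Determine the amount that can be pushed from `u` to `v`, and change the flow. -/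
def pushFlow : Prog :=
  .ite (.natLe (.lit 1) (.read 1 (.entry 7 6)))
    (.block [
      .setReal 5 (.lit 0) (.read 1 (.reg 6)),
      .setReal 6 (.lit 0) (.read 2 (.reg 6)),
      .setReal 3 (.entry 6 7) (.add (.read 3 (.entry 6 7)) (.reg 5)),
      .setReal 4 (.entry 6 7) (.add (.read 4 (.entry 6 7)) (.reg 6))])
    (.block [
      .setReal 5 (.lit 0) (.read 3 (.entry 7 6)),
      .setReal 6 (.lit 0) (.read 4 (.entry 7 6)),
      .ite (.lexLe (.read 1 (.reg 6)) (.read 2 (.reg 6)) (.reg 5) (.reg 6))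
        (.block [
          .setReal 5 (.lit 0) (.read 1 (.reg 6)),
          .setReal 6 (.lit 0) (.read 2 (.reg 6))])
        .skip,
      .setReal 3 (.entry 7 6) (.sub (.read 3 (.entry 7 6)) (.reg 5)),
      .setReal 4 (.entry 7 6) (.sub (.read 4 (.entry 7 6)) (.reg 6))])

/-- If `v` is below `u`, the arc has infinite capacity and takes the whole excess. Otherwise its
residual capacity is the flow from `v` to `u`, which is cancelled as far as the excess permits. In
both cases either the excess of `u` or the residual arc is used up. -/
theorem pushFlow_spec {n : ℕ} {le : ℕ → ℕ → Prop} {s : State} (ho : OrderMem n le s) {u v : ℕ}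
    (hu : s.nat 6 0 = u) (hv : s.nat 7 0 = v) (hun : u < n) (hvn : v < n)
    (he : 0 ≤ s.excess u) (hf : 0 ≤ s.flow n v u) :
    HaltsWithin pushFlow 200 (fun s' => s'.nat = s.nat ∧ s'.real 1 = s.real 1 ∧
      s'.real 2 = s.real 2 ∧
      ∃ δ : Lex (ℝ × ℝ), δ = toLex (s'.real 5 0, s'.real 6 0) ∧ 0 ≤ δ ∧ δ ≤ s.excess u ∧
        ((le v u ∧ δ = s.excess u ∧ ∀ x < n, ∀ y < n,
            s'.flow n x y = if x = u ∧ y = v then s.flow n u v + δ else s.flow n x y) ∨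
          (¬ le v u ∧ δ ≤ s.flow n v u ∧ (δ = s.excess u ∨ δ = s.flow n v u) ∧
            ∀ x < n, ∀ y < n,
            s'.flow n x y = if x = v ∧ y = u then s.flow n v u - δ else s.flow n x y))) s := by
  have hvu : (NExpr.entry 7 6).eval s = v * n + u := by
    simp [NExpr.eval, hu, hv, ho.row v hvn]
  have huv : (NExpr.entry 6 7).eval s = u * n + v := by
    simp [NExpr.eval, hu, hv, ho.row u hun]
  refine HaltsWithin.ite (T := 190) (by decide) (fun hb => ?_) (fun hb => ?_)
  · simp only [BExpr.eval] at hb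
    rw [NExpr.eval, NExpr.eval, hvu, ho.matrix v hvn u hun] at hb
    refine (HaltsWithin.cons_setReal <| .cons_setReal <| .cons_setReal <| .cons_setReal <|
      .nil ?_).mono (by decide) fun _ h => h
    refine ⟨rfl, ?_, ?_, s.excess u, ?_, he, le_rfl, .inl ⟨hb, rfl, ?_⟩⟩
    · ext; simp
    · ext; simp
    · simp [State.excess, RExpr.eval, NExpr.eval, hu]
    · intro x hx y hy
      simp only [State.flow, State.excess, RExpr.eval, NExpr.eval, State.setReal_nat,
        State.setReal_real, hu, hv, ho.row u hun, mul_add_inj hvn hy]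
      by_cases hxy : x = u ∧ y = v
      · simp only [hxy, and_true, if_true]
        rfl
      · simp [hxy]
  · simp only [BExpr.eval] at hb
    rw [NExpr.eval, NExpr.eval, hvu, ho.matrix v hvn u hun] at hb
    refine (HaltsWithin.cons_setReal <| .cons_setReal <| .cons (T := 100) (T' := 50)
      ?_).mono (by decide) fun _ h => h
    refine HaltsWithin.ite (T := 60) (by decide) (fun hc => ?_) (fun hc => ?_)
    · rw [BExpr.lexLe_eval] at hc
      refine (HaltsWithin.cons_setReal <| .cons_setReal <| .nil ?_).mono
        (by decide) fun _ h => h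
      refine (HaltsWithin.cons_setReal <| .cons_setReal <| .nil ?_).mono
        (by decide) fun _ h => h
      refine ⟨rfl, ?_, ?_, s.excess u, ?_, he, le_rfl, .inr ⟨hb, ?_, .inl rfl, ?_⟩⟩
      · ext; simp
      · ext; simp
      · simp [State.excess, RExpr.eval, NExpr.eval, hu]
      · simpa [State.flow, State.excess, RExpr.eval, NExpr.eval, hu, hv, ho.row v hvn] using hc
      · intro x hx y hy
        simp only [State.flow, State.excess, RExpr.eval, NExpr.eval, State.setReal_nat,
          State.setReal_real, hu, hv, ho.row v hvn, mul_add_inj hun hy]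
        by_cases hxy : x = v ∧ y = u
        · simp only [hxy, and_true, if_true]
          rfl
        · simp [hxy]
    · rw [BExpr.lexLe_eval, not_le] at hc
      refine HaltsWithin.skip (by decide) ?_
      refine (HaltsWithin.cons_setReal <| .cons_setReal <| .nil ?_).mono
        (by decide) fun _ h => h
      refine ⟨rfl, ?_, ?_, s.flow n v u, ?_, hf, ?_, .inr ⟨hb, le_rfl, .inr rfl, ?_⟩⟩
      · ext; simp
      · ext; simp
      · simp [State.flow, RExpr.eval, NExpr.eval, hu, hv, ho.row v hvn]
      · refine le_of_lt ?_
        simpa [State.flow, State.excess, RExpr.eval, NExpr.eval, hu, hv, ho.row v hvn] using hc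
      · intro x hx y hy
        simp only [State.flow, RExpr.eval, NExpr.eval, State.setReal_nat,
          State.setReal_real, hu, hv, ho.row v hvn, mul_add_inj hun hy]
        by_cases hxy : x = v ∧ y = u
        · simp only [hxy, and_true, if_true]
          rfl
        · simp [hxy]

theorem State.setNat_nat_of_ne (s : State) {a i x b : ℕ} (h : b ≠ a) :
    (s.setNat a i x).nat b = s.nat b := by
  funext j; simp [h]

theorem State.setReal_real_of_ne (s : State) {a i b : ℕ} {x : ℝ} (h : b ≠ a) :
    (s.setReal a i x).real b = s.real b := by
  funext j; simp [h]

theorem OrderMem.setNat {n : ℕ} {le : ℕ → ℕ → Prop} {s : State} (h : OrderMem n le s)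
    {a i x : ℕ} (ha : 3 ≤ a) : OrderMem n le (s.setNat a i x) :=
  h.congr (s.setNat_nat_of_ne (by omega)) (s.setNat_nat_of_ne (by omega))
    (s.setNat_nat_of_ne (by omega))

theorem FlowMem.setNat {n : ℕ} {le : ℕ → ℕ → Prop} {c : ℕ → Lex (ℝ × ℝ)} {s : State}
    (h : FlowMem n le c s) {a i x : ℕ} (ha : 4 ≤ a) : FlowMem n le c (s.setNat a i x) :=
  h.congr (s.setNat_nat_of_ne (by omega)) (s.setNat_nat_of_ne (by omega))
    (s.setNat_nat_of_ne (by omega)) (s.setNat_nat_of_ne (by omega)) rfl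

/-- Push as much as possible from `u` to `v` if `v` lies one level lower. -/
def pushArc : Prog :=
  .ite (.both (.natLe (.read 3 (.reg 6)) (.add (.read 3 (.reg 7)) (.lit 1)))
      (.natLe (.add (.read 3 (.reg 7)) (.lit 1)) (.read 3 (.reg 6))))
    (.block [pushFlow,
      .setReal 1 (.reg 6) (.sub (.read 1 (.reg 6)) (.reg 5)),
      .setReal 2 (.reg 6) (.sub (.read 2 (.reg 6)) (.reg 6)),
      .setReal 1 (.reg 7) (.add (.read 1 (.reg 7)) (.reg 5)),
      .setReal 2 (.reg 7) (.add (.read 2 (.reg 7)) (.reg 6))])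
    .skip

/-- The clauses on zero excess and on flow into `u` make the effect of a push persist while the
remaining arcs out of `u` are processed. The last clause says that excess arrives only one level
below `u`. -/
theorem pushArc_spec {n : ℕ} {le : ℕ → ℕ → Prop} {c : ℕ → Lex (ℝ × ℝ)} {s : State}
    (hs : FlowMem n le c s) {u v : ℕ}
    (hu : s.nat 6 0 = u) (hv : s.nat 7 0 = v) (hun : u < n) (hvn : v < n)
    (he : 0 ≤ s.excess u) :
    HaltsWithin pushArc 300 (fun s' => FlowMem n le c s' ∧ s'.nat = s.nat ∧ 0 ≤ s'.excess u ∧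
      (s.excess u = 0 → s'.excess u = 0) ∧
      (s.nat 3 u = s.nat 3 v + 1 → s'.excess u = 0 ∨ ¬ (le v u ∨ 0 < s'.flow n v u)) ∧
      (∀ x < n, x ≠ v → s'.flow n x u = s.flow n x u) ∧
      ∀ x < n, x ≠ u → s'.excess x = s.excess x ∨ s.nat 3 x + 1 = s.nat 3 u) s := by
  refine HaltsWithin.ite (T := 270) (by decide) (fun hb => ?_) (fun hb => ?_)
  · have hlev : s.nat 3 u = s.nat 3 v + 1 := by
      simp only [BExpr.eval, NExpr.eval, hu, hv] at hb
      omega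
    have huv : u ≠ v := by rintro rfl; omega
    refine (HaltsWithin.cons (T := 200) (T' := 60) ?_).mono (by decide) fun _ h => h
    refine (pushFlow_spec hs.order hu hv hun hvn he
      (hs.preflow.nonneg v hvn u hun)).mono le_rfl ?_
    rintro s₁ ⟨hn, h1, h2, δ, hδ, hδ0, hδe, hfl⟩
    refine (HaltsWithin.cons_setReal <| .cons_setReal <| .cons_setReal <| .cons_setReal <|
      .nil ?_).mono (by decide) fun _ h => h
    set s' : State := (((s₁.setReal _ _ _).setReal _ _ _).setReal _ _ _).setReal _ _ _ with hs'
    have hnat : s'.nat = s.nat := by simp [hs', hn]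
    have hflow : s'.flow n = s₁.flow n := by
      funext x y
      simp [hs', State.flow]
    have hexc : ∀ x, s'.excess x = if x = v then s.excess v + δ
        else if x = u then s.excess u - δ else s.excess x := by
      intro x
      simp only [hs', State.excess, RExpr.eval, NExpr.eval, State.setReal_nat,
        State.setReal_real, hn, hu, hv, h1, h2, hδ]
      by_cases hxv : x = v
      · subst hxv
        simp only [huv.symm, Nat.reduceEqDiff, and_true, false_and, and_false, and_self, if_false,
          if_true]
        rfl
      · by_cases hxu : x = u
        · subst hxu
          simp only [hxv, Nat.reduceEqDiff, and_true, false_and, and_false, and_self, if_false,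
            if_true]
          rfl
        · simp [hxv, hxu]
    have hexu : s'.excess u = s.excess u - δ := by rw [hexc, if_neg huv, if_pos rfl]
    have hexv : s'.excess v = s.excess v + δ := by rw [hexc, if_pos rfl]
    have hexx : ∀ x, x ≠ u → x ≠ v → s'.excess x = s.excess x := by
      intro x hxu hxv
      rw [hexc, if_neg hxv, if_neg hxu]
    have H := hs.preflow
    refine ⟨⟨hs.order.congr (by rw [hnat]) (by rw [hnat]) (by rw [hnat]), ?_⟩, hnat, ?_, ?_, ?_,
      ?_, ?_⟩
    · rw [hnat, hflow]
      rcases hfl with ⟨hle, -, hfl⟩ | ⟨hle, hδf, -, hfl⟩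
      · refine H.push hun hvn hlev hδ0 hδe hexu hexv (fun x _ => hexx x) ?_ ?_ ?_ ?_ ?_
        · intro x hx y hy
          rw [hfl x hx y hy]
          split_ifs with hxy
          · exact add_nonneg (H.nonneg u hun v hvn) hδ0
          · exact H.nonneg x hx y hy
        · intro x hx y hy
          rw [hfl x hx y hy]
          split_ifs with hxy
          · rcases hxy with ⟨rfl, rfl⟩
            exact fun _ => hle
          · exact H.support x hx y hy
        · intro x hx y hy
          rw [hfl x hx y hy]
          split_ifs with hxy
          · exact fun _ => .inr hxy
          · exact fun h => .inl h
        · rw [hfl u hun v hvn, hfl v hvn u hun, if_pos ⟨rfl, rfl⟩, if_neg fun h => huv h.2]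
          abel
        · intro x hx y hy hxy _
          rw [hfl x hx y hy, if_neg hxy]
      · refine H.push hun hvn hlev hδ0 hδe hexu hexv (fun x _ => hexx x) ?_ ?_ ?_ ?_ ?_
        · intro x hx y hy
          rw [hfl x hx y hy]
          split_ifs with hxy
          · exact sub_nonneg.2 hδf
          · exact H.nonneg x hx y hy
        · intro x hx y hy
          rw [hfl x hx y hy]
          split_ifs with hxy
          · rcases hxy with ⟨rfl, rfl⟩
            intro h0
            refine H.support x hx y hy fun h1 => h0 ?_
            rw [h1] at hδf ⊢
            rw [le_antisymm hδf hδ0, sub_zero]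
          · exact H.support x hx y hy
        · intro x hx y hy
          rw [hfl x hx y hy]
          split_ifs with hxy
          · rcases hxy with ⟨rfl, rfl⟩
            exact fun h => .inl (h.trans_le (sub_le_self _ hδ0))
          · exact fun h => .inl h
        · rw [hfl u hun v hvn, hfl v hvn u hun, if_neg fun h => huv h.1, if_pos ⟨rfl, rfl⟩]
          abel
        · intro x hx y hy _ hxy
          rw [hfl x hx y hy, if_neg hxy]
    · rw [hexu]; exact sub_nonneg.2 hδe
    · intro h0
      rw [hexu, h0, zero_sub, neg_eq_zero]
      exact le_antisymm (h0 ▸ hδe) hδ0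
    · intro _
      rw [hexu, hflow]
      rcases hfl with ⟨hle, hδ', -⟩ | ⟨hle, -, hδ' | hδ', hfl⟩
      · left; rw [hδ', sub_self]
      · left; rw [hδ', sub_self]
      · right
        rw [hfl v hvn u hun, if_pos ⟨rfl, rfl⟩, hδ', sub_self]
        simpa using hle
    · intro x hx hxv
      rw [hflow]
      rcases hfl with ⟨-, -, hfl⟩ | ⟨-, -, -, hfl⟩
      · rw [hfl x hx u hun, if_neg fun h => huv h.2]
      · rw [hfl x hx u hun, if_neg fun h => hxv h.1]
    · intro x hx hxu
      by_cases hxv : x = v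
      · subst hxv; exact .inr hlev.symm
      · exact .inl (hexx x hxu hxv)
  · have hlev : s.nat 3 u ≠ s.nat 3 v + 1 := by
      simp only [BExpr.eval, NExpr.eval, hu, hv] at hb
      omega
    exact HaltsWithin.skip (by decide) ⟨hs, rfl, he, id, fun h => absurd h hlev,
      fun _ _ _ => rfl, fun _ _ _ => .inl rfl⟩

/-- Push as much as possible from `u`, and raise `u` if its excess stays positive. -/
def discharge : Prog :=
  .block [.forLoop 7 (.reg 0) pushArc,
    .ite (.lexLe (.read 1 (.reg 6)) (.read 2 (.reg 6)) (.lit 0) (.lit 0))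
      .skip
      (.block [
        .setNat 3 (.reg 6) (.add (.read 3 (.reg 6)) (.lit 1)),
        .setNat 4 (.lit 0) (.lit 1)])]

/-- If positive excess remains after all arcs have been tried, no residual arc out of `u` leads one
level down, which is just the condition for `IsPreflow.relabel`. Otherwise the excess of `u` is
gone, and no vertex outside the next lower level has changed its excess. -/
theorem discharge_spec {n : ℕ} {le : ℕ → ℕ → Prop} {c : ℕ → Lex (ℝ × ℝ)} {s : State}
    (hs : FlowMem n le c s) {u : ℕ}
    (hu : s.nat 6 0 = u) (hun : u < n) (hhu : s.nat 3 u ≤ n) (he : 0 ≤ s.excess u) :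
    HaltsWithin discharge (400 * (n + 1)) (fun s' => FlowMem n le c s' ∧
      ((s'.nat 4 0 = 1 ∧
          ∑ x ∈ Finset.range n, s'.nat 3 x = ∑ x ∈ Finset.range n, s.nat 3 x + 1) ∨
        (s'.nat 4 0 = s.nat 4 0 ∧ s'.nat 3 = s.nat 3 ∧ s'.excess u ≤ 0 ∧
          ∀ x < n, x ≠ u → s'.excess x = s.excess x ∨ s.nat 3 x + 1 = s.nat 3 u))) s := by
  have key : HaltsWithin (.forLoop 7 (.reg 0) pushArc) (n * (2 + 300 + 12) + 2 + 9)
      (fun s' => FlowMem n le c s' ∧ s'.nat 3 = s.nat 3 ∧ s'.nat 4 = s.nat 4 ∧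
        s'.nat 6 = s.nat 6 ∧ 0 ≤ s'.excess u ∧
        (∀ v < n, s.nat 3 u = s.nat 3 v + 1 →
          s'.excess u = 0 ∨ ¬ (le v u ∨ 0 < s'.flow n v u)) ∧
        ∀ x < n, x ≠ u → s'.excess x = s.excess x ∨ s.nat 3 x + 1 = s.nat 3 u) s := by
    refine HaltsWithin.forLoop (fun k s' => FlowMem n le c s' ∧ s'.nat 3 = s.nat 3 ∧
        s'.nat 4 = s.nat 4 ∧ s'.nat 6 = s.nat 6 ∧ 0 ≤ s'.excess u ∧
        (∀ v < k, s.nat 3 u = s.nat 3 v + 1 →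
          s'.excess u = 0 ∨ ¬ (le v u ∨ 0 < s'.flow n v u)) ∧
        ∀ x < n, x ≠ u → s'.excess x = s.excess x ∨ s.nat 3 x + 1 = s.nat 3 u)
      (by decide) ?_ ?_ ?_
    · exact ⟨hs.setNat (by decide), s.setNat_nat_of_ne (by decide), s.setNat_nat_of_ne (by decide),
        s.setNat_nat_of_ne (by decide), he, fun v hv => absurd hv (by omega),
        fun _ _ _ => .inl rfl⟩
    · rintro j s' ⟨h, -⟩
      exact h.order.size
    · rintro j s₁ hj ⟨h, h3, h4, h6, he₁, hv, hx⟩ hj7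
      refine (pushArc_spec h (by rw [h6, hu]) hj7 hun hj he₁).mono le_rfl ?_
      rintro s₂ ⟨h', hnat, he₂, hz, hadm, hfl, hx₂⟩
      refine ⟨h'.setNat (by decide), ?_, ?_, ?_, he₂, ?_, ?_⟩
      · rw [State.setNat_nat_of_ne _ (by decide), hnat, h3]
      · rw [State.setNat_nat_of_ne _ (by decide), hnat, h4]
      · rw [State.setNat_nat_of_ne _ (by decide), hnat, h6]
      · intro v hvj hlev
        change s₂.excess u = 0 ∨ ¬ (le v u ∨ 0 < s₂.flow n v u)
        rcases Nat.lt_succ_iff_lt_or_eq.1 hvj with hvj | rfl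
        · rcases hv v hvj hlev with h0 | h0
          · exact .inl (hz h0)
          · rw [hfl v (by omega) (by omega)]
            exact .inr h0
        · rw [h3] at hadm
          exact hadm hlev
      · intro x hxn hxu
        rw [h3] at hx₂
        change s₂.excess x = s.excess x ∨ _
        rcases hx₂ x hxn hxu with h0 | h0
        · rw [h0]; exact hx x hxn hxu
        · exact .inr h0
  refine (HaltsWithin.cons (T' := 60) (key.mono le_rfl ?_)).mono (by omega) fun _ h => h
  rintro s₁ ⟨h, h3, h4, h6, he₁, hadm, hx⟩
  refine (HaltsWithin.cons (T := 50) (T' := 1) ?_).mono (by omega) fun _ h => h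
  have hlex : (BExpr.lexLe (.read 1 (.reg 6)) (.read 2 (.reg 6)) (.lit 0) (.lit 0)).eval s₁ ↔
      s₁.excess u ≤ 0 := by
    rw [BExpr.lexLe_eval]
    simp only [RExpr.eval, NExpr.eval, h6, hu, Nat.cast_zero]
    rfl
  refine HaltsWithin.ite (T := 20) (by decide) (fun hb => ?_) (fun hb => ?_)
  · refine HaltsWithin.skip (by decide) (HaltsWithin.nil ?_)
    exact ⟨h, .inr ⟨by rw [h4], h3, hlex.1 hb, hx⟩⟩
  · rw [hlex, not_le] at hb
    refine (HaltsWithin.cons_setNat <| .cons_setNat <| .nil <| .nil ?_).mono (by decide)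
      fun _ h => h
    set s' : State := (s₁.setNat _ _ _).setNat _ _ _ with hs'
    have e3u : s'.nat 3 u = s.nat 3 u + 1 := by simp [hs', NExpr.eval, h6, hu, h3]
    have e3 : ∀ x, x ≠ u → s'.nat 3 x = s.nat 3 x := by
      intro x hx; simp [hs', NExpr.eval, h6, hu, h3, hx]
    refine ⟨⟨h.order.congr ?_ ?_ ?_, ?_⟩, .inl ⟨?_, ?_⟩⟩
    · funext; simp [hs']
    · funext; simp [hs']
    · funext; simp [hs']
    · refine IsPreflow.relabel h.preflow hun (by rw [h3]; exact hhu) hb ?_ (by rw [e3u, h3]) ?_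
      · intro v hv hr hlev
        rw [h3] at hlev
        rcases hadm v hv hlev with h0 | h0
        · exact hb.ne' h0
        · exact h0 hr
      · intro x _ hxu
        rw [e3 x hxu, h3]
    · simp [hs', NExpr.eval]
    · have hu' := Finset.mem_range.2 hun
      rw [← Finset.add_sum_erase _ _ hu', ← Finset.add_sum_erase _ _ hu', e3u,
        Finset.sum_congr rfl fun x hx => e3 x (Finset.ne_of_mem_erase hx)]
      ring

/-- Discharge the vertex `u` if it lies on the current level and has positive excess. -/
def visit : Prog :=
  .ite (.both (.both (.natLe (.add (.read 3 (.reg 6)) (.reg 5)) (.reg 0))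
        (.natLe (.reg 0) (.add (.read 3 (.reg 6)) (.reg 5))))
      (.neg (.lexLe (.read 1 (.reg 6)) (.read 2 (.reg 6)) (.lit 0) (.lit 0))))
    discharge .skip

/-- Visit all vertices, from the highest level downwards. -/
def sweep : Prog := .forLoop 5 (.add (.reg 0) (.lit 1)) (.forLoop 6 (.reg 0) visit)

/-- The invariant of a sweep, before the visit of the vertex `j` in round `k`; `H` is the sum of
the heights at the start. -/
structure SweepInv (n : ℕ) (le : ℕ → ℕ → Prop) (c : ℕ → Lex (ℝ × ℝ)) (H k j : ℕ) (s : State) :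
    Prop where
  mem : FlowMem n le c s
  le_sum : H ≤ ∑ x ∈ Finset.range n, s.nat 3 x
  progress : (s.nat 4 0 = 1 ∧ H < ∑ x ∈ Finset.range n, s.nat 3 x) ∨
    (s.nat 4 0 = 0 ∧ ∀ v < n, s.nat 3 v ≤ n →
      (n < s.nat 3 v + k ∨ (s.nat 3 v + k = n ∧ v < j)) → s.excess v ≤ 0)

theorem SweepInv.setNat {n : ℕ} {le : ℕ → ℕ → Prop} {c : ℕ → Lex (ℝ × ℝ)} {H k j : ℕ} {s : State}
    (h : SweepInv n le c H k j s) {a i x : ℕ} (ha : 5 ≤ a) :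
    SweepInv n le c H k j (s.setNat a i x) := by
  have e3 : (s.setNat a i x).nat 3 = s.nat 3 := s.setNat_nat_of_ne (by omega)
  have e4 : (s.setNat a i x).nat 4 = s.nat 4 := s.setNat_nat_of_ne (by omega)
  refine ⟨h.mem.setNat (by omega), ?_, ?_⟩
  · rw [e3]; exact h.le_sum
  · rw [e3, e4]; exact h.progress

/-- Round `k` treats the level `n - k`. As long as nothing is raised, pushes change excesses only on
the next lower level, so the vertices already visited stay without positive excess. -/
theorem visit_spec {n : ℕ} {le : ℕ → ℕ → Prop} {c : ℕ → Lex (ℝ × ℝ)} {H k j : ℕ} {s : State}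
    (h : SweepInv n le c H k j s) (hk : s.nat 5 0 = k) (hj : s.nat 6 0 = j) (hjn : j < n) :
    HaltsWithin visit (430 * (n + 1)) (fun s' => SweepInv n le c H k (j + 1) s') s := by
  have hlex : (BExpr.lexLe (.read 1 (.reg 6)) (.read 2 (.reg 6)) (.lit 0) (.lit 0)).eval s ↔
      s.excess j ≤ 0 := by
    rw [BExpr.lexLe_eval]
    simp only [RExpr.eval, NExpr.eval, hj, Nat.cast_zero]
    rfl
  refine HaltsWithin.ite (T := 400 * (n + 1)) ?_ (fun hb => ?_) (fun hb => ?_)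
  · simp only [BExpr.cost, BExpr.lexLe, RExpr.cost, NExpr.cost]; omega
  · rw [BExpr.eval, BExpr.eval, hlex, not_le] at hb
    simp only [BExpr.eval, NExpr.eval, hj, hk, h.mem.order.size] at hb
    refine (discharge_spec h.mem hj hjn (by omega) hb.2.le).mono le_rfl ?_
    rintro s' ⟨hm, ⟨h4, hsum⟩ | ⟨h4, h3, he, hx⟩⟩
    · have := h.le_sum
      exact ⟨hm, by omega, .inl ⟨h4, by omega⟩⟩
    · refine ⟨hm, by rw [h3]; exact h.le_sum, ?_⟩
      rw [h4, h3]
      refine h.progress.imp id fun ⟨h0, hp⟩ => ⟨h0, fun v hv hvn hvk => ?_⟩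
      by_cases hvj : v = j
      · rwa [hvj]
      · rcases hx v hv hvj with h1 | h1
        · rw [h1]
          refine hp v hv hvn (hvk.imp id fun h2 => ⟨h2.1, by omega⟩)
        · omega
  · rw [BExpr.eval, BExpr.eval, hlex] at hb
    simp only [BExpr.eval, NExpr.eval, hj, hk, h.mem.order.size] at hb
    refine HaltsWithin.skip (by omega) ⟨h.mem, h.le_sum, ?_⟩
    refine h.progress.imp id fun ⟨h0, hp⟩ => ⟨h0, fun v hv hvn hvk => ?_⟩
    by_cases hvj : v = j ∧ s.nat 3 v + k = n
    · obtain ⟨rfl, hlev⟩ := hvj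
      by_contra hcon
      exact hb ⟨⟨hlev.le, hlev.ge⟩, hcon⟩
    · exact hp v hv hvn (by omega)

/-- A sweep without a raise carries all excess down through the levels `n, …, 0` and leaves none of
it positive there. Excess at height `n + 1` is stuck and is allowed to remain. -/
theorem sweep_spec {n : ℕ} {le : ℕ → ℕ → Prop} {c : ℕ → Lex (ℝ × ℝ)} {s : State}
    (h : FlowMem n le c s) (h4 : s.nat 4 0 = 0) :
    HaltsWithin sweep (500 * (n + 1) ^ 3) (fun s' => FlowMem n le c s' ∧
      ((s'.nat 4 0 = 1 ∧
          ∑ x ∈ Finset.range n, s.nat 3 x < ∑ x ∈ Finset.range n, s'.nat 3 x) ∨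
        (s'.nat 4 0 = 0 ∧ ∀ v < n, s'.nat 3 v ≤ n → s'.excess v ≤ 0))) s := by
  set H := ∑ x ∈ Finset.range n, s.nat 3 x
  refine (HaltsWithin.forLoop (k := n + 1) (T := n * (2 + 430 * (n + 1) + 12) + 2 + 9)
    (fun k s' => SweepInv n le c H k 0 s')
    (by decide) ?_ ?_ ?_).mono ?_ ?_
  · refine SweepInv.setNat ⟨h, le_rfl, .inr ⟨h4, fun v hv hvn hvk => ?_⟩⟩ le_rfl
    omega
  · intro j s' h
    simp [NExpr.eval, h.mem.order.size]
  · intro k s₁ hk h₁ hk5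
    refine ((HaltsWithin.forLoop (k := n) (T := 430 * (n + 1))
      (fun j s' => SweepInv n le c H k j s' ∧ s'.nat 5 0 = k) (by decide) ?_ ?_ ?_)).mono
      le_rfl ?_
    · exact ⟨h₁.setNat (by decide), by simpa using hk5⟩
    · intro j s' h
      exact h.1.mem.order.size
    · rintro j s₂ hj ⟨h₂, h5⟩ hj6
      refine (visit_spec h₂ h5 hj6 hj).frame.mono le_rfl ?_
      rintro s₃ ⟨h₃, hf⟩
      refine ⟨h₃.setNat (by decide), ?_⟩
      rw [State.setNat_nat_of_ne _ (by decide), hf.nat 5 (by decide), h5]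
    · rintro s₂ ⟨h₂, h5⟩
      refine SweepInv.setNat ⟨h₂.mem, h₂.le_sum, h₂.progress.imp id fun ⟨h0, hp⟩ =>
        ⟨h0, fun v hv hvn hvk => hp v hv hvn ?_⟩⟩ le_rfl
      omega
  · simp only [NExpr.cost]
    have : (n + 1) * (1 + 1 + 1 + 1 + (n * (2 + 430 * (n + 1) + 12) + 2 + 9) + 12)
      + (1 + 1 + 1 + 1) + 9 = 430 * (n + 1) ^ 3 - 430 * (n + 1) ^ 2 + 14 * n * (n + 1)
        + 27 * (n + 1) + 13 := by
      zify [show 430 * (n + 1) ^ 2 ≤ 430 * (n + 1) ^ 3 from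
        Nat.mul_le_mul_left _ (Nat.pow_le_pow_right (by omega) (by omega))]
      ring
    have h2 : (n + 1) ^ 3 = n * n * n + 3 * (n * n) + 3 * n + 1 := by ring
    have h3 : (n + 1) ^ 2 = n * n + 2 * n + 1 := by ring
    have h4 : 14 * n * (n + 1) = 14 * (n * n) + 14 * n := by ring
    rw [this, h2, h3, h4]
    omega
  · rintro s' h'
    refine ⟨h'.mem, h'.progress.imp id fun ⟨h0, hp⟩ => ⟨h0, fun v hv hvn => hp v hv hvn ?_⟩⟩
    omega

/-- Sweep until no height changes. -/
def sweeps : Prog :=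
  .block [.setNat 4 (.lit 0) (.lit 1),
    .loop (.natLe (.lit 1) (.reg 4)) (.block [.setNat 4 (.lit 0) (.lit 0), sweep])]

/-- Every sweep but the last one increases the sum of the heights, which is at most `n * (n + 1)`.
The flag is set beforehand to force the first sweep. -/
theorem sweeps_spec {n : ℕ} {le : ℕ → ℕ → Prop} {c : ℕ → Lex (ℝ × ℝ)} {s : State}
    (h : FlowMem n le c s) :
    HaltsWithin sweeps (600 * (n + 1) ^ 5) (fun s' => FlowMem n le c s' ∧
      ∀ v < n, s'.nat 3 v ≤ n → s'.excess v ≤ 0) s := by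
  refine (HaltsWithin.cons_setNat <| .cons (T := (n * (n + 1) + 1) *
    (4 + (3 + (500 * (n + 1) ^ 3 + 1)) + 1) + 4 + 1) (T' := 1) ?_).mono ?_ fun _ h => h
  · refine (HaltsWithin.loop (T := 3 + (500 * (n + 1) ^ 3 + 1))
      (fun j s' => FlowMem n le c s' ∧
        ((s'.nat 4 0 = 1 ∧ n * (n + 1) + 1 ≤ ∑ x ∈ Finset.range n, s'.nat 3 x + j) ∨
          (s'.nat 4 0 = 0 ∧ ∀ v < n, s'.nat 3 v ≤ n → s'.excess v ≤ 0)))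
      (n * (n + 1) + 1) ?_ ?_ ?_).mono ?_ ?_
    · exact ⟨h.setNat le_rfl, .inl ⟨by simp [NExpr.eval], by omega⟩⟩
    · rintro s' ⟨hm, ⟨h4, hs⟩ | ⟨h4, -⟩⟩ hb
      · have := hm.preflow.sum_height_le
        omega
      · simp [BExpr.eval, NExpr.eval, h4] at hb
    · rintro j s₁ ⟨hm, hj⟩ hb
      simp only [BExpr.eval, NExpr.eval] at hb
      refine HaltsWithin.cons_setNat ?_
      have h3 : (s₁.setNat 4 ((NExpr.lit 0).eval s₁) ((NExpr.lit 0).eval s₁)).nat 3 = s₁.nat 3 :=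
        s₁.setNat_nat_of_ne (by decide)
      refine HaltsWithin.cons ((sweep_spec (hm.setNat le_rfl) (by simp [NExpr.eval])).mono le_rfl
        ?_)
      rintro s₂ ⟨hm₂, h₂⟩
      refine HaltsWithin.nil ⟨hm₂, h₂.imp (fun ⟨h4, hs⟩ => ⟨h4, ?_⟩) id⟩
      rw [h3] at hs
      rcases hj with ⟨-, hj⟩ | ⟨h0, -⟩ <;> omega
    · simp only [BExpr.cost, NExpr.cost]
      have : 1 + (1 + 1) + 1 + (3 + (500 * (n + 1) ^ 3 + 1)) + 1
        = 4 + (3 + (500 * (n + 1) ^ 3 + 1)) + 1 := by omega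
      rw [this]
    · rintro s' ⟨⟨j, hm, hj⟩, hb⟩
      simp only [BExpr.eval, NExpr.eval] at hb
      refine HaltsWithin.nil ⟨hm, ?_⟩
      rcases hj with ⟨h4, -⟩ | ⟨-, hd⟩
      · omega
      · exact hd
  · simp only [NExpr.cost]
    have h1 : 1 ≤ (n + 1) ^ 3 := Nat.one_le_pow _ _ (by omega)
    have h2 : n * (n + 1) + 1 ≤ (n + 1) ^ 2 := by ring_nf; omega
    have h3 : 1 ≤ (n + 1) ^ 5 := Nat.one_le_pow _ _ (by omega)
    calc _ ≤ (n + 1) ^ 2 * (510 * (n + 1) ^ 3) + 9 := by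
          have := Nat.mul_le_mul h2 (show 4 + (3 + (500 * (n + 1) ^ 3 + 1)) + 1
            ≤ 510 * (n + 1) ^ 3 by omega)
          omega
      _ = 510 * (n + 1) ^ 5 + 9 := by ring
      _ ≤ _ := by omega

/-! ### Setting up the preflow and reading off the lower set -/

/-- The weight `(c · w, d · w)` of the vertex `u` in the primary and secondary directions. -/
noncomputable def State.weight (s : State) (u : ℕ) : Lex (ℝ × ℝ) :=
  toLex (s.real 7 0 * s.real 0 (u + u) + s.real 8 0 * s.real 0 (u + u + 1),
    s.real 9 0 * s.real 0 (u + u) + s.real 10 0 * s.real 0 (u + u + 1))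

/-- The first coordinate of the weight of the vertex in register `6`. -/
abbrev RExpr.wx : RExpr := .read 0 (.add (.reg 6) (.reg 6))

/-- The second coordinate of the weight of the vertex in register `6`. -/
abbrev RExpr.wy : RExpr := .read 0 (.add (.add (.reg 6) (.reg 6)) (.lit 1))

/-- Initialize excesses, heights and flow. -/
def initFlow : Prog :=
  .forLoop 6 (.reg 0) (.block [
    .setReal 1 (.reg 6) (.add (.mul (.reg 7) .wx) (.mul (.reg 8) .wy)),
    .setReal 2 (.reg 6) (.add (.mul (.reg 9) .wx) (.mul (.reg 10) .wy)),
    .setNat 3 (.reg 6) (.lit 0),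
    .forLoop 7 (.reg 0) (.block [
      .setReal 3 (.entry 6 7) (.lit 0),
      .setReal 4 (.entry 6 7) (.lit 0)])])

/-- The part of the memory that `initFlow` has initialized before round `j` of its outer loop and
round `k` of its inner loop. -/
structure InitInv (n : ℕ) (le : ℕ → ℕ → Prop) (s₀ : State) (i j k : ℕ) (s : State) : Prop where
  order : OrderMem n le s
  real : ∀ a, a = 0 ∨ 7 ≤ a → s.real a = s₀.real a
  excess : ∀ u < i, s.excess u = s₀.weight u
  height : ∀ u < i, s.nat 3 u = 0
  flow : ∀ u < n, ∀ v < n, (u < j ∨ u = j ∧ v < k) → s.flow n u v = 0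

theorem InitInv.setNat {n : ℕ} {le : ℕ → ℕ → Prop} {s₀ s : State} {i j k : ℕ}
    (h : InitInv n le s₀ i j k s) {a l x : ℕ} (ha : 4 ≤ a) :
    InitInv n le s₀ i j k (s.setNat a l x) :=
  ⟨h.order.setNat (by omega), h.real, h.excess,
    by rw [s.setNat_nat_of_ne (by omega)]; exact h.height, h.flow⟩

theorem initFlow_spec {n : ℕ} {le : ℕ → ℕ → Prop} {s : State} (h : OrderMem n le s) :
    HaltsWithin initFlow (200 * (n + 1) ^ 2) (fun s' => FlowMem n le s.weight s') s := by
  refine (HaltsWithin.forLoop (k := n) (T := 80 + (n * 50 + 20)) (fun j => InitInv n le s j j 0)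
    (by decide) ?_ ?_ ?_).mono ?_ ?_
  · refine InitInv.setNat ⟨h, fun _ _ => rfl, ?_, ?_, ?_⟩ (by decide) <;> intro u hu <;> omega
  · intro j s' h'
    exact h'.order.size
  · intro j s₁ hj h₁ hj6
    refine (HaltsWithin.cons_setReal <| .cons_setReal <| .cons_setNat <|
      .cons (T := n * 45 + 11) (T' := 1) ?_).mono
      (by simp only [NExpr.cost, RExpr.cost]; omega) fun _ h => h
    refine (HaltsWithin.forLoop (k := n) (T := 31)
      (fun k s' => InitInv n le s (j + 1) j k s' ∧ s'.nat 6 0 = j)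
      (by decide) ?_ ?_ ?_).mono (by simp only [NExpr.cost]; omega) ?_
    · have hw : ∀ i, s₁.real 0 i = s.real 0 i := fun i => by rw [h₁.real 0 (by omega)]
      have hc : ∀ a, 7 ≤ a → s₁.real a 0 = s.real a 0 := fun a ha => by rw [h₁.real a (.inr ha)]
      refine ⟨InitInv.setNat ⟨?_, ?_, ?_, ?_, ?_⟩ (by decide), by simpa using hj6⟩
      · refine OrderMem.setNat ?_ le_rfl
        exact h₁.order.congr rfl rfl rfl
      · intro a ha
        rw [State.setNat_real, State.setReal_real_of_ne _ (by omega),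
          State.setReal_real_of_ne _ (by omega), h₁.real a ha]
      · intro u hu
        by_cases huj : u = j
        · subst huj
          simp [State.excess, State.weight, RExpr.eval, NExpr.eval, hj6, hw, hc]
        · rw [← h₁.excess u (by omega)]
          simp [State.excess, NExpr.eval, hj6, huj]
      · intro u hu
        by_cases huj : u = j
        · subst huj
          simp [NExpr.eval, hj6]
        · simpa [NExpr.eval, hj6, huj] using h₁.height u (by omega)
      · intro u hu v hv huv
        rw [← h₁.flow u hu v hv huv]
        simp [State.flow]
    · rintro k s' ⟨h', -⟩
      exact h'.order.size
    · rintro k s₂ hk ⟨h₂, h6⟩ hk7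
      have he : (NExpr.entry 6 7).eval s₂ = j * n + k := by
        simp [NExpr.eval, h6, hk7, h₂.order.row j hj]
      refine (HaltsWithin.cons_setReal <| .cons_setReal <| .nil ?_).mono (by decide) fun _ h => h
      refine ⟨InitInv.setNat ?_ (by decide), by simpa using h6⟩
      refine ⟨h₂.order.congr rfl rfl rfl, ?_, ?_, h₂.height, ?_⟩
      · intro a ha
        rw [State.setReal_real_of_ne _ (by omega),
          State.setReal_real_of_ne _ (by omega), h₂.real a ha]
      · intro u hu
        rw [← h₂.excess u hu]
        simp [State.excess]
      · intro u hu v hv huv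
        by_cases hjk : u = j ∧ v = k
        · simp only [State.flow, RExpr.eval, NExpr.eval, State.setReal_nat,
            State.setReal_real, h6, hk7, h₂.order.row j hj, hjk]
          simp
        · rw [← h₂.flow u hu v hv (by omega)]
          simp only [State.flow, NExpr.eval, State.setReal_nat,
            State.setReal_real, h6, hk7, h₂.order.row j hj, mul_add_inj hk hv, hjk]
          simp
    · rintro s₂ ⟨h₂, -⟩
      refine HaltsWithin.nil ?_
      show InitInv n le s (j + 1) (j + 1) 0 (s₂.setNat 6 0 (j + 1))
      refine InitInv.setNat ⟨h₂.order, h₂.real, h₂.excess, h₂.height, ?_⟩ (by decide)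
      intro u hu v hv huv
      exact h₂.flow u hu v hv (by omega)
  · simp only [NExpr.cost]
    ring_nf; omega
  · intro s' h'
    exact ⟨h'.order, IsPreflow.init n le h'.excess
      (fun u hu v hv => h'.flow u hu v hv (.inl hu)) h'.height⟩

/-- Find an unoccupied level. -/
def findGap : Prog :=
  .block [.setNat 8 (.lit 0) (.lit 0),
    .forLoop 5 (.add (.reg 0) (.lit 1)) (.block [
      .setNat 9 (.lit 0) (.lit 0),
      .forLoop 6 (.reg 0)
        (.ite (.both (.natLe (.read 3 (.reg 6)) (.add (.reg 5) (.lit 1)))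
            (.natLe (.add (.reg 5) (.lit 1)) (.read 3 (.reg 6))))
          (.setNat 9 (.lit 0) (.lit 1)) .skip),
      .ite (.natLe (.reg 9) (.lit 0)) (.setNat 8 (.lit 0) (.add (.reg 5) (.lit 1))) .skip])]

theorem findGap_spec {n : ℕ} {s : State} (hn : s.nat 0 0 = n) :
    HaltsWithin findGap (150 * (n + 1) ^ 2) (fun s' => 1 ≤ s'.nat 8 0 ∧ s'.nat 8 0 ≤ n + 1 ∧
      ∀ u < n, s.nat 3 u ≠ s'.nat 8 0) s := by
  refine (HaltsWithin.cons_setNat <| .cons (T' := 1) <| (HaltsWithin.forLoop (k := n + 1)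
    (T := 60 + n * 50) (fun k s' => s'.nat 0 0 = n ∧ s'.nat 3 = s.nat 3 ∧
      -- The value `0` in register `8` means that no gap has been found yet; genuine gaps are at
      -- least `1`.
      ((s'.nat 8 0 = 0 ∧ ∀ g, 1 ≤ g → g ≤ k → ∃ u < n, s.nat 3 u = g) ∨
        (1 ≤ s'.nat 8 0 ∧ s'.nat 8 0 ≤ k ∧ ∀ u < n, s.nat 3 u ≠ s'.nat 8 0)))
    (by decide) ?_ ?_ ?_).mono le_rfl ?_).mono ?_ fun _ h => h
  · refine ⟨by simpa using hn, ?_, .inl ⟨by simp [NExpr.eval], by omega⟩⟩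
    funext; simp
  · rintro j s' ⟨h, -⟩
    simp [NExpr.eval, h]
  · rintro k s₁ hk ⟨h0, h3, h⟩ hk5
    refine (HaltsWithin.cons_setNat <| .cons (T' := 20) <|
      (HaltsWithin.forLoop (k := n) (T := 30)
      (fun j s' => s'.nat 0 0 = n ∧ s'.nat 3 = s.nat 3 ∧ s'.nat 5 0 = k ∧
        s'.nat 8 = s₁.nat 8 ∧ (s'.nat 9 0 = 0 ↔ ∀ u < j, s.nat 3 u ≠ k + 1))
      (by decide) ?_ ?_ ?_).mono le_rfl ?_).mono
      (by simp only [NExpr.cost]; omega) fun _ h => h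
    · refine ⟨by simpa using h0, ?_, by simpa using hk5, ?_, by simp [NExpr.eval]⟩
      · rw [State.setNat_nat_of_ne _ (by decide), State.setNat_nat_of_ne _ (by decide), h3]
      · rw [State.setNat_nat_of_ne _ (by decide), State.setNat_nat_of_ne _ (by decide)]
    · rintro j s' ⟨h', -⟩
      exact h'
    · rintro j s₂ hj ⟨g0, g3, g5, g8, g9⟩ hj6
      refine HaltsWithin.ite (T := 5) (by decide) (fun hb => ?_) (fun hb => ?_)
      · simp only [BExpr.eval, NExpr.eval, hj6, g3, g5] at hb
        refine HaltsWithin.setNat (by decide) ⟨by simpa using g0, ?_, by simpa using g5, ?_, ?_⟩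
        · funext; simp [g3]
        · funext; simp [g8]
        · simp only [NExpr.eval, State.setNat_nat]
          simp only [Nat.reduceEqDiff, false_and, if_false, and_self, if_true, one_ne_zero,
            false_iff]
          intro hall
          have := hall j (by omega)
          omega
      · simp only [BExpr.eval, NExpr.eval, hj6, g3, g5] at hb
        refine HaltsWithin.skip (by decide) ⟨by simpa using g0, ?_, by simpa using g5, ?_, ?_⟩
        · funext; simp [g3]
        · funext; simp [g8]
        · simp only [State.setNat_nat, Nat.reduceEqDiff, false_and, if_false, g9]
          refine ⟨fun hall u hu => ?_, fun hall u hu => hall u (by omega)⟩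
          rcases Nat.lt_succ_iff_lt_or_eq.1 hu with hu | rfl
          · exact hall u hu
          · omega
    · rintro s₂ ⟨g0, g3, g5, g8, g9⟩
      refine (HaltsWithin.cons (T := 15) (T' := 1) ?_).mono (by decide) fun _ h => h
      refine HaltsWithin.ite (T := 8) (by decide) (fun hb => ?_) (fun hb => ?_)
      · simp only [BExpr.eval, NExpr.eval, Nat.le_zero, g9] at hb
        refine HaltsWithin.setNat (by decide) (HaltsWithin.nil ⟨by simpa using g0, ?_, .inr ?_⟩)
        · funext; simp [g3]
        · simp only [NExpr.eval, State.setNat_nat, g5, Nat.reduceEqDiff, false_and, if_false,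
            and_self, if_true]
          exact ⟨by omega, le_rfl, hb⟩
      · simp only [BExpr.eval, NExpr.eval, Nat.le_zero, g9] at hb
        refine HaltsWithin.skip (by decide) (HaltsWithin.nil ⟨by simpa using g0, ?_, ?_⟩)
        · funext; simp [g3]
        · simp only [State.setNat_nat, g8, Nat.reduceEqDiff, false_and, if_false]
          rcases h with ⟨h8, hall⟩ | ⟨h8, hle, hall⟩
          · refine .inl ⟨h8, fun g hg1 hgk => ?_⟩
            rcases Nat.lt_succ_iff_lt_or_eq.1 (Nat.lt_succ_of_le hgk) with hg | rfl
            · exact hall g hg1 (by omega)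
            · push Not at hb
              exact hb
          · exact .inr ⟨h8, by omega, hall⟩
  · rintro s' ⟨-, -, h⟩
    refine HaltsWithin.nil ?_
    rcases h with ⟨-, hall⟩ | h
    -- By the pigeonhole principle the search cannot fail.
    · obtain ⟨g, hg1, hg2, hg⟩ := IsPreflow.exists_gap n (s.nat 3)
      obtain ⟨u, hu, hug⟩ := hall g hg1 hg2
      exact absurd hug (hg u hu)
    · exact h
  · simp only [NExpr.cost]
    ring_nf; omega

/-- Sum the weights of the vertices above the unoccupied level. -/
def sumWeights : Prog :=
  .block [.setReal 11 (.lit 0) (.lit 0), .setReal 12 (.lit 0) (.lit 0),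
    .forLoop 6 (.reg 0)
      (.ite (.natLe (.add (.reg 8) (.lit 1)) (.read 3 (.reg 6)))
        (.block [
          .setReal 11 (.lit 0) (.add (.reg 11) .wx),
          .setReal 12 (.lit 0) (.add (.reg 12) .wy)])
        .skip)]

theorem sumWeights_spec {n : ℕ} {s : State} (hn : s.nat 0 0 = n) :
    HaltsWithin sumWeights (100 * (n + 1)) (fun s' =>
      s'.real 11 0 = ∑ u ∈ Finset.range n with s.nat 8 0 < s.nat 3 u, s.real 0 (u + u) ∧
      s'.real 12 0 = ∑ u ∈ Finset.range n with s.nat 8 0 < s.nat 3 u, s.real 0 (u + u + 1)) s := by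
  refine (HaltsWithin.cons_setReal <| .cons_setReal <| .cons (T' := 1) <|
    (HaltsWithin.forLoop (k := n)
    (T := 50) (fun k s' => s'.nat 0 = s.nat 0 ∧ s'.nat 3 = s.nat 3 ∧ s'.nat 8 = s.nat 8 ∧
      s'.real 0 = s.real 0 ∧
      s'.real 11 0 = ∑ u ∈ Finset.range k with s.nat 8 0 < s.nat 3 u, s.real 0 (u + u) ∧
      s'.real 12 0 = ∑ u ∈ Finset.range k with s.nat 8 0 < s.nat 3 u, s.real 0 (u + u + 1))
    (by decide) ?_ ?_ ?_).mono le_rfl ?_).mono ?_ fun _ h => h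
  · refine ⟨?_, ?_, ?_, ?_, by simp [RExpr.eval, NExpr.eval], by simp [RExpr.eval, NExpr.eval]⟩
    all_goals funext; simp
  · rintro j s' ⟨h, -⟩
    simp [NExpr.eval, h, hn]
  · rintro k s₁ hk ⟨h0, h3, h8, hr, h11, h12⟩ hk6
    refine HaltsWithin.ite (T := 35) (by decide) (fun hb => ?_) (fun hb => ?_)
    · simp only [BExpr.eval, NExpr.eval, hk6, h3, h8, Nat.add_one_le_iff] at hb
      refine (HaltsWithin.cons_setReal <| .cons_setReal <| .nil ?_).mono (by decide) fun _ h => h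
      refine ⟨?_, ?_, ?_, ?_, ?_, ?_⟩
      · funext; simp [h0]
      · funext; simp [h3]
      · funext; simp [h8]
      · funext; simp [hr]
      · rw [Finset.range_add_one, Finset.filter_insert, if_pos hb, Finset.sum_insert (by simp),
          ← h11]
        simp [RExpr.eval, NExpr.eval, hk6, hr, add_comm]
      · rw [Finset.range_add_one, Finset.filter_insert, if_pos hb, Finset.sum_insert (by simp),
          ← h12]
        simp [RExpr.eval, NExpr.eval, hk6, hr, add_comm]
    · simp only [BExpr.eval, NExpr.eval, hk6, h3, h8, Nat.add_one_le_iff] at hb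
      refine HaltsWithin.skip (by decide) ⟨?_, ?_, ?_, ?_, ?_, ?_⟩
      · funext; simp [h0]
      · funext; simp [h3]
      · funext; simp [h8]
      · funext; simp [hr]
      · rw [Finset.range_add_one, Finset.filter_insert, if_neg hb, ← h11, State.setNat_real]
      · rw [Finset.range_add_one, Finset.filter_insert, if_neg hb, ← h12, State.setNat_real]
  · rintro s' ⟨-, -, -, -, h⟩
    exact HaltsWithin.nil h
  · simp only [NExpr.cost, RExpr.cost]
    omega

/-- Find a lower set whose weight is lexicographically maximal in the directions in the real
registers `7` to `10`, and compute its sum of weights. -/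
def maxLowerSet : Prog := .block [initFlow, sweeps, findGap, sumWeights]

/-- Neither transitivity nor antisymmetry of `le` plays a role: the preflow argument works for
closure under an arbitrary relation. -/
theorem maxLowerSet_spec {n : ℕ} {le : ℕ → ℕ → Prop} {s : State} (h : OrderMem n le s) :
    HaltsWithin maxLowerSet (2000 * (n + 1) ^ 5) (fun s' => ∃ L ⊆ Finset.range n,
      (∀ u ∈ L, ∀ v < n, le v u → v ∈ L) ∧
      (∀ M ⊆ Finset.range n, (∀ u ∈ M, ∀ v < n, le v u → v ∈ M) →
        ∑ u ∈ M, s.weight u ≤ ∑ u ∈ L, s.weight u) ∧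
      s'.real 11 0 = ∑ u ∈ L, s.real 0 (u + u) ∧
      s'.real 12 0 = ∑ u ∈ L, s.real 0 (u + u + 1)) s := by
  refine (HaltsWithin.cons <| (initFlow_spec h).frame.mono le_rfl fun s₁ ⟨h₁, f₁⟩ => ?_).mono
    (T := 200 * (n + 1) ^ 2 + (600 * (n + 1) ^ 5 + (150 * (n + 1) ^ 2 + (100 * (n + 1) + 1))))
    ?_ fun _ h => h
  · refine HaltsWithin.cons <| (sweeps_spec h₁).frame.mono le_rfl fun s₂ ⟨⟨h₂, hd⟩, f₂⟩ => ?_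
    refine HaltsWithin.cons <| (findGap_spec h₂.order.size).frame.mono le_rfl
      fun s₃ ⟨⟨hg1, hg2, hg⟩, f₃⟩ => ?_
    refine HaltsWithin.cons <| (sumWeights_spec (n := n)
      (by rw [f₃.nat 0 (by decide), h₂.order.size])).mono le_rfl fun s₄ ⟨h11, h12⟩ =>
      HaltsWithin.nil ?_
    have e3 : s₃.nat 3 = s₂.nat 3 := f₃.nat 3 (by decide)
    have e0 : s₃.real 0 = s.real 0 := by
      rw [f₃.real 0 (by decide), f₂.real 0 (by decide), f₁.real 0 (by decide)]
    rw [e0, e3] at h11 h12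
    obtain ⟨hlow, hmax⟩ := h₂.preflow.isMax hd hg1 hg2 hg
      (L := {u ∈ Finset.range n | s₃.nat 8 0 < s₂.nat 3 u}) (by simp)
    exact ⟨_, Finset.filter_subset _ _, hlow, hmax, h11, h12⟩
  · have h1 : (n + 1) ^ 2 ≤ (n + 1) ^ 5 := Nat.pow_le_pow_right (by omega) (by omega)
    have h2 : n + 1 ≤ (n + 1) ^ 5 := Nat.le_self_pow (by omega) _
    omega

/-! ### Planar convex geometry -/

/-- If a vertex is a convex combination, then it equals each point of positive weight. -/
theorem eq_vertex_of_combination {K : Set (ℝ × ℝ)} (hK : Convex ℝ K) {p a b c : ℝ × ℝ}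
    (hp : p ∈ vertices K) (ha : a ∈ K) (hb : b ∈ K) (hc : c ∈ K) {A B C : ℝ} (hA : 0 < A)
    (hB : 0 ≤ B) (hC : 0 ≤ C) (h1 : (A + B + C) * p.1 = A * a.1 + B * b.1 + C * c.1)
    (h2 : (A + B + C) * p.2 = A * a.2 + B * b.2 + C * c.2) : a = p := by
  have hp' := mem_extremePoints.1 hp
  rcases (add_nonneg hB hC).eq_or_lt with h0 | h0
  · have hB0 : B = 0 := by linarith
    have hC0 : C = 0 := by linarith
    subst hB0 hC0
    simp only [add_zero, zero_mul] at h1 h2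
    exact Prod.ext (mul_left_cancel₀ hA.ne' h1.symm) (mul_left_cancel₀ hA.ne' h2.symm)
  -- Merging `b` and `c` into one point reduces to a segment through `p`.
  · have hq : (B / (B + C)) • b + (C / (B + C)) • c ∈ K :=
      hK hb hc (by positivity) (by positivity) (by field_simp)
    refine (hp'.2 a ha _ hq ⟨A / (A + B + C), (B + C) / (A + B + C), by positivity, by positivity,
      by field_simp; ring, ?_⟩).1
    have h3 : A + B + C ≠ 0 := by positivity
    ext
    · simp only [Prod.fst_add, Prod.smul_fst, smul_eq_mul]
      field_simp
      linarith
    · simp only [Prod.snd_add, Prod.smul_snd, smul_eq_mul]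
      field_simp
      linarith

/-- The pair of the values of the functionals `c` and `d`, compared lexicographically. -/
def lexValue (c d x : ℝ × ℝ) : Lex (ℝ × ℝ) :=
  toLex (c.1 * x.1 + c.2 * x.2, d.1 * x.1 + d.2 * x.2)

theorem lexValue_add (c d x y : ℝ × ℝ) :
    lexValue c d (x + y) = lexValue c d x + lexValue c d y := by
  simp only [lexValue, Prod.fst_add, Prod.snd_add]
  rw [← toLex_add, Prod.mk_add_mk]
  congr 2 <;> ring

/-- A lexicographic half-plane is convex although it need not be closed, so optimality over the
generating points extends to the hull. -/
theorem lexValue_le_of_mem_convexHull {A : Set (ℝ × ℝ)} {c d r : ℝ × ℝ}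
    (h : ∀ x ∈ A, lexValue c d x ≤ lexValue c d r) :
    ∀ x ∈ convexHull ℝ A, lexValue c d x ≤ lexValue c d r := by
  have hconv : Convex ℝ {x | lexValue c d x ≤ lexValue c d r} := by
    intro x hx y hy a b ha hb hab
    simp only [Set.mem_ofPred_eq, lexValue, Prod.Lex.toLex_le_toLex, Prod.fst_add, Prod.snd_add,
      Prod.smul_fst, Prod.smul_snd, smul_eq_mul] at hx hy ⊢
    have ea : a = 1 - b := by linarith
    rcases ha.eq_or_lt with h0 | ha
    · obtain rfl : b = 1 := by linarith
      subst h0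
      simpa using hy
    rcases hb.eq_or_lt with h0 | hb
    · subst h0
      obtain rfl : a = 1 := by linarith
      simpa using hx
    have hle : ∀ {s t R : ℝ}, s ≤ R → t ≤ R → a * s + b * t ≤ R := fun h1 h2 => by
      subst ea; nlinarith
    have hlt : ∀ {s t R : ℝ}, s < R → t ≤ R → a * s + b * t < R := fun h1 h2 => by
      subst ea; nlinarith
    have hlt' : ∀ {s t R : ℝ}, s ≤ R → t < R → a * s + b * t < R := fun h1 h2 => by
      subst ea; nlinarith
    have e : ∀ p q : ℝ, p * (a * x.1 + b * y.1) + q * (a * x.2 + b * y.2)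
        = a * (p * x.1 + q * x.2) + b * (p * y.1 + q * y.2) := fun p q => by ring
    rw [e, e]
    rcases hx with hx | ⟨hx1, hx2⟩
    · exact .inl (hlt hx (hy.elim le_of_lt fun h => h.1.le))
    · rcases hy with hy | ⟨hy1, hy2⟩
      · exact .inl (hlt' hx1.le hy)
      · exact .inr ⟨by rw [hx1, hy1, ← add_mul, hab, one_mul], hle hx2 hy2⟩
  exact fun x hx => convexHull_min h hconv hx

/-- A lexicographic maximum in independent directions is a vertex. -/
theorem mem_vertices_of_lexValue_le {K : Set (ℝ × ℝ)} {c d r : ℝ × ℝ} (hr : r ∈ K)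
    (hcd : c.1 * d.2 - c.2 * d.1 ≠ 0) (h : ∀ x ∈ K, lexValue c d x ≤ lexValue c d r) :
    r ∈ vertices K := by
  refine mem_extremePoints.2 ⟨hr, ?_⟩
  -- Independent functionals determine a point by Cramer's rule, so the maximum is attained only at
  -- `r`.
  have hinj : ∀ x, lexValue c d x = lexValue c d r → x = r := by
    intro x hx
    have h1 := congrArg (fun z => (ofLex z).1) hx
    have h2 := congrArg (fun z => (ofLex z).2) hx
    simp only [lexValue, ofLex_toLex] at h1 h2
    ext
    · refine mul_left_cancel₀ hcd ?_
      linear_combination d.2 * h1 - c.2 * h2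
    · refine mul_left_cancel₀ hcd ?_
      linear_combination c.1 * h2 - d.1 * h1
  have key : ∀ x ∈ K, ∀ y ∈ K, r ∈ openSegment ℝ x y → x = r := by
    rintro x hx y hy ⟨a, b, ha, hb, hab, rfl⟩
    apply hinj
    refine le_antisymm (h x hx) ?_
    have h1 := h x hx
    have h2 := h y hy
    simp only [lexValue, Prod.Lex.toLex_le_toLex, Prod.fst_add, Prod.snd_add,
      Prod.smul_fst, Prod.smul_snd, smul_eq_mul] at h1 h2 ⊢
    obtain rfl : b = 1 - a := by linarith
    have e : ∀ p q : ℝ, p * (a * x.1 + (1 - a) * y.1) + q * (a * x.2 + (1 - a) * y.2)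
        = a * (p * x.1 + q * x.2) + (1 - a) * (p * y.1 + q * y.2) := fun p q => by ring
    rw [e, e] at h1 h2 ⊢
    set X := c.1 * x.1 + c.2 * x.2
    set Y := c.1 * y.1 + c.2 * y.2
    set X' := d.1 * x.1 + d.2 * x.2
    set Y' := d.1 * y.1 + d.2 * y.2
    have hX : X ≤ Y := by
      have := h1.elim le_of_lt fun h => h.1.le
      nlinarith
    have hY : Y ≤ X := by
      have := h2.elim le_of_lt fun h => h.1.le
      nlinarith
    have hXY : X = Y := le_antisymm hX hY
    refine .inr ⟨by rw [hXY]; ring, ?_⟩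
    have h1' : X' ≤ Y' := by
      rcases h1 with h1 | h1
      · nlinarith
      · nlinarith [h1.2]
    have h2' : Y' ≤ X' := by
      rcases h2 with h2 | h2
      · nlinarith
      · nlinarith [h2.2]
    nlinarith
  intro x hx y hy hxy
  exact ⟨key x hx y hy hxy, key y hy x hx (openSegment_symm ℝ x y ▸ hxy)⟩

/-- `a` lies above `v`, or to the right of `v` on the same level. -/
def Above (v a : ℝ × ℝ) : Prop := v.2 < a.2 ∨ (v.2 = a.2 ∧ v.1 < a.1)

theorem Above.ne {v a : ℝ × ℝ} (h : Above v a) : a ≠ v := by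
  rintro rfl
  rcases h with h | h
  · exact lt_irrefl _ h
  · exact lt_irrefl _ h.2

/-- Two points above `v`, the second one to the left of the first one as seen from `v`. -/
structure AngleLt (v a b : ℝ × ℝ) : Prop where
  left : Above v a
  right : Above v b
  pos : 0 < orient v a b

/-- Directions from `v` to points above it fill a half-open half-turn, on which the sign of the
orientation is a strict order. -/
theorem AngleLt.trans {v a b c : ℝ × ℝ} (h : AngleLt v a b) (h' : AngleLt v b c) :
    AngleLt v a c := by
  refine ⟨h.left, h'.right, ?_⟩
  have h1 := h.pos
  have h2 := h'.pos
  have ha := h.left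
  have hb := h.right
  have hc := h'.right
  unfold orient at h1 h2 ⊢
  unfold Above at ha hb hc
  -- The orientation of `v a c` is a combination of the other two with heights above `v` as
  -- coefficients. These may vanish, hence the cases below.
  have hid : (b.2 - v.2) * ((a.1 - v.1) * (c.2 - v.2) - (a.2 - v.2) * (c.1 - v.1))
      = (a.2 - v.2) * ((b.1 - v.1) * (c.2 - v.2) - (b.2 - v.2) * (c.1 - v.1))
        + (c.2 - v.2) * ((a.1 - v.1) * (b.2 - v.2) - (a.2 - v.2) * (b.1 - v.1)) := by ring
  have ha0 : 0 ≤ a.2 - v.2 := by rcases ha with h | h <;> linarith [h]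
  have hc0 : 0 ≤ c.2 - v.2 := by rcases hc with h | h <;> linarith [h]
  rcases hb with hb | ⟨hb, hb'⟩
  · refine pos_of_mul_pos_right (a := b.2 - v.2) ?_ (by linarith)
    rw [hid]
    rcases ha0.eq_or_lt with ha1 | ha1
    · rcases hc0.eq_or_lt with hc1 | hc1
      · rw [← hc1] at h2
        rcases hc with hc | hc
        · linarith
        · nlinarith [hc.2]
      · have := mul_pos hc1 h1
        rw [← ha1] at this ⊢
        linarith
    · have := mul_pos ha1 h2
      have := mul_nonneg hc0 h1.le
      linarith
  · rw [show b.2 - v.2 = 0 by linarith] at h1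
    nlinarith

/-- If three points are ordered by angle around the vertex `v`, and the middle one is a vertex, then
they turn counterclockwise. -/
theorem orient_pos_of_angleLt {K : Set (ℝ × ℝ)} (hK : Convex ℝ K) {v a b c : ℝ × ℝ}
    (hv : v ∈ K) (ha : a ∈ K) (hb : b ∈ vertices K) (hc : c ∈ K) (hab : AngleLt v a b)
    (hbc : AngleLt v b c) : 0 < orient a b c := by
  by_contra hcon
  have h1 := hab.pos
  have h2 := hbc.pos
  have h3 := (hab.trans hbc).pos
  -- Otherwise `b` would lie in the triangle `a c v`; the coefficients are its unnormalized
  -- barycentric coordinates.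
  have : a = b := by
    refine eq_vertex_of_combination hK hb ha hc hv (A := orient v b c) (B := orient v a b)
      (C := - orient a b c) h2 h1.le (by linarith) ?_ ?_ <;> (unfold orient; ring)
  subst this
  unfold orient at h1
  linarith

/-- A vertex to the right of `p q` comes after `p` and before `q` in the order around the
vertex `v`. -/
theorem angleLt_of_orient_neg {K : Set (ℝ × ℝ)} (hK : Convex ℝ K) {v p q r : ℝ × ℝ}
    (hv : v ∈ vertices K) (hp : p ∈ vertices K) (hq : q ∈ vertices K) (hr : r ∈ vertices K)
    (habove : ∀ x ∈ K, x = v ∨ Above v x) (hpq : AngleLt v p q) (h : orient p q r < 0) :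
    AngleLt v p r ∧ AngleLt v r q := by
  have h1 := hpq.pos
  have hrv : Above v r := by
    refine (habove r hr.1).resolve_left ?_
    rintro rfl
    unfold orient at h1 h
    linarith
  constructor
  · refine ⟨hpq.left, hrv, ?_⟩
    by_contra hcon
    -- Otherwise `p` would lie in the triangle `v r q`, with positive weight at `v`. The second half
    -- treats `q` in the same way.
    have : v = p := by
      refine eq_vertex_of_combination hK hp hv.1 hr.1 hq.1 (A := -orient p q r)
        (B := orient v p q) (C := - orient v p r) (by linarith) h1.le (by linarith) ?_ ?_ <;>
      (unfold orient; ring)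
    exact hpq.left.ne this.symm
  · refine ⟨hrv, hpq.right, ?_⟩
    by_contra hcon
    have : v = q := by
      refine eq_vertex_of_combination hK hq hv.1 hr.1 hp.1 (A := -orient p q r)
        (B := orient v p q) (C := - orient v r q) (by linarith) h1.le (by linarith) ?_ ?_ <;>
      (unfold orient; ring)
    exact hpq.right.ne this.symm

/-- All of `K` lies to the left of the line from `p` to `q`. -/
def IsLeftOf (K : Set (ℝ × ℝ)) (p q : ℝ × ℝ) : Prop := ∀ x ∈ K, 0 ≤ orient p q x

/-- `v` is the lowest point of `K`, the leftmost one if there are several. -/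
structure IsLowest (K : Set (ℝ × ℝ)) (v : ℝ × ℝ) : Prop where
  convex : Convex ℝ K
  vertex : v ∈ vertices K
  above : ∀ x ∈ K, x = v ∨ Above v x

/-- A partial traversal of the boundary of `K`: the vertices `v :: l` have been listed, and `l'` are
some of the remaining vertices, in counterclockwise order. -/
structure IsTraversal (K : Set (ℝ × ℝ)) (v : ℝ × ℝ) (l l' : List (ℝ × ℝ)) : Prop where
  mem : ∀ p ∈ l ++ l', p ∈ vertices K
  ne : ∀ p ∈ l ++ l', p ≠ v
  chain : (l ++ l').IsChain (AngleLt v)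
  left : (v :: l).IsChain (IsLeftOf K)
  nontrivial : l ++ l' = [] → ∀ x ∈ K, x = v

namespace IsTraversal

variable {K : Set (ℝ × ℝ)} {v r : ℝ × ℝ} {l l' : List (ℝ × ℝ)}

theorem pairwise (h : IsTraversal K v l l') : (l ++ l').Pairwise (AngleLt v) :=
  haveI : Trans (AngleLt v) (AngleLt v) (AngleLt v) := ⟨AngleLt.trans⟩
  List.isChain_iff_pairwise.1 h.chain

theorem nodup (h : IsTraversal K v l l') : (v :: (l ++ l')).Nodup := by
  refine List.nodup_cons.2 ⟨fun hv => h.ne v hv rfl, ?_⟩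
  refine h.pairwise.imp fun {a b} hab => ?_
  rintro rfl
  have := hab.pos
  unfold orient at this
  linarith

/-- Bounds the list and the stack together, and thereby the number of steps of the traversal. -/
theorem length_le (h : IsTraversal K v l l') (hv : v ∈ vertices K) (hfin : (vertices K).Finite) :
    (l ++ l').length + 1 ≤ (vertices K).ncard := by
  classical
  rw [← List.length_cons (a := v), ← List.toFinset_card_of_nodup h.nodup, ← Set.ncard_coe_finset]
  refine Set.ncard_le_ncard (fun x hx => ?_) hfin
  simp only [List.coe_toFinset, Set.mem_ofPred_eq, List.mem_cons] at hx
  rcases hx with rfl | hx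
  · exact hv
  · exact h.mem x hx

/-- Inserting a vertex to the right of the next edge. -/
theorem insert (h : IsTraversal K v l l') (hK : IsLowest K v) (hr : r ∈ vertices K)
    (hneg : orient (l.getLast?.getD v) (l'.head?.getD v) r < 0) : IsTraversal K v l (r :: l') := by
  have hrv : r ≠ v ∧ (∀ p ∈ l.getLast?, AngleLt v p r) ∧ ∀ q ∈ l'.head?, AngleLt v r q := by
    have habove : ∀ p ∈ l ++ l', Above v p := fun p hp =>
      (hK.above p (h.mem p hp).1).resolve_left (h.ne p hp)
    -- The current segment starts at `v` if nothing else is listed, and ends at `v` if no vertex is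
    -- pending; only when both ends differ from `v` is `angleLt_of_orient_neg` needed.
    rcases List.eq_nil_or_concat l with rfl | ⟨l₁, p, rfl⟩
    · rcases l' with _ | ⟨q, l₂⟩
      · simp [orient] at hneg
      · simp only [List.getLast?_nil, Option.getD_none, List.head?_cons, Option.getD_some] at hneg
        have hr' : r ≠ v := by
          rintro rfl
          unfold orient at hneg; linarith
        refine ⟨hr', by simp, ?_⟩
        simp only [List.head?_cons, Option.mem_def, Option.some.injEq, forall_eq']
        refine ⟨(hK.above r hr.1).resolve_left hr', habove q (by simp), ?_⟩
        unfold orient at hneg ⊢; linarith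
    · rcases l' with _ | ⟨q, l₂⟩
      · simp only [List.concat_eq_append, List.getLast?_append, List.getLast?_singleton,
          Option.some_or, Option.getD_some, List.head?_nil, Option.getD_none] at hneg
        have hr' : r ≠ v := by
          rintro rfl
          unfold orient at hneg; linarith
        refine ⟨hr', ?_, by simp⟩
        simp only [List.concat_eq_append, List.getLast?_append, List.getLast?_singleton,
          Option.some_or, Option.mem_def, Option.some.injEq, forall_eq']
        refine ⟨habove p (by simp), (hK.above r hr.1).resolve_left hr', ?_⟩
        unfold orient at hneg ⊢; linarith
      · simp only [List.concat_eq_append, List.getLast?_append, List.getLast?_singleton,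
          Option.some_or, Option.getD_some, List.head?_cons] at hneg
        have hpq : AngleLt v p q := by
          have := h.chain
          rw [List.isChain_append] at this
          exact this.2.2 p (by simp) q (by simp)
        obtain ⟨h1, h2⟩ := angleLt_of_orient_neg hK.convex hK.vertex (h.mem p (by simp))
          (h.mem q (by simp)) hr hK.above hpq hneg
        refine ⟨h1.right.ne, ?_, ?_⟩
        · simpa using h1
        · simpa using h2
  obtain ⟨hrv, h1, h2⟩ := hrv
  have hmem : ∀ p, p ∈ l ++ r :: l' → p = r ∨ p ∈ l ++ l' := by
    intro p hp
    simp only [List.mem_append, List.mem_cons] at hp ⊢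
    tauto
  have hc := List.isChain_append.1 h.chain
  refine ⟨fun p hp => ?_, fun p hp => ?_, ?_, h.left, fun h0 => by simp at h0⟩
  · rcases hmem p hp with rfl | hp
    · exact hr
    · exact h.mem p hp
  · rcases hmem p hp with rfl | hp
    · exact hrv
    · exact h.ne p hp
  · refine List.isChain_append.2 ⟨hc.1, List.isChain_cons.2 ⟨h2, hc.2.1⟩, fun x hx y hy => ?_⟩
    simp only [List.head?_cons, Option.mem_def, Option.some.injEq] at hy
    exact hy ▸ h1 x hx

theorem left_append (h : IsTraversal K v l l') {q : ℝ × ℝ}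
    (hleft : IsLeftOf K (l.getLast?.getD v) q) : (v :: (l ++ [q])).IsChain (IsLeftOf K) := by
  rw [← List.cons_append]
  refine List.isChain_append.2 ⟨h.left, List.isChain_singleton _, fun x hx y hy => ?_⟩
  simp only [List.head?_cons, Option.mem_def, Option.some.injEq] at hy
  subst hy
  rw [List.getLast?_cons, Option.mem_def, Option.some.injEq] at hx
  exact hx ▸ hleft

/-- Listing the next vertex. -/
theorem advance {q : ℝ × ℝ} (h : IsTraversal K v l (q :: l'))
    (hleft : IsLeftOf K (l.getLast?.getD v) q) : IsTraversal K v (l ++ [q]) l' := by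
  have e : l ++ [q] ++ l' = l ++ q :: l' := by simp
  exact ⟨e ▸ h.mem, e ▸ h.ne, e ▸ h.chain, h.left_append hleft, e ▸ h.nontrivial⟩

/-- The segments from `v` to the listed vertices cut the polygon into a fan of triangles. A vertex
`x` in the sector between consecutive `q` and `q'` is also to the left of `q q'`, hence in the
triangle `v q q'`, and must be `q`. Beyond the last `q`, both sides of the line through `q` and `v`
are excluded, so `x` lies on the ray from `v` through `q`. -/
theorem mem_of_left (hK : IsLowest K v) {x : ℝ × ℝ} (hx : x ∈ vertices K) (hxv : x ≠ v)
    (q : ℝ × ℝ) (l : List (ℝ × ℝ)) (hmem : ∀ p ∈ q :: l, p ∈ vertices K)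
    (hne : ∀ p ∈ q :: l, p ≠ v) (hchain : (q :: l).IsChain (AngleLt v))
    (hleft : (q :: (l ++ [v])).IsChain (IsLeftOf K)) (h0 : 0 ≤ orient v q x) : x ∈ q :: l := by
  have hxa := (hK.above x hx.1).resolve_left hxv
  induction l generalizing q with
  | nil =>
    have hq := hmem q (by simp)
    have hqv := hne q (by simp)
    have hqa := (hK.above q hq.1).resolve_left hqv
    have h1 : 0 ≤ orient q v x := by
      simp only [List.nil_append, List.isChain_cons_cons] at hleft
      exact hleft.1 x hx.1
    have h2 : (q.1 - v.1) * (x.2 - v.2) = (q.2 - v.2) * (x.1 - v.1) := by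
      unfold orient at h0 h1; linarith
    suffices h : q = x by simp [h]
    -- Of two points on a ray from `v`, the nearer one lies between `v` and the farther one, so a
    -- vertex cannot be strictly nearer. Distances are compared by height, or by abscissa if the ray
    -- is horizontal.
    have key : ∀ a b : ℝ × ℝ, a ∈ K → b ∈ vertices K → b ≠ v → ∀ A B : ℝ, 0 < A → A ≤ B →
        B * (b.1 - v.1) = A * (a.1 - v.1) → B * (b.2 - v.2) = A * (a.2 - v.2) → a = b := by
      intro a b ha hb hbv A B hA hAB e1 e2
      refine eq_vertex_of_combination hK.convex hb ha hK.vertex.1 hK.vertex.1 (A := A)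
        (B := B - A) (C := 0) hA (by linarith) le_rfl (by linarith) (by linarith)
    unfold Above at hqa hxa
    rcases hqa with hqa | ⟨hqa, hqa'⟩
    · rcases hxa with hxa | ⟨hxa, hxa'⟩
      · rcases le_total (x.2 - v.2) (q.2 - v.2) with hle | hle
        · exact key q x hq.1 hx hxv _ _ (by linarith) hle (by linarith) (by ring)
        · exact (key x q hx.1 hq hqv _ _ (by linarith) hle (by linarith) (by ring)).symm
      · rw [← hxa, sub_self, mul_zero] at h2
        nlinarith
    · rw [← hqa, sub_self, zero_mul] at h2
      have h3 : x.2 - v.2 = 0 := by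
        rcases mul_eq_zero.1 h2 with h | h
        · linarith
        · exact h
      have hxa' : v.1 < x.1 := by
        rcases hxa with h | h
        · linarith
        · exact h.2
      rcases le_total (x.1 - v.1) (q.1 - v.1) with hle | hle
      · refine key q x hq.1 hx hxv _ _ (by linarith) hle (by ring) ?_
        rw [h3, ← hqa]; ring
      · refine (key x q hx.1 hq hqv _ _ (by linarith) hle (by ring) ?_).symm
        rw [h3, ← hqa]; ring
  | cons q' l ih =>
    simp only [List.cons_append, List.isChain_cons_cons] at hleft hchain
    by_cases h1 : 0 ≤ orient v q' x
    · exact List.mem_cons_of_mem _ (ih q' (fun p hp => hmem p (List.mem_cons_of_mem _ hp))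
        (fun p hp => hne p (List.mem_cons_of_mem _ hp)) hchain.2 hleft.2 h1)
    · rw [not_le] at h1
      have h2 := hleft.1 x hx.1
      have : q = x := by
        refine eq_vertex_of_combination hK.convex hx (hmem q (by simp)).1
          (hmem q' (by simp)).1 hK.vertex.1 (A := - orient v q' x) (B := orient v q x)
          (C := orient q q' x) (by linarith) h0 h2 ?_ ?_ <;> (unfold orient; ring)
      simp [this]

/-- After the last edge, all vertices have been listed. -/
theorem isVertexList (h : IsTraversal K v l []) (hK : IsLowest K v)
    (hleft : IsLeftOf K (l.getLast?.getD v) v) {m : ℕ} (hm : m = l.length + 1)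
    {f : Fin m → ℝ × ℝ} (hf : ∀ i : Fin m, (v :: l)[(i : ℕ)]? = some (f i)) :
    IsVertexList K f := by
  have hget : ∀ i : Fin m, ∃ hi : (i : ℕ) < (v :: l).length, (v :: l)[(i : ℕ)] = f i := fun i =>
    List.getElem?_eq_some_iff.1 (hf i)
  have hnodup := h.nodup
  have hmem := h.mem
  have hpw := h.pairwise
  simp only [List.append_nil] at hnodup hmem hpw
  refine ⟨?_, ?_, ?_⟩
  · intro i j hij
    obtain ⟨hi, ei⟩ := hget i
    obtain ⟨hj, ej⟩ := hget j
    exact Fin.ext ((List.Nodup.getElem_inj_iff hnodup).1 (ei.trans (hij.trans ej.symm)))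
  · apply Set.Subset.antisymm
    · rintro _ ⟨i, rfl⟩
      obtain ⟨hi, ei⟩ := hget i
      have : f i ∈ v :: l := ei ▸ List.getElem_mem hi
      rcases List.mem_cons.1 this with h0 | h0
      · rw [h0]; exact hK.vertex
      · exact hmem _ h0
    · intro x hx
      have hxl : x ∈ v :: l := by
        by_cases hxv : x = v
        · simp [hxv]
        refine List.mem_cons_of_mem _ ?_
        have hl := h.left_append hleft
        rcases l with _ | ⟨q, l⟩
        · exact absurd (h.nontrivial rfl x hx.1) hxv
        · have hc := h.chain
          simp only [List.append_nil] at hc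
          have hne := h.ne
          simp only [List.append_nil] at hne
          simp only [List.cons_append, List.isChain_cons_cons] at hl
          exact mem_of_left hK hx hxv q l hmem hne hc hl.2 (hl.1 x hx.1)
      obtain ⟨i, hi, rfl⟩ := List.getElem_of_mem hxl
      have him : i < m := by rw [hm]; simpa using hi
      obtain ⟨_, ei⟩ := hget ⟨i, him⟩
      exact ⟨⟨i, him⟩, ei.symm⟩
  · intro i j k hij hjk
    obtain ⟨hi, ei⟩ := hget i
    obtain ⟨hj, ej⟩ := hget j
    obtain ⟨hk, ek⟩ := hget k
    have hlt : ∀ a b : ℕ, a < b → ∀ (ha : a < l.length) (hb : b < l.length),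
        AngleLt v l[a] l[b] := fun a b hab ha hb => List.pairwise_iff_getElem.1 hpw a b ha hb hab
    rw [← ei, ← ej, ← ek]
    obtain ⟨j', hj'⟩ : ∃ j', (j : ℕ) = j' + 1 := ⟨j - 1, by omega⟩
    obtain ⟨k', hk'⟩ : ∃ k', (k : ℕ) = k' + 1 := ⟨k - 1, by omega⟩
    simp only [hj', hk', List.getElem_cons_succ]
    have hjl : j' < l.length := by simp only [List.length_cons] at hj; omega
    have hkl : k' < l.length := by simp only [List.length_cons] at hk; omega
    have hjk' := hlt j' k' (by omega) hjl hkl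
    -- Triangles at `v` are oriented by the angular order itself; the others need that their middle
    -- corner is a vertex.
    rcases Nat.eq_zero_or_pos (i : ℕ) with h0 | h0
    · simp only [h0, List.getElem_cons_zero]
      exact hjk'.pos
    · obtain ⟨i', hi'⟩ : ∃ i', (i : ℕ) = i' + 1 := ⟨i - 1, by omega⟩
      simp only [hi', List.getElem_cons_succ]
      have hil : i' < l.length := by omega
      exact orient_pos_of_angleLt hK.convex hK.vertex.1 (hmem _ (List.getElem_mem _)).1
        (hmem _ (List.getElem_mem _)) (hmem _ (List.getElem_mem _)).1
        (hlt i' j' (by omega) hil hjl) hjk'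

end IsTraversal

/-! ### The program for the polygon

Further integer arrays: `10` the number of listed points, `11` the height of the stack, `12` a loop
variable.  Further real arrays: `13` and `14` the list, `15` and `16` the stack. -/

section Input

set_option linter.unusedSectionVars false

variable {α : Type*} [Fintype α] {n : ℕ}

theorem lexValue_sum (c d : ℝ × ℝ) {ι : Type*} (M : Finset ι) (f : ι → ℝ × ℝ) :
    lexValue c d (∑ u ∈ M, f u) = ∑ u ∈ M, lexValue c d (f u) := by
  classical
  induction M using Finset.induction_on with
  | empty => simp [lexValue]
  | insert a M ha ih => rw [Finset.sum_insert ha, Finset.sum_insert ha, lexValue_add, ih]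

theorem project_numbered (e : Fin n ≃ α) {wt : α → ℝ × ℝ} {f : ℕ → ℝ × ℝ}
    (hf : ∀ u : Fin n, f u = wt (e u)) {M : Finset ℕ} (hM : M ⊆ Finset.range n) :
    project wt {a | ((e.symm a : Fin n) : ℕ) ∈ M} = ∑ u ∈ M, f u := by
  classical
  unfold project
  refine Finset.sum_bij (fun a _ => ((e.symm a : Fin n) : ℕ)) ?_ ?_ ?_ ?_
  · intro a ha
    simpa using ha
  · intro a _ b _ hab
    exact e.symm.injective (Fin.ext hab)
  · intro u hu
    exact ⟨e ⟨u, Finset.mem_range.1 (hM hu)⟩, by simpa using hu, by simp⟩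
  · intro a _
    rw [hf, e.apply_symm_apply]

variable [PartialOrder α]

/-- The order on `{0, …, n - 1}` given by a numbering. -/
def numberedLE (e : Fin n ≃ α) (u v : ℕ) : Prop := ∃ (hu : u < n) (hv : v < n), e ⟨u, hu⟩ ≤ e ⟨v, hv⟩

/-- The point stored in cells `2 u` and `2 u + 1` of the real array `0`. -/
def State.point (s : State) (u : ℕ) : ℝ × ℝ := (s.real 0 (u + u), s.real 0 (u + u + 1))

/-- The memory contains the order, with row offsets, and the weights. -/
structure InputMem (e : Fin n ≃ α) (wt : α → ℝ × ℝ) (s : State) : Prop where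
  order : OrderMem n (numberedLE e) s
  weights : ∀ u : Fin n, s.point u = wt (e u)

/-- The lower set program finds a lexicographically maximal point of the polygon. -/
theorem maxLowerSet_point {e : Fin n ≃ α} {wt : α → ℝ × ℝ} {s : State} (h : InputMem e wt s)
    {c d : ℝ × ℝ} (hc : c = (s.real 7 0, s.real 8 0)) (hd : d = (s.real 9 0, s.real 10 0)) :
    HaltsWithin maxLowerSet (2000 * (n + 1) ^ 5) (fun s' =>
      (s'.real 11 0, s'.real 12 0) ∈ poly wt ∧
        ∀ x ∈ poly wt, lexValue c d x ≤ lexValue c d (s'.real 11 0, s'.real 12 0)) s := by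
  classical
  refine (maxLowerSet_spec h.order).mono le_rfl ?_
  rintro s' ⟨L, hL, hlow, hmax, h11, h12⟩
  have hpt : (s'.real 11 0, s'.real 12 0) = ∑ u ∈ L, s.point u := by
    rw [h11, h12]
    ext
    · rw [Prod.fst_sum]; rfl
    · rw [Prod.snd_sum]; rfl
  have hw : ∀ M : Finset ℕ, ∑ u ∈ M, s.weight u = lexValue c d (∑ u ∈ M, s.point u) := by
    intro M
    rw [lexValue_sum, hc, hd]
    rfl
  rw [hpt]
  constructor
  · refine subset_convexHull ℝ _ ⟨⟨{a | ((e.symm a : Fin n) : ℕ) ∈ L}, ?_⟩, ?_⟩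
    · intro a b hba ha
      refine hlow _ ha _ (e.symm b).2 ⟨(e.symm b).2, (e.symm a).2, ?_⟩
      simpa using hba
    · exact (project_numbered e h.weights hL).symm
  · refine lexValue_le_of_mem_convexHull ?_
    rintro _ ⟨M, rfl⟩
    let M' : Finset ℕ := {u ∈ Finset.range n | ∃ hu : u < n, e ⟨u, hu⟩ ∈ M}
    have hM' : ∀ a : α, ((e.symm a : Fin n) : ℕ) ∈ M' ↔ a ∈ M := by
      intro a
      simp [M']
    have hset : (M : Set α) = {a | ((e.symm a : Fin n) : ℕ) ∈ M'} := by
      ext a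
      simp [hM']
    rw [hset, project_numbered e h.weights (Finset.filter_subset _ _), ← hw, ← hw]
    refine hmax _ (Finset.filter_subset _ _) ?_
    rintro u hu v hv ⟨_, hun, hle⟩
    simp only [Finset.mem_filter, Finset.mem_range] at hu ⊢
    obtain ⟨_, _, hu⟩ := hu
    exact ⟨hv, hv, M.lower hle hu⟩

/-- Compute the row offsets. -/
def initRows : Prog :=
  .forLoop 6 (.reg 0) (.setNat 2 (.add (.reg 6) (.lit 1)) (.add (.read 2 (.reg 6)) (.reg 0)))

/-- Integers cannot be multiplied in one step, so the offsets `u * n` are tabulated by repeated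
addition, starting from the `0` that the memory holds initially. -/
theorem initRows_spec (e : Fin n ≃ α) (wt : α → ℝ × ℝ) :
    HaltsWithin initRows (50 * (n + 1)) (InputMem e wt) (inputState e wt) := by
  refine (HaltsWithin.forLoop (k := n) (T := 20) (fun k s => s.nat 0 0 = n ∧
    s.nat 1 = (inputState e wt).nat 1 ∧ s.real = (inputState e wt).real ∧
    ∀ u ≤ k, s.nat 2 u = u * n) (by decide) ?_ ?_ ?_).mono ?_ ?_
  · refine ⟨by simp [inputState], State.setNat_nat_of_ne _ (by decide), rfl, fun u hu => ?_⟩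
    simp [inputState, Nat.le_zero.1 hu]
  · rintro j s ⟨h, -⟩
    exact h
  · rintro k s hk ⟨h0, h1, hr, h2⟩ h6
    refine HaltsWithin.setNat (by decide) ⟨by simpa using h0, ?_, hr, fun u hu => ?_⟩
    · rw [State.setNat_nat_of_ne _ (by decide), State.setNat_nat_of_ne _ (by decide), h1]
    · simp only [State.setNat_nat, NExpr.eval, h6, h0, h2 k le_rfl]
      by_cases huk : u = k + 1
      · subst huk
        simp [Nat.succ_mul]
      · simpa [huk] using h2 u (by omega)
  · simp only [NExpr.cost]; omega
  · rintro s ⟨h0, h1, hr, h2⟩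
    refine ⟨⟨h0, fun u hu v hv => ?_, fun u hu => h2 u hu.le⟩, fun u => ?_⟩
    · rw [h1]
      simp only [inputState, one_ne_zero, false_and, if_false, true_and]
      split_ifs with h
      · obtain ⟨-, i, j, hij, hle⟩ := h
        obtain ⟨rfl, rfl⟩ := (mul_add_inj j.2 hv).1 hij
        exact ⟨fun _ => ⟨i.2, j.2, hle⟩, fun _ => le_rfl⟩
      · refine ⟨fun h' => absurd h' (by decide), ?_⟩
        rintro ⟨hu', hv', hle⟩
        exact absurd ⟨rfl, ⟨u, hu'⟩, ⟨v, hv'⟩, rfl, hle⟩ h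
    · have e1 : ((u : ℕ) + u) / 2 = u := by omega
      have e2 : ((u : ℕ) + u + 1) / 2 = u := by omega
      have e3 : ((u : ℕ) + u) % 2 = 0 := by omega
      have e4 : ((u : ℕ) + u + 1) % 2 = 1 := by omega
      simp [State.point, hr, inputState, e1, e2, e3, e4]

end Input

/-! ### The list and the stack in memory -/

/-- The points listed so far. -/
def State.listed (s : State) (k : ℕ) : List (ℝ × ℝ) :=
  (List.range k).map fun i => (s.real 13 i, s.real 14 i)

/-- The points on the stack, the top first. -/
def State.stack (s : State) (k : ℕ) : List (ℝ × ℝ) :=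
  ((List.range k).map fun i => (s.real 15 i, s.real 16 i)).reverse

theorem State.listed_succ (s : State) (k : ℕ) :
    s.listed (k + 1) = s.listed k ++ [(s.real 13 k, s.real 14 k)] := by
  simp [State.listed, List.range_succ]

theorem State.stack_succ (s : State) (k : ℕ) :
    s.stack (k + 1) = (s.real 15 k, s.real 16 k) :: s.stack k := by
  simp [State.stack, List.range_succ]

theorem State.listed_congr {s s' : State} {k : ℕ} (h1 : ∀ i < k, s'.real 13 i = s.real 13 i)
    (h2 : ∀ i < k, s'.real 14 i = s.real 14 i) : s'.listed k = s.listed k := by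
  refine List.map_congr_left fun i hi => ?_
  rw [h1 i (List.mem_range.1 hi), h2 i (List.mem_range.1 hi)]

theorem State.stack_congr {s s' : State} {k : ℕ} (h1 : ∀ i < k, s'.real 15 i = s.real 15 i)
    (h2 : ∀ i < k, s'.real 16 i = s.real 16 i) : s'.stack k = s.stack k := by
  refine congrArg List.reverse (List.map_congr_left fun i hi => ?_)
  rw [h1 i (List.mem_range.1 hi), h2 i (List.mem_range.1 hi)]

/-! ### One step of the boundary traversal -/

section Hull

set_option linter.unusedSectionVars false

variable {α : Type*} [Fintype α] [PartialOrder α] {n : ℕ}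

theorem InputMem.congr {e : Fin n ≃ α} {wt : α → ℝ × ℝ} {s s' : State} (h : InputMem e wt s)
    (h0 : s'.nat 0 = s.nat 0) (h1 : s'.nat 1 = s.nat 1) (h2 : s'.nat 2 = s.nat 2)
    (hr : s'.real 0 = s.real 0) : InputMem e wt s' :=
  ⟨h.order.congr h0 h1 h2, fun u => by rw [← h.weights u]; simp [State.point, hr]⟩

/-- The coordinates of the point listed last. -/
abbrev RExpr.px : RExpr := .read 13 (.sub (.reg 10) (.lit 1))
/-- The coordinates of the point listed last. -/
abbrev RExpr.py : RExpr := .read 14 (.sub (.reg 10) (.lit 1))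
/-- The coordinates of the point on the top of the stack. -/
abbrev RExpr.qx : RExpr := .read 15 (.sub (.reg 11) (.lit 1))
/-- The coordinates of the point on the top of the stack. -/
abbrev RExpr.qy : RExpr := .read 16 (.sub (.reg 11) (.lit 1))

/-- Search for a vertex to the right of the edge from the last listed point to the top of the stack;
push it on the stack if there is one, and otherwise move the top of the stack to the list. -/
def hullStep : Prog :=
  .block [
    -- The primary direction is the normal pointing to the right of the segment `p q`, so that a
    -- maximum minimizes `orient p q`; the secondary direction runs along the segment.
    .setReal 7 (.lit 0) (.sub .qy .py),
    .setReal 8 (.lit 0) (.sub .px .qx),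
    .setReal 9 (.lit 0) (.sub .qx .px),
    .setReal 10 (.lit 0) (.sub .qy .py),
    maxLowerSet,
    .ite (.neg (.realLe (.lit 0) (.sub (.mul (.sub .qx .px) (.sub (.reg 12) .py))
        (.mul (.sub .qy .py) (.sub (.reg 11) .px)))))
      (.block [
        .setReal 15 (.reg 11) (.reg 11),
        .setReal 16 (.reg 11) (.reg 12),
        .setNat 11 (.lit 0) (.add (.reg 11) (.lit 1))])
      (.block [
        .setReal 13 (.reg 10) .qx,
        .setReal 14 (.reg 10) .qy,
        .setNat 10 (.lit 0) (.add (.reg 10) (.lit 1)),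
        .setNat 11 (.lit 0) (.sub (.reg 11) (.lit 1))])]

/-- The memory contains a partial traversal of the polygon: the list `v :: l` and the stack
`l' ++ [v]`. -/
structure HullMem (e : Fin n ≃ α) (wt : α → ℝ × ℝ) (v : ℝ × ℝ) (l l' : List (ℝ × ℝ))
    (s : State) : Prop where
  input : InputMem e wt s
  size : s.nat 10 0 = l.length + 1
  listed : s.listed (l.length + 1) = v :: l
  height : s.nat 11 0 = l'.length + 1
  stack : s.stack (l'.length + 1) = l' ++ [v]
  traversal : IsTraversal (poly wt) v l l'

/-- The memory contains a complete traversal of the polygon: the list `v :: l ++ [v]`. -/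
structure HullDone (wt : α → ℝ × ℝ) (v : ℝ × ℝ) (l : List (ℝ × ℝ)) (s : State) : Prop where
  size : s.nat 10 0 = l.length + 2
  listed : s.listed (l.length + 1) = v :: l
  height : s.nat 11 0 = 0
  traversal : IsTraversal (poly wt) v l []
  left : IsLeftOf (poly wt) (l.getLast?.getD v) v

/-- The optimizer returns a point `r` that minimizes `orient p q` on the polygon. If the minimum is
negative, `r` is a new vertex; otherwise the whole polygon lies to the left of `p q`. -/
theorem hullStep_spec {e : Fin n ≃ α} {wt : α → ℝ × ℝ} {v : ℝ × ℝ} {l l' : List (ℝ × ℝ)}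
    {s : State} (h : HullMem e wt v l l' s) (hK : IsLowest (poly wt) v) :
    HaltsWithin hullStep (2000 * (n + 1) ^ 5 + 300) (fun s' =>
      (∃ r, HullMem e wt v l (r :: l') s') ∨
      (∃ q l'', l' = q :: l'' ∧ HullMem e wt v (l ++ [q]) l'' s') ∨
      (l' = [] ∧ HullDone wt v l s')) s := by
  obtain ⟨k, hk⟩ : ∃ k, k = l.length := ⟨_, rfl⟩
  obtain ⟨m, hm⟩ : ∃ m, m = l'.length := ⟨_, rfl⟩
  obtain ⟨p, hp⟩ : ∃ p : ℝ × ℝ, p = (s.real 13 k, s.real 14 k) := ⟨_, rfl⟩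
  obtain ⟨q, hq⟩ : ∃ q : ℝ × ℝ, q = (s.real 15 m, s.real 16 m) := ⟨_, rfl⟩
  have hlist := h.listed
  rw [State.listed_succ, ← hk, ← hp] at hlist
  have hstack := h.stack
  rw [State.stack_succ, ← hm, ← hq] at hstack
  have hpl : l.getLast?.getD v = p := by
    have := congrArg List.getLast? hlist
    rw [List.getLast?_append, List.getLast?_singleton, Option.some_or, List.getLast?_cons] at this
    exact (Option.some_injective _ this).symm
  -- When `l'` is empty, the top of the stack is the copy of `v` at its bottom.
  have hql : l'.head?.getD v = q := by
    have := congrArg List.head? hstack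
    rcases l' with _ | ⟨a, l'⟩
    · simpa using this.symm
    · simpa using this.symm
  have h10 : s.nat 10 0 = k + 1 := by rw [h.size, hk]
  have h11 : s.nat 11 0 = m + 1 := by rw [h.height, hm]
  refine (HaltsWithin.cons_setReal <| .cons_setReal <| .cons_setReal <| .cons_setReal <|
    .cons (T := 2000 * (n + 1) ^ 5) (T' := 150) ?_).mono
    (by simp only [NExpr.cost, RExpr.cost]; omega) fun _ h => h
  set s₁ : State := (((s.setReal _ _ _).setReal _ _ _).setReal _ _ _).setReal _ _ _ with hs₁
  have hin₁ : InputMem e wt s₁ := by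
    refine h.input.congr rfl rfl rfl ?_
    funext i; simp [hs₁]
  have hreal₁ : ∀ a, 13 ≤ a → s₁.real a = s.real a := by
    intro a ha
    simp only [hs₁]
    rw [State.setReal_real_of_ne _ (by omega), State.setReal_real_of_ne _ (by omega),
      State.setReal_real_of_ne _ (by omega), State.setReal_real_of_ne _ (by omega)]
  have hnat₁ : s₁.nat = s.nat := by simp [hs₁]
  have hc : (q.2 - p.2, p.1 - q.1) = (s₁.real 7 0, s₁.real 8 0) := by
    simp [hs₁, RExpr.eval, NExpr.eval, h10, h11, hp, hq]
  have hd : (q.1 - p.1, q.2 - p.2) = (s₁.real 9 0, s₁.real 10 0) := by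
    simp [hs₁, RExpr.eval, NExpr.eval, h10, h11, hp, hq]
  refine ((maxLowerSet_point hin₁ hc hd).frame).mono le_rfl ?_
  rintro s₂ ⟨⟨hr, hmax⟩, hf⟩
  set r : ℝ × ℝ := (s₂.real 11 0, s₂.real 12 0) with hrdef
  have hin₂ : InputMem e wt s₂ := hin₁.congr (hf.nat 0 (by decide)) (hf.nat 1 (by decide))
    (hf.nat 2 (by decide)) (hf.real 0 (by decide))
  have e10 : s₂.nat 10 = s.nat 10 := by rw [hf.nat 10 (by decide), hnat₁]
  have e11 : s₂.nat 11 = s.nat 11 := by rw [hf.nat 11 (by decide), hnat₁]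
  have e13 : s₂.real 13 = s.real 13 := by rw [hf.real 13 (by decide), hreal₁ 13 (by decide)]
  have e14 : s₂.real 14 = s.real 14 := by rw [hf.real 14 (by decide), hreal₁ 14 (by decide)]
  have e15 : s₂.real 15 = s.real 15 := by rw [hf.real 15 (by decide), hreal₁ 15 (by decide)]
  have e16 : s₂.real 16 = s.real 16 := by rw [hf.real 16 (by decide), hreal₁ 16 (by decide)]
  refine (HaltsWithin.cons (T := 140) (T' := 1) ?_).mono (by decide) fun _ h => h
  have hor : (BExpr.realLe (.lit 0) (.sub (.mul (.sub .qx .px) (.sub (.reg 12) .py))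
      (.mul (.sub .qy .py) (.sub (.reg 11) .px)))).eval s₂ ↔ 0 ≤ orient p q r := by
    simp only [BExpr.eval, RExpr.eval, NExpr.eval, e10, e11, e13, e14, e15, e16, h10, h11,
      Nat.add_sub_cancel, Nat.cast_zero, hp, hq]
    rfl
  refine HaltsWithin.ite (T := 60) (by decide) (fun hb => ?_) (fun hb => ?_)
  · rw [BExpr.eval, hor, not_le] at hb
    refine (HaltsWithin.cons_setReal <| .cons_setReal <| .cons_setNat <| .nil <| .nil <|
      .inl ⟨r, ?_⟩).mono (by decide) fun _ h => h
    have hrv : r ∈ vertices (poly wt) := by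
      -- The determinant of the two directions is the squared length of `p q`; it is nonzero because
      -- `p = q` would make the orientation zero.
      refine mem_vertices_of_lexValue_le hr ?_ hmax
      intro h0
      have h1 : q.2 - p.2 = 0 := by nlinarith [sq_nonneg (q.2 - p.2), sq_nonneg (q.1 - p.1)]
      have h2 : q.1 - p.1 = 0 := by nlinarith [sq_nonneg (q.2 - p.2), sq_nonneg (q.1 - p.1)]
      unfold orient at hb
      rw [h1, h2] at hb
      simp at hb
    refine ⟨hin₂.congr ?_ ?_ ?_ ?_, ?_, ?_, ?_, ?_, ?_⟩
    · funext; simp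
    · funext; simp
    · funext; simp
    · funext; simp
    · simpa [e10] using h.size
    · rw [← h.listed]
      refine State.listed_congr (fun i _ => ?_) fun i _ => ?_
      · simp [e13]
      · simp [e14]
    · simp [NExpr.eval, e11, h11, hm]
    · rw [List.length_cons, ← hm, State.stack_succ, List.cons_append, ← h.stack, ← hm]
      congr 1
      · simp [RExpr.eval, NExpr.eval, e11, h11, hrdef]
      · refine State.stack_congr (fun i hi => ?_) fun i hi => ?_
        · have : i ≠ m + 1 := by omega
          simp [NExpr.eval, e11, h11, e15, this]
        · have : i ≠ m + 1 := by omega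
          simp [NExpr.eval, e11, h11, e16, this]
    · refine h.traversal.insert hK hrv ?_
      rwa [hpl, hql]
  · rw [BExpr.eval, not_not, hor] at hb
    have hleft : IsLeftOf (poly wt) p q := by
      intro x hx
      have := hmax x hx
      simp only [lexValue, Prod.Lex.toLex_le_toLex] at this
      have := this.elim le_of_lt fun h => h.1.le
      unfold orient at hb ⊢
      linarith
    refine (HaltsWithin.cons_setReal <| .cons_setReal <| .cons_setNat <| .cons_setNat <| .nil <|
      .nil <| .inr ?_).mono (by decide) fun _ h => h
    set s' : State := (((s₂.setReal _ _ _).setReal _ _ _).setNat _ _ _).setNat _ _ _ with hs'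
    have hin' : InputMem e wt s' := by
      refine hin₂.congr ?_ ?_ ?_ ?_ <;> (funext; simp [hs'])
    have h10' : s'.nat 10 0 = k + 2 := by simp [hs', NExpr.eval, e10, h10]
    have h11' : s'.nat 11 0 = m := by simp [hs', NExpr.eval, e11, h11]
    have hlist' : s'.listed (k + 1) = v :: l := by
      rw [← h.listed, ← hk]
      refine State.listed_congr (fun i hi => ?_) fun i hi => ?_
      · have : i ≠ k + 1 := by omega
        simp [hs', NExpr.eval, e10, h10, e13, this]
      · have : i ≠ k + 1 := by omega
        simp [hs', NExpr.eval, e10, h10, e14, this]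
    have hnew : (s'.real 13 (k + 1), s'.real 14 (k + 1)) = q := by
      simp [hs', RExpr.eval, NExpr.eval, e10, h10, e11, h11, e15, e16, hq]
    have hstack' : ∀ j, s'.stack j = s.stack j := by
      intro j
      refine State.stack_congr (fun i hi => ?_) fun i hi => ?_
      · simp [hs', e15]
      · simp [hs', e16]
    rcases l' with _ | ⟨a, l''⟩
    · right
      simp only [List.head?_nil, Option.getD_none] at hql
      refine ⟨rfl, hk ▸ h10', hk ▸ hlist', by rw [h11', hm]; rfl, h.traversal, ?_⟩
      rw [hpl, hql]
      exact hleft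
    · left
      simp only [List.head?_cons, Option.getD_some] at hql
      subst hql
      refine ⟨a, l'', rfl, hin', ?_, ?_, ?_, ?_, ?_⟩
      · rw [h10']; simp [hk]
      · have : (l ++ [a]).length + 1 = (k + 1) + 1 := by simp [hk]
        rw [this, State.listed_succ, hlist', hnew]
        rfl
      · rw [h11', hm]; simp
      · rw [hstack']
        rw [List.cons_append] at hstack
        rw [hm] at hstack
        exact (List.cons.inj hstack).2
      · refine h.traversal.advance ?_
        rw [hpl]
        exact hleft

end Hull

/-! ### The complete program and its running time -/

section Polygon

variable {α : Type*} [Fintype α] [PartialOrder α] {n : ℕ}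

/-- Start the traversal: list the lowest point, and put it on the stack, with the highest point on
top if that is a different one. -/
def hullInit : Prog :=
  .block [
    .setReal 7 (.lit 0) (.lit 0),
    .setReal 8 (.lit 0) (.sub (.lit 0) (.lit 1)),
    .setReal 9 (.lit 0) (.sub (.lit 0) (.lit 1)),
    .setReal 10 (.lit 0) (.lit 0),
    maxLowerSet,
    .setReal 13 (.lit 0) (.reg 11),
    .setReal 14 (.lit 0) (.reg 12),
    .setReal 15 (.lit 0) (.reg 11),
    .setReal 16 (.lit 0) (.reg 12),
    .setNat 10 (.lit 0) (.lit 1),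
    .setNat 11 (.lit 0) (.lit 1),
    .setReal 8 (.lit 0) (.lit 1),
    .setReal 9 (.lit 0) (.lit 1),
    maxLowerSet,
    .ite (.both (.both (.realLe (.reg 11) (.reg 13)) (.realLe (.reg 13) (.reg 11)))
        (.both (.realLe (.reg 12) (.reg 14)) (.realLe (.reg 14) (.reg 12))))
      .skip
      (.block [
        .setReal 15 (.lit 1) (.reg 11),
        .setReal 16 (.lit 1) (.reg 12),
        .setNat 11 (.lit 0) (.lit 2)])]

/-- The lexicographic directions select the lowest point, leftmost among ties, and the highest
point, rightmost among ties. These coincide only if the polygon is a single point, which provides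
the clause `nontrivial`. -/
theorem hullInit_spec {e : Fin n ≃ α} {wt : α → ℝ × ℝ} {s : State} (h : InputMem e wt s) :
    HaltsWithin hullInit (4000 * (n + 1) ^ 5 + 200) (fun s' =>
      ∃ v l', IsLowest (poly wt) v ∧ HullMem e wt v [] l' s') s := by
  refine (HaltsWithin.cons_setReal <| .cons_setReal <| .cons_setReal <| .cons_setReal <|
    .cons (T := 2000 * (n + 1) ^ 5) (T' := 2000 * (n + 1) ^ 5 + 150) ?_).mono
    (by simp only [NExpr.cost, RExpr.cost]; omega) fun _ h => h
  refine (maxLowerSet_point (e := e) (wt := wt) (c := (0, -1)) (d := (-1, 0)) ?_ ?_ ?_).frame.mono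
    le_rfl ?_
  · refine h.congr rfl rfl rfl ?_
    funext i; simp
  · simp [RExpr.eval, NExpr.eval]
  · simp [RExpr.eval, NExpr.eval]
  rintro s₁ ⟨⟨hv, hvmax⟩, hf₁⟩
  obtain ⟨v, hvdef⟩ : ∃ v : ℝ × ℝ, v = (s₁.real 11 0, s₁.real 12 0) := ⟨_, rfl⟩
  rw [← hvdef] at hv hvmax
  have hin₁ : InputMem e wt s₁ := by
    refine h.congr ?_ ?_ ?_ ?_
    · rw [hf₁.nat 0 (by decide)]; simp
    · rw [hf₁.nat 1 (by decide)]; simp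
    · rw [hf₁.nat 2 (by decide)]; simp
    · rw [hf₁.real 0 (by decide)]; funext; simp
  have e7 : s₁.real 7 0 = 0 := by
    rw [hf₁.real 7 (by decide)]; simp [RExpr.eval, NExpr.eval]
  have e10 : s₁.real 10 0 = 0 := by
    rw [hf₁.real 10 (by decide)]; simp [RExpr.eval, NExpr.eval]
  have hK : IsLowest (poly wt) v := by
    refine ⟨convex_convexHull ℝ _, mem_vertices_of_lexValue_le hv (by norm_num) hvmax,
      fun x hx => ?_⟩
    have := hvmax x hx
    simp only [lexValue, Prod.Lex.toLex_le_toLex] at this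
    rcases this with h1 | ⟨h1, h2⟩
    · exact .inr (.inl (by linarith))
    · rcases h2.lt_or_eq with h2 | h2
      · exact .inr (.inr ⟨by linarith, by linarith⟩)
      · exact .inl (Prod.ext (by linarith) (by linarith))
  refine (HaltsWithin.cons_setReal <| .cons_setReal <| .cons_setReal <| .cons_setReal <|
    .cons_setNat <| .cons_setNat <| .cons_setReal <| .cons_setReal <|
    .cons (T := 2000 * (n + 1) ^ 5) (T' := 80) ?_).mono
    (by simp only [NExpr.cost, RExpr.cost]; omega) fun _ h => h
  refine (maxLowerSet_point (e := e) (wt := wt) (c := (0, 1)) (d := (1, 0)) ?_ ?_ ?_).frame.mono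
    le_rfl ?_
  · refine hin₁.congr ?_ ?_ ?_ ?_ <;> (funext i; simp)
  · simp [RExpr.eval, NExpr.eval, e7]
  · simp [RExpr.eval, NExpr.eval, e10]
  rintro s₂ ⟨⟨hr, hrmax⟩, hf₂⟩
  obtain ⟨r, hrdef⟩ : ∃ r : ℝ × ℝ, r = (s₂.real 11 0, s₂.real 12 0) := ⟨_, rfl⟩
  rw [← hrdef] at hr hrmax
  have hin₂ : InputMem e wt s₂ := by
    refine hin₁.congr ?_ ?_ ?_ ?_
    · rw [hf₂.nat 0 (by decide)]; funext; simp
    · rw [hf₂.nat 1 (by decide)]; funext; simp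
    · rw [hf₂.nat 2 (by decide)]; funext; simp
    · rw [hf₂.real 0 (by decide)]; funext; simp
  have n10 : s₂.nat 10 0 = 1 := by
    rw [hf₂.nat 10 (by decide)]; simp [NExpr.eval]
  have n11 : s₂.nat 11 0 = 1 := by
    rw [hf₂.nat 11 (by decide)]; simp [NExpr.eval]
  have e13 : s₂.real 13 0 = v.1 := by
    rw [hf₂.real 13 (by decide), hvdef]; simp [RExpr.eval, NExpr.eval]
  have e14 : s₂.real 14 0 = v.2 := by
    rw [hf₂.real 14 (by decide), hvdef]; simp [RExpr.eval, NExpr.eval]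
  have e15 : s₂.real 15 0 = v.1 := by
    rw [hf₂.real 15 (by decide), hvdef]; simp [RExpr.eval, NExpr.eval]
  have e16 : s₂.real 16 0 = v.2 := by
    rw [hf₂.real 16 (by decide), hvdef]; simp [RExpr.eval, NExpr.eval]
  have e11 : s₂.real 11 0 = r.1 := by rw [hrdef]
  have e12 : s₂.real 12 0 = r.2 := by rw [hrdef]
  refine (HaltsWithin.cons (T := 60) (T' := 1) ?_).mono (by decide) fun _ h => h
  refine HaltsWithin.ite (T := 20) (by decide) (fun hb => ?_) (fun hb => ?_)
  · simp only [BExpr.eval, RExpr.eval, NExpr.eval, e11, e12, e13, e14] at hb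
    have hrv : r = v := Prod.ext (le_antisymm hb.1.1 hb.1.2) (le_antisymm hb.2.1 hb.2.2)
    refine HaltsWithin.skip (by decide) (HaltsWithin.nil ⟨v, [], hK, hin₂, n10, ?_, n11, ?_, ?_⟩)
    · simp [State.listed, e13, e14]
    · simp [State.stack, e15, e16]
    · refine ⟨by simp, by simp, by simp, by simp, fun _ x hx => ?_⟩
      have h1 := hrmax x hx
      rw [hrv] at h1
      simp only [lexValue, Prod.Lex.toLex_le_toLex] at h1
      rcases hK.above x hx with h2 | h2 | ⟨h2, h3⟩
      · exact h2
      · rcases h1 with h1 | h1 <;> linarith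
      · rcases h1 with h1 | h1 <;> linarith
  · simp only [BExpr.eval, RExpr.eval, NExpr.eval, e11, e12, e13, e14] at hb
    have hrv : r ≠ v := by
      rintro rfl
      exact hb ⟨⟨le_rfl, le_rfl⟩, ⟨le_rfl, le_rfl⟩⟩
    have hrK : r ∈ vertices (poly wt) := mem_vertices_of_lexValue_le hr (by norm_num) hrmax
    refine (HaltsWithin.cons_setReal <| .cons_setReal <| .cons_setNat <| .nil <| .nil
      ⟨v, [r], hK, ?_, ?_, ?_, ?_, ?_, ?_⟩).mono (by decide) fun _ h => h
    · refine hin₂.congr ?_ ?_ ?_ ?_ <;> (funext i; simp)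
    · simp [n10]
    · simp [State.listed, e13, e14]
    · simp [NExpr.eval]
    · simp [State.stack, List.range_succ, RExpr.eval, NExpr.eval, e11, e12, e15, e16]
    · exact ⟨by simpa using hrK, by simpa using hrv, by simp, by simp, by simp⟩

/-- Compute the vertices of the polygon. -/
def polygonProgram : Prog :=
  .block [initRows, hullInit, .loop (.natLe (.lit 1) (.reg 11)) hullStep,
    -- The traversal ends by listing `v` a second time; the subtraction drops this copy.
    .forLoop 12 (.sub (.reg 10) (.lit 1)) (.block [
      .setReal 0 (.add (.reg 12) (.reg 12)) (.read 13 (.reg 12)),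
      .setReal 0 (.add (.add (.reg 12) (.reg 12)) (.lit 1)) (.read 14 (.reg 12))]),
    .setNat 0 (.lit 0) (.sub (.reg 10) (.lit 1))]

theorem polygonProgram_spec (e : Fin n ≃ α) (wt : α → ℝ × ℝ)
    (hfin : (vertices (poly wt)).Finite) :
    HaltsWithin polygonProgram (10000 * ((vertices (poly wt)).ncard + 1) * (n + 1) ^ 5)
      (fun s' => IsVertexList (poly wt) (output s')) (inputState e wt) := by
  set V := (vertices (poly wt)).ncard with hV
  refine (HaltsWithin.cons <| (initRows_spec e wt).mono le_rfl fun s₁ h₁ => .cons <|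
    (hullInit_spec h₁).mono le_rfl ?_).mono (T := 50 * (n + 1) + (4000 * (n + 1) ^ 5 + 200 +
      ((2 * V * (4 + (2000 * (n + 1) ^ 5 + 300) + 1) + 4 + 1) + (V * 50 + 50)))) ?_ fun _ h => h
  · rintro s₂ ⟨v, l', hK, h₂⟩
    refine HaltsWithin.cons ((HaltsWithin.loop (T := 2000 * (n + 1) ^ 5 + 300)
      -- Inserting a vertex and advancing both increase `2 * l.length + l'.length` by one. As `l`
      -- and `l'` together have at most `V - 1` vertices, `2 * V` rounds suffice, including the one
      -- that closes the polygon.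
      (fun j s => (∃ l l', 2 * V ≤ j + 2 * l.length + l'.length + 1 ∧ HullMem e wt v l l' s) ∨
        ∃ l, HullDone wt v l s) (2 * V) ?_ ?_ ?_).mono (by simp [BExpr.cost, NExpr.cost]) ?_)
    · exact .inl ⟨[], l', by omega, h₂⟩
    · rintro s (⟨l, l', hj, h⟩ | ⟨l, h⟩) hb
      · have := h.traversal.length_le hK.vertex hfin
        rw [List.length_append] at this
        omega
      · simp [BExpr.eval, NExpr.eval, h.height] at hb
    · rintro j s (⟨l, l', hj, h⟩ | ⟨l, h⟩) hb
      · refine (hullStep_spec h hK).mono le_rfl ?_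
        rintro s' (⟨r, h'⟩ | ⟨q, l'', rfl, h'⟩ | ⟨rfl, h'⟩)
        · exact .inl ⟨l, r :: l', by rw [List.length_cons]; omega, h'⟩
        · refine .inl ⟨l ++ [q], l'', ?_, h'⟩
          simp only [List.length_append, List.length_cons, List.length_nil] at hj ⊢
          omega
        · exact .inr ⟨l, h'⟩
      · simp [BExpr.eval, NExpr.eval, h.height] at hb
    · rintro s₃ ⟨⟨j, ⟨l, l', hj, h⟩ | ⟨l, h⟩⟩, hb⟩
      · simp [BExpr.eval, NExpr.eval, h.height] at hb
      have hlen : l.length + 1 ≤ V := by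
        have := h.traversal.length_le hK.vertex hfin
        simpa using this
      refine (HaltsWithin.cons (T := (l.length + 1) * (4 + 25 + 12) + 4 + 9) (T' := 10)
        ((HaltsWithin.forLoop (k := l.length + 1) (T := 25) (fun k s => s.nat 10 = s₃.nat 10 ∧
        s.real 13 = s₃.real 13 ∧ s.real 14 = s₃.real 14 ∧
        ∀ i < k, s.real 0 (2 * i) = s₃.real 13 i ∧ s.real 0 (2 * i + 1) = s₃.real 14 i)
        (by decide) ?_ ?_ ?_).mono (by simp [NExpr.cost]) ?_)).mono ?_ fun _ h => h
      · refine ⟨?_, rfl, rfl, fun i hi => absurd hi (by omega)⟩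
        funext; simp
      · rintro k s ⟨h10, -⟩
        simp [NExpr.eval, h10, h.size]
      · rintro k s hk ⟨h10, h13, h14, h0⟩ h12
        refine (HaltsWithin.cons_setReal <| .cons_setReal <| .nil ?_).mono (by decide)
          fun _ h => h
        refine ⟨?_, ?_, ?_, fun i hi => ?_⟩
        · funext; simp [h10]
        · funext; simp [h13]
        · funext; simp [h14]
        · have p1 : ¬ 2 * i = k + k + 1 := by omega
          have p2 : ¬ 2 * i + 1 = k + k := by omega
          simp only [RExpr.eval, NExpr.eval, State.setNat_real, State.setReal_real,
            State.setReal_nat, h12, h13, h14, p1, p2, true_and, Nat.reduceEqDiff, false_and,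
            if_false]
          by_cases hik : i = k
          · subst hik
            rw [if_pos (by omega), if_pos (by omega)]
            exact ⟨rfl, rfl⟩
          · rw [if_neg (by omega), if_neg (by omega)]
            exact h0 i (by omega)
      · rintro s₄ ⟨h10, h13, h14, h0⟩
        refine (HaltsWithin.cons_setNat <| .nil ?_).mono (by decide) fun _ h => h
        refine h.traversal.isVertexList hK h.left (by simp [NExpr.eval, h10, h.size])
          fun i => ?_
        have hi : (i : ℕ) < l.length + 1 := by
          have := i.2
          simpa [NExpr.eval, h10, h.size] using this
        rw [← h.listed]
        simp only [State.listed, List.getElem?_map, List.getElem?_range hi, Option.map_some]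
        simp only [output, State.setNat_real]
        rw [(h0 i hi).1, (h0 i hi).2]
      · have := Nat.mul_le_mul_right 50 hlen
        omega
  · have h1 : n + 1 ≤ (n + 1) ^ 5 := Nat.le_self_pow (by omega) _
    set N := (n + 1) ^ 5
    have h2 : 1 ≤ N := by omega
    have h3 : V ≤ V * N := Nat.le_mul_of_pos_right _ h2
    have e1 : 10000 * (V + 1) * N = 10000 * (V * N) + 10000 * N := by ring
    have e2 : 2 * V * (4 + (2000 * N + 300) + 1) = 4000 * (V * N) + 610 * V := by ring
    rw [e1, e2]
    omega

end Polygon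

/-! ### Separators from tree-decompositions -/

section Separator

variable {V ι : Type*} {G : SimpleGraph V} {T : SimpleGraph ι} {bag : ι → Finset V}

/-- The nodes on the side of `j` when the edge `i j` of a tree is deleted. -/
def side (T : SimpleGraph ι) (i j : ι) : Set ι := {k | (T.deleteEdges {s(i, j)}).Reachable j k}

theorem notMem_side (hT : T.IsTree) {i j : ι} (h : T.Adj i j) : i ∉ side T i j := fun hi =>
  SimpleGraph.isBridge_iff.1 (SimpleGraph.isAcyclic_iff_forall_adj_isBridge.1 hT.isAcyclic h)
    hi.symm

/-- A path on the side of `j` avoids `i`, so it survives when another edge at `i` is deleted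
instead. -/
theorem reachable_of_mem_side (hT : T.IsTree) {i j x : ι} (h : T.Adj i j) (hx : x ∈ side T i j)
    (k : ι) : (T.deleteEdges {s(k, i)}).Reachable j x := by
  have hi := notMem_side hT h
  suffices ∀ D : SimpleGraph ι, D ≤ T → (∀ y, D.Reachable y j → y ≠ i) → ∀ x, D.Walk x j →
      (T.deleteEdges {s(k, i)}).Reachable j x by
    obtain ⟨p⟩ := SimpleGraph.Reachable.symm hx
    exact this _ (T.deleteEdges_le _) (fun y hy hyi => by subst hyi; exact hi hy.symm) x p
  intro D hD hne x p
  clear hi hx h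
  induction p with
  | nil => exact SimpleGraph.Reachable.refl _
  | @cons u v w huv p ih =>
    have hv := hne v ⟨p⟩
    have hu := hne u (huv.reachable.trans ⟨p⟩)
    refine (ih hne).trans (SimpleGraph.Adj.reachable ?_)
    rw [SimpleGraph.deleteEdges_adj]
    refine ⟨(hD huv).symm, ?_⟩
    simp only [Set.mem_singleton_iff, Sym2.eq_iff]
    rintro (⟨-, rfl⟩ | ⟨rfl, -⟩)
    · exact hu rfl
    · exact hv rfl

/-- Moving on into a side shrinks it strictly; this is the descent in the search for a separator. -/
theorem side_ssubset (hT : T.IsTree) {i j k : ι} (hij : T.Adj i j) (hjk : T.Adj j k) (hki : k ≠ i) :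
    side T j k ⊂ side T i j := by
  refine ⟨fun x hx => ?_, fun hsub => notMem_side hT hjk (hsub (SimpleGraph.Reachable.refl j))⟩
  refine SimpleGraph.Reachable.trans (SimpleGraph.Adj.reachable ?_)
    (reachable_of_mem_side hT hjk hx i)
  rw [SimpleGraph.deleteEdges_adj]
  refine ⟨hjk, ?_⟩
  simp only [Set.mem_singleton_iff, Sym2.eq_iff]
  rintro (⟨rfl, -⟩ | ⟨-, rfl⟩)
  · exact hij.ne rfl
  · exact hki rfl

theorem side_unique (hT : T.IsTree) {i j j' x : ι} (hj : T.Adj i j) (hj' : T.Adj i j')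
    (hx : x ∈ side T i j) (hx' : x ∈ side T i j') : j = j' := by
  by_contra hne
  have h1 : (T.deleteEdges {s(i, j)}).Reachable j' x := by
    have := reachable_of_mem_side hT hj' hx' j
    rwa [Sym2.eq_swap] at this
  refine notMem_side hT hj (SimpleGraph.Reachable.trans hx
    (h1.symm.trans (SimpleGraph.Adj.reachable ?_)))
  rw [SimpleGraph.deleteEdges_adj]
  refine ⟨hj'.symm, ?_⟩
  simp only [Set.mem_singleton_iff, Sym2.eq_iff]
  rintro (⟨-, rfl⟩ | ⟨rfl, -⟩)
  · exact hj.ne rfl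
  · exact hne rfl

theorem side_disjoint (hT : T.IsTree) {i j x : ι} (hij : T.Adj i j) (hx : x ∈ side T i j)
    (hx' : x ∈ side T j i) : False := by
  unfold side at hx'
  rw [Sym2.eq_swap] at hx'
  exact notMem_side hT hij (SimpleGraph.Reachable.trans hx (SimpleGraph.Reachable.symm hx'))

theorem mem_side_of_adj {i j x y : ι} (hx : x ∈ side T i j) (hxy : T.Adj x y) (hxi : x ≠ i)
    (hyi : y ≠ i) : y ∈ side T i j := by
  refine SimpleGraph.Reachable.trans hx (SimpleGraph.Adj.reachable ?_)
  rw [SimpleGraph.deleteEdges_adj]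
  refine ⟨hxy, ?_⟩
  simp only [Set.mem_singleton_iff, Sym2.eq_iff]
  rintro (⟨rfl, -⟩ | ⟨-, rfl⟩)
  · exact hxi rfl
  · exact hyi rfl

theorem exists_mem_side (hT : T.IsTree) {i x : ι} (hx : x ≠ i) : ∃ j, T.Adj i j ∧ x ∈ side T i j := by
  obtain ⟨p⟩ := hT.1.preconnected x i
  induction p with
  | nil => exact absurd rfl hx
  | @cons u v w huv p ih =>
    by_cases hv : v = w
    · subst hv
      exact ⟨u, huv.symm, SimpleGraph.Reachable.refl u⟩
    · obtain ⟨j, hj, hvj⟩ := ih hv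
      exact ⟨j, hj, mem_side_of_adj hvj huv.symm hv hx⟩

/-- The nodes whose bags contain `v` are connected in the tree and avoid `i`, so they cannot change
sides. -/
theorem IsTreeDecomposition.mem_side (h : IsTreeDecomposition G T bag) {i j : ι} {v : V}
    (hv : v ∉ bag i) {k k' : ι} (hk : v ∈ bag k) (hk' : v ∈ bag k') (hkj : k ∈ side T i j) :
    k' ∈ side T i j := by
  have hconn := (h.connected v).preconnected ⟨k, hk⟩ ⟨k', hk'⟩
  obtain ⟨p⟩ := hconn
  suffices ∀ (a b : {i | v ∈ bag i}), (T.induce {i | v ∈ bag i}).Walk a b →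
      (a : ι) ∈ side T i j → (b : ι) ∈ side T i j from this _ _ p hkj
  intro a b p
  induction p with
  | nil => exact id
  | @cons a b c hab p ih =>
    intro ha
    refine ih (mem_side_of_adj ha hab ?_ ?_)
    · rintro rfl; exact hv a.2
    · rintro rfl; exact hv b.2

/-- Some bag splits the graph into parts, the colour classes of `c`, that each contain at most half
of the vertices in `X`. -/
theorem IsTreeDecomposition.exists_separator [Finite ι] [DecidableEq V] [DecidableEq ι] (h : IsTreeDecomposition G T bag)
    (X : Finset V) : ∃ (i : ι) (c : V → ι),
      (∀ u v, G.Adj u v → u ∉ bag i → v ∉ bag i → c u = c v) ∧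
      ∀ j, 2 * (X.filter fun v => v ∉ bag i ∧ c v = j).card ≤ X.card := by
  have hT := h.isTree
  have hnode : ∀ v, ∃ k, v ∈ bag k := fun v => by
    obtain ⟨⟨k, hk⟩⟩ := (h.connected v).nonempty
    exact ⟨k, hk⟩
  -- The colour of `v` is the neighbour of `i` towards the bags that contain `v`.
  have hcol : ∀ i v, ∃ j, v ∉ bag i → T.Adj i j ∧ ∀ k, v ∈ bag k → k ∈ side T i j := by
    intro i v
    by_cases hv : v ∈ bag i
    · exact ⟨i, fun h => absurd hv h⟩
    · obtain ⟨k, hk⟩ := hnode v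
      obtain ⟨j, hj, hkj⟩ := exists_mem_side hT (i := i) (x := k) (by rintro rfl; exact hv hk)
      exact ⟨j, fun _ => ⟨hj, fun k' hk' => h.mem_side hv hk hk' hkj⟩⟩
  choose c hc using hcol
  suffices ∃ i, ∀ j, 2 * (X.filter fun v => v ∉ bag i ∧ c i v = j).card ≤ X.card by
    obtain ⟨i, hi⟩ := this
    -- Adjacent vertices share a bag, which lies on one side only.
    refine ⟨i, c i, fun u v huv hu hv => ?_, hi⟩
    obtain ⟨k, hku, hkv⟩ := h.edge u v huv
    exact side_unique hT (hc i u hu).1 (hc i v hv).1 ((hc i u hu).2 k hku) ((hc i v hv).2 k hkv)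
  -- Otherwise every node `i` has a neighbour `f i` whose side holds more than half of `X`.
  by_contra hcon
  push Not at hcon
  choose f hf using hcon
  have hwit : ∀ i, ∃ v ∈ X, v ∉ bag i ∧ c i v = f i := by
    intro i
    have : 0 < (X.filter fun v => v ∉ bag i ∧ c i v = f i).card := by
      have := hf i
      omega
    obtain ⟨v, hv⟩ := Finset.card_pos.1 this
    exact ⟨v, (Finset.mem_filter.1 hv).1, (Finset.mem_filter.1 hv).2⟩
  have hadj : ∀ i, T.Adj i (f i) := by
    intro i
    obtain ⟨v, -, hv, hcv⟩ := hwit i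
    exact hcv ▸ (hc i v hv).1
  have := hT.1.nonempty
  -- Take a smallest heavy side. If `f` leads back to `i`, two disjoint sets each hold a majority of
  -- `X`; otherwise the heavy side at `f i` is strictly smaller.
  obtain ⟨i, hi⟩ := Finite.exists_min fun i => (side T i (f i)).ncard
  by_cases hback : f (f i) = i
  · have hdisj : Disjoint (X.filter fun v => v ∉ bag i ∧ c i v = f i)
        (X.filter fun v => v ∉ bag (f i) ∧ c (f i) v = f (f i)) := by
      rw [Finset.disjoint_left]
      intro v hv hv'
      simp only [Finset.mem_filter] at hv hv'
      obtain ⟨k, hk⟩ := hnode v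
      have h1 := (hc i v hv.2.1).2 k hk
      have h2 := (hc (f i) v hv'.2.1).2 k hk
      rw [hv.2.2] at h1
      rw [hv'.2.2, hback] at h2
      exact side_disjoint hT (hadj i) h1 h2
    have h1 := Finset.card_union_of_disjoint hdisj
    have h2 := Finset.card_le_card (Finset.union_subset
      (Finset.filter_subset (fun v => v ∉ bag i ∧ c i v = f i) X)
      (Finset.filter_subset (fun v => v ∉ bag (f i) ∧ c (f i) v = f (f i)) X))
    have h3 := hf i
    have h4 := hf (f i)
    omega
  · have := Set.ncard_lt_ncard (side_ssubset hT (hadj i) (hadj (f i)) hback) (Set.toFinite _)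
    have := hi (f i)
    omega

/-- Every finite graph has a tree-decomposition whose width is the treewidth. -/
theorem exists_treeDecomposition [Fintype V] (G : SimpleGraph V) :
    ∃ (m : ℕ) (T : SimpleGraph (Fin m)) (bag : Fin m → Finset V),
      IsTreeDecomposition G T bag ∧ ∀ i, (bag i).card ≤ treewidth G + 1 := by
  have hne : {k | ∃ (m : ℕ) (T : SimpleGraph (Fin m)) (bag : Fin m → Finset V),
      IsTreeDecomposition G T bag ∧ decompositionWidth bag = k}.Nonempty := by
    -- A single bag with all vertices shows that the infimum is attained.
    refine ⟨_, 1, ⊥, fun _ => Finset.univ, ⟨?_, ?_, ?_⟩, rfl⟩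
    · exact SimpleGraph.IsTree.of_subsingleton
    · intro v
      have : Nonempty {i : Fin 1 | v ∈ (Finset.univ : Finset V)} := ⟨⟨0, by simp⟩⟩
      have : Subsingleton {i : Fin 1 | v ∈ (Finset.univ : Finset V)} :=
        ⟨fun a b => Subtype.ext (Subsingleton.elim _ _)⟩
      exact SimpleGraph.IsTree.of_subsingleton.1
    · intro u v _
      exact ⟨0, by simp⟩
  obtain ⟨m, T, bag, hT, hw⟩ := Nat.sInf_mem hne
  refine ⟨m, T, bag, hT, fun i => ?_⟩
  have h1 : (bag i).card ≤ Finset.univ.sup fun i => (bag i).card :=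
    Finset.le_sup (f := fun i => (bag i).card) (Finset.mem_univ i)
  have h2 : decompositionWidth bag = treewidth G := hw
  unfold decompositionWidth at h2
  omega

end Separator

/-! ### The number of vertices -/

section Upper

open scoped Pointwise Classical

/-- The points of a finite set that are the unique maximum of some functional `l * x + y`. -/
noncomputable def upper (A : Finset (ℝ × ℝ)) : Finset (ℝ × ℝ) :=
  A.filter fun p => ∃ l : ℝ, ∀ x ∈ A, x ≠ p → l * x.1 + x.2 < l * p.1 + p.2

theorem mem_upper {A : Finset (ℝ × ℝ)} {p : ℝ × ℝ} :
    p ∈ upper A ↔ p ∈ A ∧ ∃ l : ℝ, ∀ x ∈ A, x ≠ p → l * x.1 + x.2 < l * p.1 + p.2 :=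
  Finset.mem_filter

theorem upper_union_subset (A B : Finset (ℝ × ℝ)) : upper (A ∪ B) ⊆ upper A ∪ upper B := by
  intro p hp
  obtain ⟨hp, l, hl⟩ := mem_upper.1 hp
  rw [Finset.mem_union] at hp ⊢
  refine hp.imp (fun hp => mem_upper.2 ⟨hp, l, fun x hx => hl x (Finset.mem_union_left _ hx)⟩)
    fun hp => mem_upper.2 ⟨hp, l, fun x hx => hl x (Finset.mem_union_right _ hx)⟩

theorem card_upper_biUnion_le {ι : Type*} (s : Finset ι) (A : ι → Finset (ℝ × ℝ)) :
    (upper (s.biUnion A)).card ≤ ∑ i ∈ s, (upper (A i)).card := by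
  induction s using Finset.induction_on with
  | empty => simp [upper]
  | insert i s hi ih =>
    rw [Finset.biUnion_insert, Finset.sum_insert hi]
    exact (Finset.card_le_card (upper_union_subset _ _)).trans
      ((Finset.card_union_le _ _).trans (Nat.add_le_add_left ih _))

/-- The number of upper points to the left of `a`. -/
noncomputable def upperRank (A : Finset (ℝ × ℝ)) (a : ℝ × ℝ) : ℕ :=
  ((upper A).filter fun x => x.1 < a.1).card

theorem upperRank_lt_card {A : Finset (ℝ × ℝ)} {a : ℝ × ℝ} (ha : a ∈ upper A) :
    upperRank A a < (upper A).card :=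
  Finset.card_lt_card (Finset.filter_ssubset.2 ⟨a, ha, lt_irrefl _⟩)

theorem upperRank_lt {A : Finset (ℝ × ℝ)} {a b : ℝ × ℝ} (ha : a ∈ upper A) (hab : a.1 < b.1) :
    upperRank A a < upperRank A b := by
  refine Finset.card_lt_card ⟨fun x hx => ?_, fun h => ?_⟩
  · rw [Finset.mem_filter] at hx ⊢
    exact ⟨hx.1, hx.2.trans hab⟩
  · have := h (Finset.mem_filter.2 ⟨ha, hab⟩)
    exact lt_irrefl _ (Finset.mem_filter.1 this).2

/-- As the slope `l` grows, the maximum moves to the right: adding the two optimality inequalities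
gives `0 < (l' - l) * (b.1 - a.1)`. -/
theorem eq_or_upperRank_lt {A : Finset (ℝ × ℝ)} {a b : ℝ × ℝ} {l l' : ℝ} (ha : a ∈ A) (hb : b ∈ A)
    (hla : ∀ x ∈ A, x ≠ a → l * x.1 + x.2 < l * a.1 + a.2)
    (hlb : ∀ x ∈ A, x ≠ b → l' * x.1 + x.2 < l' * b.1 + b.2) (hl : l ≤ l') :
    a = b ∨ upperRank A a < upperRank A b := by
  by_cases hab : a = b
  · exact .inl hab
  · refine .inr (upperRank_lt (mem_upper.2 ⟨ha, l, hla⟩) ?_)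
    have h1 := hla b hb (Ne.symm hab)
    have h2 := hlb a ha hab
    have h3 : 0 < (l' - l) * (b.1 - a.1) := by linarith
    have := pos_of_mul_pos_right h3 (by linarith)
    linarith

/-- The number of upper points of a Minkowski sum. -/
theorem card_upper_add_le {A B : Finset (ℝ × ℝ)} {x y : ℕ} (hA : (upper A).card ≤ x + 1)
    (hB : (upper B).card ≤ y + 1) : (upper (A + B)).card ≤ x + y + 1 := by
  -- A unique maximum of a sum splits into unique maxima of the summands for the same functional.
  have hdec : ∀ p ∈ upper (A + B), ∃ (a b : ℝ × ℝ) (l : ℝ), a ∈ A ∧ b ∈ B ∧ a + b = p ∧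
      (∀ x ∈ A, x ≠ a → l * x.1 + x.2 < l * a.1 + a.2) ∧
      ∀ x ∈ B, x ≠ b → l * x.1 + x.2 < l * b.1 + b.2 := by
    intro p hp
    obtain ⟨hp, l, hl⟩ := mem_upper.1 hp
    obtain ⟨a, ha, b, hb, rfl⟩ := Finset.mem_add.1 hp
    refine ⟨a, b, l, ha, hb, rfl, fun x hx hxa => ?_, fun x hx hxb => ?_⟩
    · have := hl (x + b) (Finset.add_mem_add hx hb) (by simpa using hxa)
      simp only [Prod.fst_add, Prod.snd_add] at this
      linarith
    · have := hl (a + x) (Finset.add_mem_add ha hx) (by simpa using hxb)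
      simp only [Prod.fst_add, Prod.snd_add] at this
      linarith
  choose! a b l ha hb hab hla hlb using hdec
  rw [← Finset.card_range (x + y + 1)]
  -- Both ranks grow weakly with the slope, so equal sums of ranks force equal summands. The sums
  -- range from `0` to `x + y`.
  refine Finset.card_le_card_of_injOn (fun p => upperRank A (a p) + upperRank B (b p)) ?_ ?_
  · intro p hp
    have h1 := upperRank_lt_card (mem_upper.2 ⟨ha p hp, l p, hla p hp⟩)
    have h2 := upperRank_lt_card (mem_upper.2 ⟨hb p hp, l p, hlb p hp⟩)
    simp only [Finset.coe_range, Set.mem_Iio]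
    omega
  · have key : ∀ p ∈ upper (A + B), ∀ q ∈ upper (A + B), l p ≤ l q →
        upperRank A (a p) + upperRank B (b p) = upperRank A (a q) + upperRank B (b q) → p = q := by
      intro p hp q hq hpq h
      rw [← hab p hp, ← hab q hq]
      rcases eq_or_upperRank_lt (ha p hp) (ha q hq) (hla p hp) (hla q hq) hpq with h1 | h1
      · rcases eq_or_upperRank_lt (hb p hp) (hb q hq) (hlb p hp) (hlb q hq) hpq with h2 | h2
        · rw [h1, h2]
        · rw [h1] at h
          omega
      · rcases eq_or_upperRank_lt (hb p hp) (hb q hq) (hlb p hp) (hlb q hq) hpq with h2 | h2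
        · rw [h2] at h
          omega
        · omega
    intro p hp q hq h
    rcases le_total (l p) (l q) with hl | hl
    · exact key p hp q hq hl h
    · exact (key q hq p hp hl h.symm).symm

/-- Each vertex of the convex hull of a finite set is an upper point of the set or of its
reflection. -/
theorem vertices_subset (A : Finset (ℝ × ℝ)) :
    vertices (convexHull ℝ (A : Set (ℝ × ℝ))) ⊆
      (upper A : Set (ℝ × ℝ)) ∪ Neg.neg '' (upper (A.image Neg.neg) : Set (ℝ × ℝ)) := by
  intro p hp
  have hpA : p ∈ A := extremePoints_convexHull_subset hp
  have hnot : p ∉ convexHull ℝ ((A : Set (ℝ × ℝ)) \ {p}) := by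
    intro h
    refine ((Convex.mem_extremePoints_iff_mem_sdiff_convexHull_sdiff
      (convex_convexHull ℝ _)).1 hp).2 ?_
    exact convexHull_mono (Set.sdiff_subset_sdiff_left (subset_convexHull ℝ _)) h
  have hclosed : IsClosed (convexHull ℝ ((A : Set (ℝ × ℝ)) \ {p})) :=
    (Set.Finite.isCompact_convexHull ℝ (A.finite_toSet.subset Set.sdiff_subset)).isClosed
  -- A vertex is strictly separated from the other points. The sign of the second coefficient of `f`
  -- decides between the upper hull and the reflected one.
  obtain ⟨f, u, hfp, hfu⟩ := geometric_hahn_banach_point_closed (convex_convexHull ℝ _) hclosed hnot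
  have hf : ∀ x : ℝ × ℝ, f x = f (1, 0) * x.1 + f (0, 1) * x.2 := by
    intro x
    have : x = x.1 • ((1, 0) : ℝ × ℝ) + x.2 • ((0, 1) : ℝ × ℝ) := by ext <;> simp
    conv_lhs => rw [this]
    rw [map_add, map_smul, map_smul, smul_eq_mul, smul_eq_mul]
    ring
  have hlt : ∀ x ∈ A, x ≠ p → f (1, 0) * p.1 + f (0, 1) * p.2 < f (1, 0) * x.1 + f (0, 1) * x.2 := by
    intro x hx hxp
    rw [← hf, ← hf]
    exact hfp.trans (hfu x (subset_convexHull ℝ _ ⟨hx, hxp⟩))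
  rcases lt_trichotomy (f (0, 1)) 0 with h0 | h0 | h0
  · refine .inl (mem_upper.2 ⟨hpA, f (1, 0) / f (0, 1), fun x hx hxp => ?_⟩)
    have := hlt x hx hxp
    have e : ∀ y : ℝ × ℝ, f (1, 0) / f (0, 1) * y.1 + y.2
        = (f (1, 0) * y.1 + f (0, 1) * y.2) / f (0, 1) := fun y => by
      field_simp [h0.ne]
    rw [e, e]
    exact div_lt_div_of_neg_of_lt h0 this
  · simp only [h0, zero_mul, add_zero] at hlt
    -- A purely horizontal functional is not of the form `l * x + y`, but a large multiple of it
    -- plus `y` still has its unique maximum at `p`.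
    have hev : ∀ᶠ t : ℝ in Filter.atTop, ∀ x ∈ A, x ≠ p →
        t * -f (1, 0) * x.1 + x.2 < t * -f (1, 0) * p.1 + p.2 := by
      rw [Filter.eventually_all_finset]
      intro x hx
      by_cases hxp : x = p
      · simp [hxp]
      · have hpos : 0 < f (1, 0) * x.1 - f (1, 0) * p.1 := by
          have := hlt x hx hxp
          linarith
        filter_upwards [Filter.eventually_gt_atTop ((x.2 - p.2) /
          (f (1, 0) * x.1 - f (1, 0) * p.1))] with t ht _
        rw [div_lt_iff₀ hpos] at ht
        linarith
    obtain ⟨t, ht⟩ := hev.exists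
    exact .inl (mem_upper.2 ⟨hpA, _, ht⟩)
  · refine .inr ⟨-p, mem_upper.2 ⟨Finset.mem_image_of_mem _ hpA, f (1, 0) / f (0, 1),
      fun x hx hxp => ?_⟩, neg_neg p⟩
    obtain ⟨x, hxA, rfl⟩ := Finset.mem_image.1 hx
    have := hlt x hxA fun h => hxp (by rw [h])
    have e : ∀ y : ℝ × ℝ, f (1, 0) / f (0, 1) * (-y).1 + (-y).2
        = - (f (1, 0) * y.1 + f (0, 1) * y.2) / f (0, 1) := fun y => by
      simp only [Prod.fst_neg, Prod.snd_neg]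
      field_simp [h0.ne']
      ring
    rw [e, e]
    exact div_lt_div_of_pos_right (by linarith) h0

end Upper

/-! ### Lower sets as solutions of local constraints, and their recursive count -/

section Extensions

open scoped Pointwise Classical

variable {α : Type*} {R : α → α → Prop}

/-- The set obtained from `A` by replacing its part in `X` by `B` satisfies the constraints `R a b`,
that `a` is present whenever `b` is, for which one of `a` and `b` lies in `X`. -/
def IsExtension (R : α → α → Prop) (A X B : Finset α) : Prop :=
  ∀ a b, R a b → (a ∈ X ∨ b ∈ X) → b ∈ A \ X ∪ B → a ∈ A \ X ∪ B

/-- The subsets of `X` that extend `A`. -/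
noncomputable def extensions (R : α → α → Prop) (A X : Finset α) : Finset (Finset α) :=
  X.powerset.filter (IsExtension R A X)

theorem mem_extensions {A X B : Finset α} :
    B ∈ extensions R A X ↔ B ⊆ X ∧ IsExtension R A X B := by
  rw [extensions, Finset.mem_filter, Finset.mem_powerset]

/-- The points that represent the subsets of `X` that extend `A`. -/
noncomputable def extensionPoints (R : α → α → Prop) (wt : α → ℝ × ℝ) (A X : Finset α) :
    Finset (ℝ × ℝ) :=
  (extensions R A X).image fun B => ∑ a ∈ B, wt a

theorem mem_extensionPoints {wt : α → ℝ × ℝ} {A X : Finset α} {p : ℝ × ℝ} :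
    p ∈ extensionPoints R wt A X ↔ ∃ B, B ⊆ X ∧ IsExtension R A X B ∧ ∑ a ∈ B, wt a = p := by
  simp only [extensionPoints, Finset.mem_image, mem_extensions, and_assoc]

theorem card_upper_extensionPoints_empty (wt : α → ℝ × ℝ) (A : Finset α) :
    (upper (extensionPoints R wt A ∅)).card ≤ 1 := by
  refine (Finset.card_le_card (Finset.filter_subset _ _)).trans ?_
  refine Finset.card_image_le.trans ?_
  rw [extensions, Finset.powerset_empty]
  exact (Finset.card_le_card (Finset.filter_subset _ _)).trans (by simp)

/-- For independent parts, the extensions are chosen independently. -/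
theorem extensionPoints_union (wt : α → ℝ × ℝ) (A : Finset α) {Y Z : Finset α}
    (hd : Disjoint Y Z) (hR : ∀ a b, R a b → ¬ (a ∈ Y ∧ b ∈ Z) ∧ ¬ (a ∈ Z ∧ b ∈ Y)) :
    extensionPoints R wt A (Y ∪ Z) = extensionPoints R wt A Y + extensionPoints R wt A Z := by
  have hYZ : ∀ a, a ∈ Y → a ∉ Z := fun a h1 h2 => Finset.disjoint_left.1 hd h1 h2
  have hiff : ∀ B C : Finset α, B ⊆ Y → C ⊆ Z →
      (IsExtension R A (Y ∪ Z) (B ∪ C) ↔ IsExtension R A Y B ∧ IsExtension R A Z C) := by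
    intro B C hB hC
    have hBZ : ∀ a, a ∈ B → a ∉ Z := fun a h => hYZ a (hB h)
    have hCY : ∀ a, a ∈ C → a ∉ Y := fun a h h' => hYZ a h' (hC h)
    -- A constraint that touches `Y` does not touch `Z`, so its truth does not depend on the choice
    -- in `Z`; `m2` is the mirror image.
    have m1 : ∀ a, a ∉ Z → (a ∈ A \ (Y ∪ Z) ∪ (B ∪ C) ↔ a ∈ A \ Y ∪ B) := by
      intro a ha
      have : a ∉ C := fun h => ha (hC h)
      simp only [Finset.mem_union, Finset.mem_sdiff]
      tauto
    have m2 : ∀ a, a ∉ Y → (a ∈ A \ (Y ∪ Z) ∪ (B ∪ C) ↔ a ∈ A \ Z ∪ C) := by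
      intro a ha
      have : a ∉ B := fun h => ha (hB h)
      simp only [Finset.mem_union, Finset.mem_sdiff]
      tauto
    constructor
    · refine fun h => ⟨fun a b hab hY => ?_, fun a b hab hZ => ?_⟩
      · have ⟨h1, h2⟩ := hR a b hab
        have ha : a ∉ Z := fun h => hY.elim (fun h' => hYZ a h' h) fun h' => h2 ⟨h, h'⟩
        have hb : b ∉ Z := fun h => hY.elim (fun h' => h1 ⟨h', h⟩) fun h' => hYZ b h' h
        rw [← m1 a ha, ← m1 b hb]
        exact h a b hab (hY.imp (Finset.mem_union_left _) (Finset.mem_union_left _))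
      · have ⟨h1, h2⟩ := hR a b hab
        have ha : a ∉ Y := fun h => hZ.elim (fun h' => hYZ a h h') fun h' => h1 ⟨h, h'⟩
        have hb : b ∉ Y := fun h => hZ.elim (fun h' => h2 ⟨h', h⟩) fun h' => hYZ b h h'
        rw [← m2 a ha, ← m2 b hb]
        exact h a b hab (hZ.imp (Finset.mem_union_right _) (Finset.mem_union_right _))
    · rintro ⟨hY, hZ⟩ a b hab hor
      have ⟨h1, h2⟩ := hR a b hab
      simp only [Finset.mem_union (s := Y)] at hor
      by_cases hYm : a ∈ Y ∨ b ∈ Y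
      · have ha : a ∉ Z := fun h => hYm.elim (fun h' => hYZ a h' h) fun h' => h2 ⟨h, h'⟩
        have hb : b ∉ Z := fun h => hYm.elim (fun h' => h1 ⟨h', h⟩) fun h' => hYZ b h' h
        rw [m1 a ha, m1 b hb]
        exact hY a b hab hYm
      · have hZm : a ∈ Z ∨ b ∈ Z := by tauto
        rw [m2 a (by tauto), m2 b (by tauto)]
        exact hZ a b hab hZm
  ext p
  rw [Finset.mem_add]
  simp only [mem_extensionPoints]
  constructor
  · rintro ⟨D, hD, hext, rfl⟩
    have hDe : D = D ∩ Y ∪ D ∩ Z := by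
      rw [← Finset.inter_union_distrib_left, Finset.inter_eq_left.2 hD]
    have hdis : Disjoint (D ∩ Y) (D ∩ Z) :=
      hd.mono Finset.inter_subset_right Finset.inter_subset_right
    rw [hDe, hiff _ _ Finset.inter_subset_right Finset.inter_subset_right] at hext
    refine ⟨_, ⟨D ∩ Y, Finset.inter_subset_right, hext.1, rfl⟩, _,
      ⟨D ∩ Z, Finset.inter_subset_right, hext.2, rfl⟩, ?_⟩
    rw [← Finset.sum_union hdis, ← hDe]
  · rintro ⟨_, ⟨B, hB, hextB, rfl⟩, _, ⟨C, hC, hextC, rfl⟩, rfl⟩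
    exact ⟨B ∪ C, Finset.union_subset_union hB hC, (hiff B C hB hC).2 ⟨hextB, hextC⟩,
      Finset.sum_union (hd.mono hB hC)⟩

/-- The extensions in `S ∪ Y` are obtained by choosing first the part in `S`. -/
theorem extensionPoints_separator (wt : α → ℝ × ℝ) (A : Finset α) {S Y : Finset α}
    (hd : Disjoint S Y) : ∃ F ⊆ S.powerset, extensionPoints R wt A (S ∪ Y) =
      F.biUnion fun D => {∑ a ∈ D, wt a} + extensionPoints R wt (A \ (S ∪ Y) ∪ D) Y := by
  have hSY : ∀ a, a ∈ S → a ∉ Y := fun a h1 h2 => Finset.disjoint_left.1 hd h1 h2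
  -- `F` contains the choices in `S` that respect the constraints touching `S` but not `Y`; those
  -- touching `Y` are checked when the part in `Y` is chosen.
  refine ⟨S.powerset.filter fun D => ∀ a b, R a b → (a ∈ S ∨ b ∈ S) → a ∉ Y → b ∉ Y →
    b ∈ A \ (S ∪ Y) ∪ D → a ∈ A \ (S ∪ Y) ∪ D, Finset.filter_subset _ _, ?_⟩
  have hiff : ∀ D B : Finset α, D ⊆ S → B ⊆ Y → (IsExtension R A (S ∪ Y) (D ∪ B) ↔
      (∀ a b, R a b → (a ∈ S ∨ b ∈ S) → a ∉ Y → b ∉ Y →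
        b ∈ A \ (S ∪ Y) ∪ D → a ∈ A \ (S ∪ Y) ∪ D) ∧
      IsExtension R (A \ (S ∪ Y) ∪ D) Y B) := by
    intro D B hD hB
    have e : (A \ (S ∪ Y) ∪ D) \ Y ∪ B = A \ (S ∪ Y) ∪ (D ∪ B) := by
      ext a
      have : a ∈ D → a ∉ Y := fun h => hSY a (hD h)
      simp only [Finset.mem_union, Finset.mem_sdiff]
      tauto
    have m : ∀ a, a ∉ Y → (a ∈ A \ (S ∪ Y) ∪ (D ∪ B) ↔ a ∈ A \ (S ∪ Y) ∪ D) := by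
      intro a ha
      have : a ∉ B := fun h => ha (hB h)
      simp only [Finset.mem_union]
      tauto
    unfold IsExtension
    rw [e]
    constructor
    · refine fun h => ⟨fun a b hab hS ha hb => ?_, fun a b hab hY => ?_⟩
      · rw [← m a ha, ← m b hb]
        exact h a b hab (hS.imp (Finset.mem_union_left _) (Finset.mem_union_left _))
      · exact h a b hab (hY.imp (Finset.mem_union_right _) (Finset.mem_union_right _))
    · rintro ⟨h1, h2⟩ a b hab hor
      simp only [Finset.mem_union (s := S)] at hor
      by_cases hY : a ∈ Y ∨ b ∈ Y
      · exact h2 a b hab hY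
      · rw [m a (by tauto), m b (by tauto)]
        exact h1 a b hab (by tauto) (by tauto) (by tauto)
  ext p
  simp only [Finset.mem_biUnion, Finset.mem_add, Finset.mem_singleton, mem_extensionPoints,
    Finset.mem_filter, Finset.mem_powerset]
  constructor
  · rintro ⟨C, hC, hext, rfl⟩
    have hCe : C = C ∩ S ∪ C ∩ Y := by
      rw [← Finset.inter_union_distrib_left, Finset.inter_eq_left.2 hC]
    have hdis : Disjoint (C ∩ S) (C ∩ Y) :=
      hd.mono Finset.inter_subset_right Finset.inter_subset_right
    rw [hCe, hiff _ _ Finset.inter_subset_right Finset.inter_subset_right] at hext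
    refine ⟨C ∩ S, ⟨Finset.inter_subset_right, hext.1⟩, _, rfl, _,
      ⟨C ∩ Y, Finset.inter_subset_right, hext.2, rfl⟩, ?_⟩
    rw [← Finset.sum_union hdis, ← hCe]
  · rintro ⟨D, ⟨hD, hc⟩, _, rfl, _, ⟨B, hB, hext, rfl⟩, rfl⟩
    exact ⟨D ∪ B, Finset.union_subset_union hD hB, (hiff D B hD hB).2 ⟨hc, hext⟩,
      Finset.sum_union (hd.mono hD hB)⟩

variable {G : SimpleGraph α} {ι : Type*} {T : SimpleGraph ι} {bag : ι → Finset α}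

/-- Different colour classes are independent, so their points form a Minkowski sum, under which the
bounds `g j` on the number of upper points minus one add up. -/
theorem card_upper_extensionPoints_colour_le (hRG : ∀ a b, R a b → G.Adj a b) (wt : α → ℝ × ℝ)
    (A Y : Finset α) (c : α → ι) (hc : ∀ u v, G.Adj u v → u ∈ Y → v ∈ Y → c u = c v) (g : ι → ℕ)
    (hg : ∀ j, (upper (extensionPoints R wt A (Y.filter fun v => c v = j))).card ≤ g j + 1)
    (J : Finset ι) :
    (upper (extensionPoints R wt A (Y.filter fun v => c v ∈ J))).card ≤ ∑ j ∈ J, g j + 1 := by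
  induction J using Finset.induction_on with
  | empty => simpa using card_upper_extensionPoints_empty wt A
  | insert j J hj ih =>
    have he : (Y.filter fun v => c v ∈ insert j J)
        = (Y.filter fun v => c v = j) ∪ Y.filter fun v => c v ∈ J := by
      ext v
      simp only [Finset.mem_filter, Finset.mem_union, Finset.mem_insert]
      tauto
    rw [he, extensionPoints_union, Finset.sum_insert hj]
    · exact card_upper_add_le (hg j) ih
    · rw [Finset.disjoint_left]
      intro v hv hv'
      rw [Finset.mem_filter] at hv hv'
      exact hj (hv.2 ▸ hv'.2)
    · intro a b hab
      simp only [Finset.mem_filter]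
      constructor
      · rintro ⟨⟨ha, ha'⟩, hb, hb'⟩
        rw [← hc a b (hRG a b hab) ha hb, ha'] at hb'
        exact hj hb'
      · rintro ⟨⟨ha, ha'⟩, hb, hb'⟩
        rw [hc a b (hRG a b hab) ha hb, hb'] at ha'
        exact hj ha'

/-- The number of upper points is bounded by a power of the number of elements whose exponent
depends on the width of a tree-decomposition. -/
theorem card_upper_extensionPoints_le [Fintype ι] (hRG : ∀ a b, R a b → G.Adj a b)
    (hT : IsTreeDecomposition G T bag) {w : ℕ} (hw : ∀ i, (bag i).card ≤ w + 1) (wt : α → ℝ × ℝ)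
    (A X : Finset α) :
    (upper (extensionPoints R wt A X)).card ≤ (2 * X.card) ^ (w + 2) + 1 := by
  induction hn : X.card using Nat.strong_induction_on generalizing A X with
  | _ n ih =>
  subst hn
  rcases X.eq_empty_or_nonempty with rfl | hX
  · simpa using card_upper_extensionPoints_empty wt A
  obtain ⟨i, c, hc, hhalf⟩ := hT.exists_separator X
  set m := X.card with hm
  have hm0 : 0 < m := Finset.card_pos.2 hX
  set S := X.filter fun v => v ∈ bag i with hS
  set Y := X.filter fun v => v ∉ bag i with hY
  have hXe : X = S ∪ Y := (Finset.filter_union_filter_not_eq (fun v => v ∈ bag i) X).symm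
  have hd : Disjoint S Y := Finset.disjoint_filter_filter_not X X fun v => v ∈ bag i
  have hcard : S.card + Y.card = m := by rw [← Finset.card_union_of_disjoint hd, ← hXe]
  have hScard : S.card ≤ w + 1 :=
    (Finset.card_le_card fun v hv => (Finset.mem_filter.1 hv).2).trans (hw i)
  have hYj : ∀ j, 2 * (Y.filter fun v => c v = j).card ≤ m := by
    intro j
    rw [hY, Finset.filter_filter]
    exact hhalf j
  -- Since `2 * m_j ≤ m` for the class sizes `m_j`, all but one factor of `(2 * m_j) ^ (w + 2)` can
  -- be replaced by `m`; the last factors sum to `2 * Y.card`.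
  have hpart : ∀ A' : Finset α, (upper (extensionPoints R wt A' Y)).card
      ≤ m ^ (w + 1) * (2 * Y.card) + 1 := by
    intro A'
    have h1 := card_upper_extensionPoints_colour_le hRG wt A' Y c
      (fun u v huv hu hv => hc u v huv (Finset.mem_filter.1 hu).2 (Finset.mem_filter.1 hv).2)
      (fun j => (2 * (Y.filter fun v => c v = j).card) ^ (w + 2))
      (fun j => ih _ (by have := hYj j; omega) A' _ rfl) Finset.univ
    simp only [Finset.mem_univ, Finset.filter_true] at h1
    refine h1.trans (Nat.add_le_add_right ?_ 1)
    calc ∑ j, (2 * (Y.filter fun v => c v = j).card) ^ (w + 2)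
        ≤ ∑ j, m ^ (w + 1) * (2 * (Y.filter fun v => c v = j).card) := by
          refine Finset.sum_le_sum fun j _ => ?_
          rw [pow_succ]
          exact Nat.mul_le_mul_right _ (Nat.pow_le_pow_left (hYj j) _)
      _ = m ^ (w + 1) * (2 * Y.card) := by
          rw [← Finset.mul_sum, ← Finset.mul_sum,
            ← Finset.card_eq_sum_card_fiberwise (f := c) (t := Finset.univ) (by simp [Set.MapsTo])]
  obtain ⟨F, hF, hFe⟩ := extensionPoints_separator (R := R) wt A hd
  have htotal : (upper (extensionPoints R wt A X)).card
      ≤ 2 ^ S.card * (m ^ (w + 1) * (2 * Y.card) + 1) := by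
    rw [hXe, hFe]
    refine (card_upper_biUnion_le _ _).trans ?_
    refine (Finset.sum_le_card_nsmul F _ _ fun D _ => ?_).trans
      (Nat.mul_le_mul_right _ ((Finset.card_le_card hF).trans (Finset.card_powerset S).le))
    have h0 : (upper ({∑ a ∈ D, wt a} : Finset (ℝ × ℝ))).card ≤ 0 + 1 :=
      (Finset.card_le_card (Finset.filter_subset _ _)).trans (by simp)
    -- Adding a single point is a translation and costs nothing.
    simpa using card_upper_add_le h0 (hpart (A \ (S ∪ Y) ∪ D))
  refine htotal.trans ?_
  have hpow : m ^ (w + 2) = m ^ (w + 1) * m := pow_succ _ _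
  have hM : 1 ≤ m ^ (w + 1) := Nat.one_le_pow _ _ hm0
  -- If the bag meets `X`, then `Y` is smaller than `X`, which absorbs the summand `1` before it is
  -- multiplied by `2 ^ S.card`. If it does not, there is only one choice and the summand can stay.
  rcases Nat.eq_zero_or_pos S.card with h0 | h0
  · rw [h0, pow_zero, one_mul, mul_pow, hpow, show Y.card = m by omega]
    have : 2 ≤ 2 ^ (w + 2) := Nat.le_self_pow (by omega) _
    have := Nat.mul_le_mul_right (m ^ (w + 1) * m) this
    rw [show m ^ (w + 1) * (2 * m) = 2 * (m ^ (w + 1) * m) by ring]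
    omega
  · have h1 : m ^ (w + 1) * (2 * Y.card) + 1 ≤ 2 * m ^ (w + 2) := by
      have : Y.card + 1 ≤ m := by omega
      have := Nat.mul_le_mul_left (m ^ (w + 1)) this
      rw [hpow]
      rw [show m ^ (w + 1) * (2 * Y.card) = 2 * (m ^ (w + 1) * Y.card) by ring]
      rw [mul_add] at this
      omega
    calc 2 ^ S.card * (m ^ (w + 1) * (2 * Y.card) + 1)
        ≤ 2 ^ (w + 1) * (2 * m ^ (w + 2)) :=
          Nat.mul_le_mul (Nat.pow_le_pow_right (by omega) hScard) h1
      _ = (2 * m) ^ (w + 2) := by rw [mul_pow]; ring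
      _ ≤ _ := Nat.le_succ _

end Extensions

/-! ### The number of vertices of the polygon -/

section Count

open scoped Classical

variable {α : Type*} [Fintype α] [PartialOrder α]

/-- In a finite order the covers generate all comparabilities. This reduces the constraints to edges
of the Hasse diagram, the only ones covered by the bags. -/
theorem isLowerSet_iff_covBy (s : Set α) : IsLowerSet s ↔ ∀ a b, a ⋖ b → b ∈ s → a ∈ s := by
  let : LocallyFiniteOrder α := Fintype.toLocallyFiniteOrder
  refine ⟨fun h a b hab hb => h hab.le hb, fun h b a hab hb => ?_⟩
  have := le_iff_reflTransGen_covBy.1 hab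
  induction this using Relation.ReflTransGen.head_induction_on with
  | refl => exact hb
  | head hac hcb ih => exact h _ _ hac (ih (le_iff_reflTransGen_covBy.2 hcb))

theorem lowerSetPoints_eq (wt : α → ℝ × ℝ) :
    {p | ∃ L : LowerSet α, p = project wt (L : Set α)}
      = (extensionPoints (fun a b : α => a ⋖ b) wt ∅ Finset.univ : Set (ℝ × ℝ)) := by
  have hproj : ∀ B : Finset α, project wt (B : Set α) = ∑ a ∈ B, wt a := fun B => by
    unfold project
    exact Finset.sum_congr (by ext; simp) fun _ _ => rfl
  have hext : ∀ B : Finset α, IsExtension (fun a b : α => a ⋖ b) ∅ Finset.univ B ↔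
      IsLowerSet (B : Set α) := fun B => by
    rw [isLowerSet_iff_covBy]
    simp [IsExtension]
  ext p
  rw [Finset.mem_coe, mem_extensionPoints]
  constructor
  · rintro ⟨L, rfl⟩
    refine ⟨(L : Set α).toFinset, Finset.subset_univ _, (hext _).2 ?_, ?_⟩
    · rw [Set.coe_toFinset]; exact L.lower
    · rw [← hproj, Set.coe_toFinset]
  · rintro ⟨B, -, hB, rfl⟩
    exact ⟨⟨B, (hext B).1 hB⟩, (hproj B).symm⟩

theorem finite_vertices_poly (wt : α → ℝ × ℝ) : (vertices (poly wt)).Finite := by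
  unfold poly
  rw [lowerSetPoints_eq]
  exact (Finset.finite_toSet _).subset extremePoints_convexHull_subset

/-- The polygon of a partial order has at most `n ^ O(w)` vertices. -/
theorem ncard_vertices_poly_le (wt : α → ℝ × ℝ) :
    (vertices (poly wt)).ncard
      ≤ 2 * ((2 * Fintype.card α) ^ (treewidth (SimpleGraph.hasse α) + 2) + 1) := by
  obtain ⟨m, T, bag, hT, hw⟩ := exists_treeDecomposition (SimpleGraph.hasse α)
  have key : ∀ wt : α → ℝ × ℝ,
      (upper (extensionPoints (fun a b : α => a ⋖ b) wt ∅ Finset.univ)).card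
        ≤ (2 * Fintype.card α) ^ (treewidth (SimpleGraph.hasse α) + 2) + 1 := fun wt =>
    card_upper_extensionPoints_le (fun a b hab => SimpleGraph.hasse_adj.2 (.inl hab)) hT hw wt ∅
      Finset.univ
  -- Reflecting the points is the same as negating the weights, so `key` covers both halves of the
  -- hull.
  have hneg : (extensionPoints (fun a b : α => a ⋖ b) wt ∅ Finset.univ).image Neg.neg
      = extensionPoints (fun a b : α => a ⋖ b) (-wt) ∅ Finset.univ := by
    rw [extensionPoints, extensionPoints, Finset.image_image]
    refine Finset.image_congr fun B _ => ?_
    simp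
  have hsub := vertices_subset (extensionPoints (fun a b : α => a ⋖ b) wt ∅ Finset.univ)
  rw [← lowerSetPoints_eq] at hsub
  refine (Set.ncard_le_ncard hsub ?_).trans ((Set.ncard_union_le _ _).trans ?_)
  · exact (Finset.finite_toSet _).union ((Finset.finite_toSet _).image _)
  · have h1 := key wt
    have h2 := Set.ncard_image_le (f := (Neg.neg : ℝ × ℝ → ℝ × ℝ)) (Finset.finite_toSet
      (upper ((extensionPoints (fun a b : α => a ⋖ b) wt ∅ Finset.univ).image Neg.neg)))
    rw [hneg] at h2 ⊢
    rw [Set.ncard_coe_finset] at h2 ⊢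
    have h3 := key (-wt)
    omega

end Count

/-! ### The constant in the exponent -/

/-- With base `N ≥ 2` every constant is a power of `N`: the count costs `6 * W + 3`, the factor
`10000` costs `14` and `(n + 1) ^ 5` costs `10`. The total `6 * W + 27` is at most `33 * W` because
`W ≥ 1`. -/
theorem bounds_le_pow (n w V : ℕ) (hV : V ≤ 2 * ((2 * n) ^ (w + 2) + 1)) :
    V ≤ max n 2 ^ (33 * max w 1) ∧
      10000 * (V + 1) * (n + 1) ^ 5 ≤ max n 2 ^ (33 * max w 1) := by
  set N := max n 2
  set W := max w 1
  have hN : 2 ≤ N := le_max_right _ _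
  have hn : n ≤ N := le_max_left _ _
  have hW : 1 ≤ W := le_max_right _ _
  have hw : w ≤ W := le_max_left _ _
  have hN1 : 1 ≤ N := by omega
  have h2n : 2 * n ≤ N ^ 2 := by
    rw [pow_two]; exact Nat.mul_le_mul hN hn
  have hn1 : n + 1 ≤ N ^ 2 := by nlinarith
  have h1 : (2 * n) ^ (w + 2) ≤ N ^ (6 * W) :=
    calc (2 * n) ^ (w + 2) ≤ (N ^ 2) ^ (w + 2) := Nat.pow_le_pow_left h2n _
      _ = N ^ (2 * (w + 2)) := (pow_mul _ _ _).symm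
      _ ≤ N ^ (6 * W) := Nat.pow_le_pow_right hN1 (by omega)
  have hone : 1 ≤ N ^ (6 * W) := Nat.one_le_pow _ _ hN1
  have hV1 : V + 1 ≤ N ^ (6 * W + 3) := by
    have : 8 ≤ N ^ 3 := Nat.pow_le_pow_left hN 3
    calc V + 1 ≤ N ^ (6 * W) * 8 := by omega
      _ ≤ N ^ (6 * W) * N ^ 3 := Nat.mul_le_mul_left _ this
      _ = _ := (pow_add _ _ _).symm
  refine ⟨(Nat.le_succ V).trans (hV1.trans (Nat.pow_le_pow_right hN1 (by omega))), ?_⟩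
  have h3 : 10000 ≤ N ^ 14 := (by norm_num : 10000 ≤ 2 ^ 14).trans (Nat.pow_le_pow_left hN 14)
  calc 10000 * (V + 1) * (n + 1) ^ 5 ≤ N ^ 14 * N ^ (6 * W + 3) * (N ^ 2) ^ 5 :=
        Nat.mul_le_mul (Nat.mul_le_mul h3 hV1) (Nat.pow_le_pow_left hn1 5)
    _ = N ^ (6 * W + 27) := by rw [← pow_mul, ← pow_add, ← pow_add]; congr 1; ring
    _ ≤ N ^ (33 * W) := Nat.pow_le_pow_right hN1 (by omega)

end ParametricClosure

theorem mainTheorem3 :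
    ∃ (C : ℕ) (p : Prog), ∀ (α : Type*) [Fintype α] [PartialOrder α] (n w : ℕ),
      Fintype.card α = n → treewidth (SimpleGraph.hasse α) = w →
      ∀ wt : α → ℝ × ℝ,
        (vertices (poly wt)).encard ≤ ((max n 2 ^ (C * max w 1) : ℕ) : ℕ∞) ∧
        ∀ e : Fin n ≃ α, ∃ (s : State) (t : ℕ),
          Exec p (inputState e wt) s t ∧ t ≤ max n 2 ^ (C * max w 1) ∧
          IsVertexList (poly wt) (output s) := by
  refine ⟨33, polygonProgram, fun α _ _ n w hn hw wt => ?_⟩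
  have hV := ncard_vertices_poly_le wt
  rw [hn, hw] at hV
  obtain ⟨h1, h2⟩ := bounds_le_pow n w _ hV
  have hfin := finite_vertices_poly wt
  refine ⟨?_, fun e => ?_⟩
  · rw [← hfin.cast_ncard_eq]
    exact_mod_cast h1
  · obtain ⟨s, t, hexec, ht, hs⟩ := polygonProgram_spec e wt hfin
    exact ⟨s, t, hexec, ht.trans h2, hs⟩
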